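/- **Setting.** Let $d\in\{2,3\}$, $r\ge 2$, and let $\mathcal T^h$ be a conforming simplicial mesh in $\mathbb R^d$ with closed elements $\tau$ and mesh diameter $h=\max_\tau \operatorname{diam}\tau$; $\Omega$ is the interior of $\bigcup\tau$ (a polygonal/polyhedral domain), $\Gamma=\partial\Omega$, $\Gamma_D\subseteq\Gamma$ is a (possibly empty) union of closed element facets and $\Gamma_I=\Gamma\setminus\Gamma_D$. Let $\mathcal V^h$ be the space of continuous functions on $\overline\Omega$ that are polynomials of degree $\le r-1$ on each element and vanish on $\Gamma_D$, with a real nodal basis $\{\phi_p\}_{p\in\mathcal I^h}$, $\phi_p(x_q)=\delta_{pq}$, whose nodes $x_p$ are the affine images, in the elements, of a fixed set of points of the reference simplex that is unisolvent for polynomials of degree $\le r-1$ (e.g. the Lagrange nodes), those on $\Gamma_D$ being left out. For $D\subseteq\Omega$, $G\subseteq\partial D$, put $$a_{D,G}(u,v)=\int_D\nabla u\cdot\overline{\nabla v}-(k^2+\mathrm i\varepsilon)\int_D u\overline v-\mathrm i\eta\int_G u\overline v ,$$ where $k>0$, $\varepsilon\in\mathbb R$, $|\varepsilon|\le k^2$,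 and either $\eta=\operatorname{sign}(\varepsilon)k$ or $\eta=\sqrt{k^2+\mathrm i\varepsilon}$ (the root with positive imaginary part). Let $A_\varepsilon=(a_{\Omega,\Gamma_I}(\phi_q,\phi_p))_{p,q}$, $S=(\int_\Omega\nabla\phi_p\cdot\nabla\phi_q)$, $M=(\int_\Omega\phi_p\phi_q)$, $D_k=S+k^2M$, $\langle \mathbf V,\mathbf W\rangle_{D_k}=\mathbf W^*D_k\mathbf V$. Let $\Omega_1,\dots,\Omega_N$ be an open cover of $\Omega$, each $\Omega_\ell$ being the interior of a non-empty union of elements, of characteristic length scale $H_\ell$ (i.e. diameter $\sim H_\ell$, surface area $\sim H_\ell^{d-1}$, volume $\sim H_\ell^d$), $H=\max_\ell H_\ell$. Let $0<\delta_\ell\lesssim H$, $\delta=\min_\ell\delta_\ell$, and assume that for some $b\in(0,1)$ the part of $\Omega_\ell$ that is overlapped by other subdomains contains all points of $\Omega_\ell$ at distance $\le b\delta_\ell$ from $\partial\Omega_\ell\setminus\Gamma$ and is contained in the set of points of $\Omega_\ell$ at distance $\le\delta_\ell$ from it. Let $\Lambda=\max_\ell\#\{\ell':\overline{\Omega_\ell}\cap\overline{\Omega_{\ell'}}\ne\emptyset\}$.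 Let $\chi_\ell:\overline\Omega\to[0,1]$ be continuous, affine on each element, zero outside $\overline{\Omega_\ell}$, with $\sum_\ell\chi_\ell=1$ on $\overline\Omega$ and $\|\nabla\chi_\ell\|_{\infty,\tau}\lesssim\delta_\ell^{-1}$. With $\mathcal I^h(\overline{\Omega_\ell})=\{p:x_p\in\overline{\Omega_\ell}\}$ let $A_{\varepsilon,\ell}=(a_{\Omega_\ell,\partial\Omega_\ell\setminus\Gamma_D}(\phi_q,\phi_p))_{p,q\in\mathcal I^h(\overline{\Omega_\ell})}$, $(R_\ell\mathbf V)_p=\chi_\ell(x_p)V_p$ for $p\in\mathcal I^h(\overline{\Omega_\ell})$, and $B_\varepsilon^{-1}=\sum_\ell R_\ell^\top A_{\varepsilon,\ell}^{-1}R_\ell$. The mesh is shape regular and $kh\lesssim1$. All constants hidden in $\lesssim$ and $\sim$, here and below, are bounded by a fixed $K\ge1$. **Corollary 3.13.** (i) Let $0<\alpha,\beta<1$. There is $C>0$, depending only on $d$, $r$, the reference nodes, $K$, $\alpha$ and $\beta$, and for each value of $\Lambda$ there is $k_0>0$ (depending in addition on $\Lambda$) such that, whenever $k\ge k_0$, $|\varepsilon|\sim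 k^{1+\beta}$, $\delta\sim H$ and $H\sim k^{-\alpha}$, all $A_{\varepsilon,\ell}$ are invertible and $$\min_{\mathbf 0\ne\mathbf V\in\mathbb C^n}\frac{|\langle\mathbf V,B_\varepsilon^{-1}A_\varepsilon\mathbf V\rangle_{D_k}|}{\|\mathbf V\|_{D_k}^2}\ \ge\ \frac1\Lambda-C\,k^{\alpha-\beta}.$$ (ii) For fixed $\delta>0$ and $\Lambda$ there are $C,k_0>0$, depending only on $d$, $r$, the reference nodes, $K$, $\delta$ and $\Lambda$, such that, whenever $|\varepsilon|=Ck$ and $k\ge k_0$, all $A_{\varepsilon,\ell}$ are invertible and $$\min_{\mathbf 0\ne\mathbf V\in\mathbb C^n}\frac{|\langle\mathbf V,B_\varepsilon^{-1}A_\varepsilon\mathbf V\rangle_{D_k}|}{\|\mathbf V\|_{D_k}^2}\ \ge\ \frac1{2\Lambda}.$$ -/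

import Mathlib

open MeasureTheory

noncomputable section

namespace Helmholtz

/-- The ambient space `ℝ^d` with its Euclidean norm. -/
abbrev E (d : ℕ) : Type := EuclideanSpace ℝ (Fin d)

/-- `a ∼ b` with hidden constant `K`. -/
def Comparable (K a b : ℝ) : Prop := a ≤ K * b ∧ b ≤ K * a

/-- On the set `s`, the function `v` is a polynomial of total degree at most `m`. -/
def IsPolyOn {d : ℕ} (m : ℕ) (v : E d → ℝ) (s : Set (E d)) : Prop :=
  ∃ p : MvPolynomial (Fin d) ℝ, p.totalDegree ≤ m ∧
    ∀ x ∈ s, v x = MvPolynomial.eval (fun j => x j) p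

/-- A finite set `X` of points of the reference simplex
`{x : x j ≥ 0, ∑ j, x j ≤ 1}` that is unisolvent for polynomials of total degree `≤ m`. The
equispaced (principal lattice) points give the standard Lagrange element. -/
def IsReferenceNodeSet {d : ℕ} (m : ℕ) (X : Finset (Fin d → ℝ)) : Prop :=
  (∀ x ∈ X, (∀ j, 0 ≤ x j) ∧ ∑ j, x j ≤ 1) ∧
  ∀ c : (Fin d → ℝ) → ℝ, ∃! p : MvPolynomial (Fin d) ℝ,
    p.totalDegree ≤ m ∧ ∀ x ∈ X, MvPolynomial.eval x p = c x

/-- The closed simplex spanned by the vertices. -/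
def cellOf {d : ℕ} (s : Affine.Simplex ℝ (E d) d) : Set (E d) :=
  convexHull ℝ (Set.range s.points)

/-- The closed facet opposite to vertex number `m`. -/
def facetOf {d : ℕ} (s : Affine.Simplex ℝ (E d) d) (m : Fin (d + 1)) : Set (E d) :=
  convexHull ℝ (s.points '' {m}ᶜ)

/-- The image of a reference point under the affine map that sends the reference simplex to the
simplex `s` (vertices in the given order). -/
def refPoint {d : ℕ} (s : Affine.Simplex ℝ (E d) d) (x : Fin d → ℝ) : E d :=
  s.points 0 + ∑ j, x j • (s.points j.succ - s.points 0)

/-- A conforming simplicial mesh, together with a set of boundary facets that make up the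
Dirichlet boundary (so that the Dirichlet boundary is closed and resolved by the mesh).
The domain is the interior of the union of the (closed) elements. -/
structure Mesh (d : ℕ) where
  numElem : ℕ
  elem : Fin numElem → Affine.Simplex ℝ (E d) d
  elem_injective : Function.Injective fun i => Set.range (elem i).points
  conforming : ∀ i j, cellOf (elem i) ∩ cellOf (elem j) =
    convexHull ℝ (Set.range (elem i).points ∩ Set.range (elem j).points)
  dirichletFacets : Finset (Fin numElem × Fin (d + 1))
  dirichletFacets_subset : ∀ f ∈ dirichletFacets,
    facetOf (elem f.1) f.2 ⊆ frontier (interior (⋃ i, cellOf (elem i)))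

namespace Mesh

variable {d : ℕ} (T : Mesh d)

/-- The closed element number `i`. -/
def cell (i : Fin T.numElem) : Set (E d) := cellOf (T.elem i)

/-- The domain `Ω`. -/
def Ω : Set (E d) := interior (⋃ i, T.cell i)

/-- The boundary `Γ` of `Ω`. -/
def Γ : Set (E d) := frontier T.Ω

/-- The Dirichlet part of the boundary. -/
def ΓD : Set (E d) := ⋃ f ∈ T.dirichletFacets, facetOf (T.elem f.1) f.2

/-- The impedance part of the boundary. -/
def ΓI : Set (E d) := T.Γ \ T.ΓD

/-- The mesh diameter `h`. -/
def h : ℝ := ⨆ i, Metric.diam (T.cell i)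

/-- Shape regularity with constant `K`: each element contains a ball of radius comparable to its
diameter. -/
def ShapeRegular (K : ℝ) : Prop :=
  ∀ i, ∃ (x : E d) (ρ : ℝ), Metric.closedBall x ρ ⊆ T.cell i ∧ Metric.diam (T.cell i) ≤ K * ρ

/-- Continuous functions on the closure of `Ω` that are polynomial of total degree `≤ m` on each
element (only the values on the closure of `Ω` are relevant). -/
def IsPiecewisePoly (m : ℕ) (v : E d → ℝ) : Prop :=
  ContinuousOn v (closure T.Ω) ∧ ∀ i, IsPolyOn m v (T.cell i)

open Classical in
/-- The nodes of the finite element space: the images of the reference nodes in all elements,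
without those on the Dirichlet boundary. -/
def nodes (X : Finset (Fin d → ℝ)) : Finset (E d) :=
  ((Finset.univ ×ˢ X).image fun q : Fin T.numElem × (Fin d → ℝ) =>
    refPoint (T.elem q.1) q.2).filter fun x => x ∉ T.ΓD

end Mesh

/-- The form `∫_D ∇u·∇v - (k² + iε) ∫_D u v - i η ∫_G u v` for real-valued functions `u`, `v`
(for which complex conjugation of `v` is void), `G` a part of the boundary of `D`. -/
def helmholtzForm {d : ℕ} (D G : Set (E d)) (k ε : ℝ) (η : ℂ) (u v : E d → ℝ) : ℂ :=
  ((∫ x in D, inner ℝ (gradient u x) (gradient v x) : ℝ) : ℂ)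
    - ((k : ℂ) ^ 2 + Complex.I * ε) * ((∫ x in D, u x * v x : ℝ) : ℂ)
    - Complex.I * η * ((∫ x in G, u x * v x ∂(μHE[d - 1]) : ℝ) : ℂ)

/-- `D` has characteristic length scale `L` (with hidden constant `K`). -/
def HasLengthScale {d : ℕ} (K : ℝ) (D : Set (E d)) (L : ℝ) : Prop :=
  Comparable K (Metric.diam D) L ∧
  Comparable K ((μHE[d - 1] : Measure (E d)).real (frontier D)) (L ^ (d - 1)) ∧
  Comparable K ((volume : Measure (E d)).real D) (L ^ d)

/-- The data of the method: a mesh with Dirichlet boundary, the finite element space of degree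
`r - 1` with its nodal basis, the overlapping subdomains with their length scales `Hl` and overlap
parameters `δl`, and the partition of unity. -/
structure Setup (d r : ℕ) (X : Finset (Fin d → ℝ)) where
  mesh : Mesh d
  /-- The nodal basis. -/
  φ : mesh.nodes X → E d → ℝ
  φ_poly : ∀ p, mesh.IsPiecewisePoly (r - 1) (φ p)
  φ_dirichlet : ∀ p, ∀ x ∈ mesh.ΓD, φ p x = 0
  φ_nodal : ∀ p q : mesh.nodes X, φ p q = if p = q then 1 else 0
  /-- The number of subdomains. -/
  N : ℕ
  /-- The elements that make up each subdomain. -/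
  sub : Fin N → Finset (Fin mesh.numElem)
  sub_nonempty : ∀ l, (sub l).Nonempty
  cover : mesh.Ω ⊆ ⋃ l, interior (⋃ i ∈ sub l, mesh.cell i)
  Hl : Fin N → ℝ
  Hl_pos : ∀ l, 0 < Hl l
  δl : Fin N → ℝ
  δl_pos : ∀ l, 0 < δl l
  /-- The partition of unity: continuous and piecewise linear. -/
  χ : Fin N → E d → ℝ
  χ_poly : ∀ l, mesh.IsPiecewisePoly 1 (χ l)
  χ_mem : ∀ l, ∀ x ∈ closure mesh.Ω, χ l x ∈ Set.Icc (0 : ℝ) 1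
  χ_support : ∀ l, ∀ x ∈ closure mesh.Ω, χ l x ≠ 0 →
    x ∈ closure (interior (⋃ i ∈ sub l, mesh.cell i))
  χ_sum : ∀ x ∈ closure mesh.Ω, ∑ l, χ l x = 1

namespace Setup

variable {d r : ℕ} {X : Finset (Fin d → ℝ)} (P : Setup d r X)

/-- The subdomain `Ω_ℓ`. -/
def Ωl (l : Fin P.N) : Set (E d) := interior (⋃ i ∈ P.sub l, P.mesh.cell i)

/-- The largest subdomain length scale. -/
def H : ℝ := ⨆ l, P.Hl l

/-- The smallest overlap parameter. -/
def δ : ℝ := ⨅ l, P.δl l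

open Classical in
/-- The maximal number `Λ` of subdomains whose closures meet the closure of a given one. -/
def Λ : ℕ :=
  Finset.univ.sup fun l : Fin P.N =>
    (Finset.univ.filter fun l' : Fin P.N =>
      (closure (P.Ωl l) ∩ closure (P.Ωl l')).Nonempty).card

/-- The part of `Ω_ℓ` that is not overlapped by any other subdomain. -/
def nonOverlapped (l : Fin P.N) : Set (E d) := P.Ωl l \ ⋃ l' ∈ ({l}ᶜ : Set (Fin P.N)), P.Ωl l'

/-- The points of `Ω_ℓ` at distance at most `μ` from the interior boundary of `Ω_ℓ`. -/
def nearBoundary (l : Fin P.N) (μ : ℝ) : Set (E d) :=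
  {x ∈ P.Ωl l | Metric.infEDist x (frontier (P.Ωl l) \ P.mesh.Γ) ≤ ENNReal.ofReal μ}

/-- The overlap condition, with constant `b`. -/
def OverlapCondition (b : ℝ) : Prop :=
  ∀ l, P.nearBoundary l (b * P.δl l) ⊆ P.Ωl l \ P.nonOverlapped l ∧
    P.Ωl l \ P.nonOverlapped l ⊆ P.nearBoundary l (P.δl l)

/-- The standing assumptions on mesh, subdomains, overlap and partition of unity, with a single
constant `K` for all the hidden constants. -/
def Regular (K : ℝ) : Prop :=
  P.mesh.ShapeRegular K ∧
  (∀ l, HasLengthScale K (P.Ωl l) (P.Hl l)) ∧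
  (∀ l, P.δl l ≤ K * P.H) ∧
  (∃ b : ℝ, 0 < b ∧ b < 1 ∧ P.OverlapCondition b) ∧
  (∀ l i, ∀ x ∈ interior (P.mesh.cell i), ‖gradient (P.χ l) x‖ ≤ K / P.δl l)

/-- The index set of the nodes. -/
abbrev Idx : Type := P.mesh.nodes X

open Classical in
/-- The index set of the nodes on the closure of `Ω_ℓ`. -/
abbrev LocIdx (l : Fin P.N) : Type :=
  {p : P.Idx // (p : E d) ∈ closure (P.Ωl l)}

open Classical in
instance (l : Fin P.N) : Fintype (P.LocIdx l) := Subtype.fintype _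

/-- The stiffness matrix. -/
def stiffness : Matrix P.Idx P.Idx ℝ := fun p q =>
  ∫ x in P.mesh.Ω, inner ℝ (gradient (P.φ p) x) (gradient (P.φ q) x)

/-- The domain mass matrix. -/
def mass : Matrix P.Idx P.Idx ℝ := fun p q => ∫ x in P.mesh.Ω, P.φ p x * P.φ q x

/-- `D_k = S + k² M`, the matrix of the Helmholtz energy inner product. -/
def Dk (k : ℝ) : Matrix P.Idx P.Idx ℂ := (P.stiffness + k ^ 2 • P.mass).map (fun t => (t : ℂ))

/-- The system matrix `A_ε`. -/
def A (k ε : ℝ) (η : ℂ) : Matrix P.Idx P.Idx ℂ := fun p q =>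
  helmholtzForm P.mesh.Ω P.mesh.ΓI k ε η (P.φ q) (P.φ p)

/-- The matrix `A_{ε,ℓ}` of the local impedance problem on `Ω_ℓ`. -/
def Aloc (k ε : ℝ) (η : ℂ) (l : Fin P.N) : Matrix (P.LocIdx l) (P.LocIdx l) ℂ := fun p q =>
  helmholtzForm (P.Ωl l) (frontier (P.Ωl l) \ P.mesh.ΓD) k ε η (P.φ q) (P.φ p)

open Classical in
/-- The weighted restriction matrix: `(R_ℓ V)_p = χ_ℓ(x_p) V_p`. -/
def R (l : Fin P.N) : Matrix (P.LocIdx l) P.Idx ℂ := fun p q =>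
  if (p : P.Idx) = q then (P.χ l (p : P.Idx) : ℂ) else 0

open Classical in
/-- The preconditioner `B_ε⁻¹ = ∑_ℓ R_ℓᵀ A_{ε,ℓ}⁻¹ R_ℓ`. -/
def Binv (k ε : ℝ) (η : ℂ) : Matrix P.Idx P.Idx ℂ :=
  ∑ l, (P.R l).transpose * (P.Aloc k ε η l)⁻¹ * P.R l

/-- `⟨V, W⟩_{D_k} = W^* D_k V`. -/
def innerDk (k : ℝ) (V W : P.Idx → ℂ) : ℂ := star W ⬝ᵥ (P.Dk k).mulVec V

/-- The norm induced by `D_k`. -/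
def normDk (k : ℝ) (V : P.Idx → ℂ) : ℝ := Real.sqrt (P.innerDk k V V).re

open Classical in
/-- All local matrices are invertible (so that the preconditioner is well defined), and the field
of values of `B_ε⁻¹ A_ε` in the `D_k` inner product has distance at least `c` from the origin. -/
def FieldOfValuesBound (k ε : ℝ) (η : ℂ) (c : ℝ) : Prop :=
  (∀ l, IsUnit (P.Aloc k ε η l)) ∧
  ∀ V : P.Idx → ℂ, V ≠ 0 →
    c ≤ ‖P.innerDk k V ((P.Binv k ε η * P.A k ε η).mulVec V)‖ / P.normDk k V ^ 2

end Setup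

/-- The two admissible impedance parameters for `ε ≠ 0`: `η = sign(ε) k`, or `η = √(k² + iε)`, the
square root with branch cut on the positive real axis, i.e. with positive imaginary part. -/
def ImpedanceChoice (k ε : ℝ) (η : ℂ) : Prop :=
  η = ((SignType.sign ε : ℝ) * k : ℝ) ∨ (η ^ 2 = (k : ℂ) ^ 2 + Complex.I * ε ∧ 0 < η.im)

/-- The standing assumptions for `K`, `k`, `ε`, `η`, including `k h ≲ 1`. -/
def Admissible {d r : ℕ} {X : Finset (Fin d → ℝ)} (P : Setup d r X) (K k ε : ℝ) (η : ℂ) : Prop :=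
  P.Regular K ∧ k * P.mesh.h ≤ K ∧ |ε| ≤ k ^ 2 ∧ ImpedanceChoice k ε η

end Helmholtz

end

open MeasureTheory

noncomputable section

namespace Helmholtz

/-! ### Polynomial functions on Euclidean space -/

/-! Write `T_l` for nodal multiplication by `χ_l` and `a_l` for the local impedance form on `Ω_l`. A
nodal basis function whose node sees `χ_l` vanishes on all elements outside `Ω_l`, so in the rows
weighted by `χ_l` the global matrix may be replaced by the local one (`Setup.χ_mul_A`). Hence `B⁻¹ A
V = ∑_l T_l U_l`, where `U_l` solves `a_l(U_l, W) = a_l(V, T_l W)` for all `W` supported on the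
nodes of `Ω_l`.

On one element `χ_l` varies by at most a multiple of `diam / δ`, so by inverse estimates and `kh ≲
1` the operator `T_l` differs from multiplication by the number `c_{l,i} = χ_l(vertex of element i)`
by `O(1/(kδ))` in the energy norm. Therefore the commutator `a_l(T_l V, W) - a_l(V, T_l W)` has size
`σ ∼ 1/(kδ)`. The form `a_l` is coercive with constant `γ ∼ |ε|/k²`, after multiplication by a
suitable complex number (`exists_multiplier`). The error `e_l = U_l - T_l V` solves a local problem
whose right-hand side is this commutator, so it has relative size `t = σ/γ ∼ k/(|ε|δ)`.

The inner product of `V` with `∑_l T_l (T_l V + e_l)` has as leading part `∑_l ∑_i c_{l,i}² ‖V‖_i²`.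
Since `∑_l c_{l,i} = 1` with at most `Λ` nonzero terms, Cauchy-Schwarz bounds this below by
`‖V‖²/Λ`. Summing plain bounds for `e_l` over `l` would cost a factor `Λ t`. Coercivity in the norm
weighted by `c_{l,i}` avoids this: the first-order error sums to `t ∑_l ∑_i c_{l,i} ‖V‖_i² = t
‖V‖²`, and `Λ` enters only with `t²`. This is why the constant in (i) can be independent of `Λ`.

The abstract argument is `schwarz_lower_bound`. Its hypotheses come from
`Setup.exists_weight_estimate` (volume terms), `Setup.exists_boundary_estimate` (impedance term),
`localForm_coercive` and `localForm_weighted_coercive`. They are assembled in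
`Setup.exists_fieldOfValuesBound`, from which both parts follow by inserting the sizes of `|ε|` and
`δ`. -/

/-- The function on `ℝ^d` given by a polynomial. -/
def polyFun {d : ℕ} (p : MvPolynomial (Fin d) ℝ) (x : E d) : ℝ :=
  MvPolynomial.eval (fun j => x j) p

lemma polyFun_smul {d : ℕ} (a : ℝ) (p : MvPolynomial (Fin d) ℝ) (x : E d) :
    polyFun (a • p) x = a * polyFun p x := by
  simp [polyFun, MvPolynomial.smul_eval]

lemma polyFun_sum {d : ℕ} {ι : Type*} (s : Finset ι) (p : ι → MvPolynomial (Fin d) ℝ) (x : E d) :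
    polyFun (∑ i ∈ s, p i) x = ∑ i ∈ s, polyFun (p i) x := by
  simp [polyFun]

lemma contDiff_polyFun {d : ℕ} (p : MvPolynomial (Fin d) ℝ) : ContDiff ℝ 1 (polyFun p) := by
  induction p using MvPolynomial.induction_on with
  | C a =>
    have : polyFun (MvPolynomial.C a : MvPolynomial (Fin d) ℝ) = fun _ => a := by
      ext x; simp [polyFun]
    rw [this]; exact contDiff_const
  | add p q hp hq =>
    have : polyFun (p + q) = fun x => polyFun p x + polyFun q x := by
      ext x; simp [polyFun]
    rw [this]; exact hp.add hq
  | mul_X p j hp =>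
    have : polyFun (p * MvPolynomial.X j) = fun x => polyFun p x * x j := by
      ext x; simp [polyFun]
    rw [this]
    exact hp.mul (by fun_prop)

lemma continuous_polyFun {d : ℕ} (p : MvPolynomial (Fin d) ℝ) : Continuous (polyFun p) :=
  (contDiff_polyFun p).continuous

lemma differentiable_polyFun {d : ℕ} (p : MvPolynomial (Fin d) ℝ) : Differentiable ℝ (polyFun p) :=
  (contDiff_polyFun p).differentiable (by norm_num)

lemma continuous_fderiv_polyFun {d : ℕ} (p : MvPolynomial (Fin d) ℝ) :
    Continuous (fderiv ℝ (polyFun p)) :=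
  (contDiff_polyFun p).continuous_fderiv (by norm_num)

lemma norm_gradient {d : ℕ} (f : E d → ℝ) (x : E d) : ‖gradient f x‖ = ‖fderiv ℝ f x‖ := by
  simp [gradient]

lemma continuous_gradient_polyFun {d : ℕ} (p : MvPolynomial (Fin d) ℝ) :
    Continuous (gradient (polyFun p)) :=
  (InnerProductSpace.toDual ℝ (E d)).symm.continuous.comp (continuous_fderiv_polyFun p)

/-- Substituting polynomials of degree at most one does not raise the total degree. -/
lemma totalDegree_aeval_le {σ τ : Type*} (l : σ → MvPolynomial τ ℝ)
    (hl : ∀ j, (l j).totalDegree ≤ 1) (p : MvPolynomial σ ℝ) :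
    (MvPolynomial.aeval l p).totalDegree ≤ p.totalDegree := by
  rw [MvPolynomial.aeval_def, MvPolynomial.eval₂_eq]
  refine MvPolynomial.totalDegree_finsetSum_le fun i hi => ?_
  refine (MvPolynomial.totalDegree_mul _ _).trans ?_
  rw [MvPolynomial.algebraMap_eq, MvPolynomial.totalDegree_C, zero_add]
  refine (MvPolynomial.totalDegree_finsetProd _ _).trans ?_
  refine le_trans ?_ (MvPolynomial.le_totalDegree hi)
  refine Finset.sum_le_sum fun j _ => ?_
  refine (MvPolynomial.totalDegree_pow _ _).trans ?_
  simpa using Nat.mul_le_mul_left (i j) (hl j)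

/-- A polynomial composed with an affine map is a polynomial of at most the same degree. -/
lemma exists_poly_comp_affine {d : ℕ} {τ : Type*} [Fintype τ] (p : MvPolynomial (Fin d) ℝ)
    (a : E d) (b : τ → E d) :
    ∃ q : MvPolynomial τ ℝ, q.totalDegree ≤ p.totalDegree ∧
      ∀ x : τ → ℝ, MvPolynomial.eval x q = polyFun p (a + ∑ j, x j • b j) := by
  let l : Fin d → MvPolynomial τ ℝ := fun i =>
    MvPolynomial.C (a i) + ∑ j, MvPolynomial.C (b j i) * MvPolynomial.X j
  refine ⟨MvPolynomial.aeval l p, totalDegree_aeval_le l (fun i => ?_) p, fun x => ?_⟩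
  · refine (MvPolynomial.totalDegree_add _ _).trans (max_le (by simp) ?_)
    refine MvPolynomial.totalDegree_finsetSum_le fun j _ => ?_
    refine (MvPolynomial.totalDegree_mul _ _).trans ?_
    simp
  · have h := MvPolynomial.comp_aeval_apply (f := l) (φ := MvPolynomial.aeval x) p
    simp only [MvPolynomial.aeval_eq_eval] at h
    rw [h, polyFun]
    congr 2
    ext i
    simp [l, mul_comm]

lemma exists_poly_comp_homothety {d : ℕ} (p : MvPolynomial (Fin d) ℝ) (a : E d) (ρ : ℝ) :
    ∃ q : MvPolynomial (Fin d) ℝ, q.totalDegree ≤ p.totalDegree ∧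
      ∀ x : E d, polyFun q x = polyFun p (a + ρ • x) := by
  obtain ⟨q, hq, h⟩ := exists_poly_comp_affine p a fun j => ρ • EuclideanSpace.single j (1 : ℝ)
  refine ⟨q, hq, fun x => ?_⟩
  rw [polyFun, h]
  congr 2
  ext i
  simp [Finset.sum_apply, Pi.single_apply, mul_comm]

/-- A polynomial that vanishes on the unit ball is zero. -/
lemma eq_zero_of_polyFun_eq_zero {d : ℕ} (p : MvPolynomial (Fin d) ℝ)
    (h : ∀ x ∈ Metric.ball (0 : E d) 1, polyFun p x = 0) : p = 0 := by
  have hc : Continuous fun y : Fin d → ℝ => (WithLp.toLp 2 y : E d) := by fun_prop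
  have ho : IsOpen {y : Fin d → ℝ | (WithLp.toLp 2 y : E d) ∈ Metric.ball (0 : E d) 1} :=
    Metric.isOpen_ball.preimage hc
  obtain ⟨t, ht, hb⟩ := Metric.isOpen_iff.1 ho 0 (by
    simp)
  refine MvPolynomial.funext_set (fun _ => Metric.ball (0 : ℝ) t) (fun _ => ?_) fun x hx => ?_
  · rw [Real.ball_eq_Ioo]; exact Set.Ioo_infinite (by linarith)
  · have hx' : x ∈ Metric.ball (0 : Fin d → ℝ) t := by
      rw [ball_pi _ ht]; exact hx
    simpa [polyFun] using h _ (hb hx')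

/-- On polynomials of bounded degree, sup norm and gradient on a ball are controlled by the `L²`
norm on the unit ball. -/
lemma exists_ball_bound (d m : ℕ) (R : ℝ) :
    ∃ C : ℝ, 0 < C ∧ ∀ p : MvPolynomial (Fin d) ℝ, p.totalDegree ≤ m →
      ∀ x ∈ Metric.closedBall (0 : E d) R,
        polyFun p x ^ 2 ≤ C * ∫ y in Metric.closedBall (0 : E d) 1, polyFun p y ^ 2 ∧
        ‖fderiv ℝ (polyFun p) x‖ ^ 2 ≤
          C * ∫ y in Metric.closedBall (0 : E d) 1, polyFun p y ^ 2 := by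
  -- Equivalence of norms on a finite-dimensional space, in coordinates: the squared `L²` norm `Q`
  -- is continuous, homogeneous of degree two and positive off zero, so it is bounded below on the
  -- unit sphere.
  set W := MvPolynomial.restrictTotalDegree (Fin d) ℝ m
  set n := Module.finrank ℝ W
  let bs : Module.Basis (Fin n) ℝ W := Module.finBasis ℝ W
  let b : Fin n → MvPolynomial (Fin d) ℝ := fun j => (bs j : MvPolynomial (Fin d) ℝ)
  let f : (Fin n → ℝ) → E d → ℝ := fun a x => ∑ j, a j * polyFun (b j) x
  have hf : ∀ a, f a = polyFun (∑ j, a j • b j) := fun a => by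
    ext x; simp [f, polyFun_sum, polyFun_smul]
  let Q : (Fin n → ℝ) → ℝ := fun a => ∫ y in Metric.closedBall (0 : E d) 1, f a y ^ 2
  have hcont : Continuous (Function.uncurry fun a y => f a y ^ 2) := by
    have : ∀ j, Continuous (polyFun (b j)) := fun j => continuous_polyFun _
    unfold Function.uncurry
    simp only [f]
    fun_prop
  have hQc : Continuous Q :=
    continuous_parametric_integral_of_continuous hcont (isCompact_closedBall _ _)
  have hQ0 : ∀ a, 0 ≤ Q a := fun a => integral_nonneg fun y => sq_nonneg _
  have hQpos : ∀ a, a ≠ 0 → 0 < Q a := by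
    intro a ha
    -- Zero `L²` norm means vanishing almost everywhere on the ball, hence everywhere on the open
    -- ball by continuity, hence being the zero polynomial.
    refine lt_of_le_of_ne (hQ0 a) fun h0 => ha ?_
    have hfc : Continuous (f a) := by rw [hf]; exact continuous_polyFun _
    have hi : IntegrableOn (fun y => f a y ^ 2) (Metric.closedBall (0 : E d) 1) :=
      (hfc.pow 2).continuousOn.integrableOn_compact (isCompact_closedBall _ _)
    have h1 := (setIntegral_eq_zero_iff_of_nonneg_ae
      (Filter.Eventually.of_forall fun y => sq_nonneg (f a y)) hi).1 h0.symm
    have h2 := ae_mono (Measure.restrict_mono Metric.ball_subset_closedBall le_rfl) h1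
    have h3 := Measure.eqOn_open_of_ae_eq h2 Metric.isOpen_ball (hfc.pow 2).continuousOn
      continuousOn_const
    have h4 : (∑ j, a j • b j) = 0 := by
      refine eq_zero_of_polyFun_eq_zero _ fun x hx => ?_
      rw [← hf]
      exact pow_eq_zero_iff (two_ne_zero) |>.1 (h3 hx)
    have h5 : (∑ j, a j • bs j) = 0 := by
      apply Subtype.ext
      simpa [b] using h4
    exact funext fun j => Fintype.linearIndependent_iff.1 bs.linearIndependent a h5 j
  obtain ⟨μ, hμ, hμQ⟩ : ∃ μ : ℝ, 0 < μ ∧ ∀ a, μ * ‖a‖ ^ 2 ≤ Q a := by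
    have hhom : ∀ (t : ℝ) a, Q (t • a) = t ^ 2 * Q a := fun t a => by
      simp only [Q, f]
      rw [← integral_const_mul]
      congr 1
      ext y
      rw [← mul_pow, Finset.mul_sum]
      simp [mul_assoc]
    by_cases hne : (Metric.sphere (0 : Fin n → ℝ) 1).Nonempty
    · obtain ⟨a₀, ha₀, hmin⟩ := (isCompact_sphere (0 : Fin n → ℝ) 1).exists_isMinOn hne
        hQc.continuousOn
      have ha₀' : a₀ ≠ 0 := by
        rintro rfl; simp at ha₀
      refine ⟨Q a₀, hQpos _ ha₀', fun a => ?_⟩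
      by_cases ha : a = 0
      · subst ha; simpa using hQ0 0
      have hna : ‖a‖ ≠ 0 := norm_ne_zero_iff.2 ha
      have h1 : Q a₀ ≤ Q (‖a‖⁻¹ • a) := hmin (by simp [norm_smul, hna])
      have h2 := hhom ‖a‖ (‖a‖⁻¹ • a)
      rw [smul_smul, mul_inv_cancel₀ hna, one_smul] at h2
      rw [h2, mul_comm]
      exact mul_le_mul_of_nonneg_left h1 (sq_nonneg _)
    -- The unit sphere is empty only if the coordinate space is trivial, and then any positive
    -- constant serves.
    · refine ⟨1, one_pos, fun a => ?_⟩
      have ha : a = 0 := by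
        by_contra ha
        exact hne ⟨‖a‖⁻¹ • a, by simp [norm_smul, ha]⟩
      subst ha; simpa using hQ0 0
  have hbd : ∀ j, ∃ B : ℝ, ∀ x ∈ Metric.closedBall (0 : E d) R,
      |polyFun (b j) x| ≤ B ∧ ‖fderiv ℝ (polyFun (b j)) x‖ ≤ B := by
    intro j
    obtain ⟨B₁, h₁⟩ := (isCompact_closedBall (0 : E d) R).exists_bound_of_continuousOn
      (continuous_polyFun (b j)).continuousOn
    obtain ⟨B₂, h₂⟩ := (isCompact_closedBall (0 : E d) R).exists_bound_of_continuousOn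
      (continuous_fderiv_polyFun (b j)).continuousOn
    exact ⟨max B₁ B₂, fun x hx => ⟨(h₁ x hx).trans (le_max_left _ _),
      (h₂ x hx).trans (le_max_right _ _)⟩⟩
  choose B hB using hbd
  set S := ∑ j, |B j|
  have hS : 0 ≤ S := Finset.sum_nonneg fun j _ => abs_nonneg _
  -- Values and gradients are at most `‖a‖ S`, while `μ ‖a‖² ≤ Q a`; the summand `1` only keeps the
  -- constant positive.
  refine ⟨(S ^ 2 + 1) / μ, by positivity, fun p hp x hx => ?_⟩
  let P : W := ⟨p, (MvPolynomial.mem_restrictTotalDegree _ _ _).2 hp⟩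
  let a : Fin n → ℝ := bs.repr P
  have hpa : polyFun p = f a := by
    rw [hf]
    congr 1
    have h := congrArg W.subtype (bs.sum_repr P)
    rw [map_sum] at h
    exact h.symm
  have key : ∀ z : ℝ, 0 ≤ z → z ≤ ‖a‖ * S → z ^ 2 ≤ (S ^ 2 + 1) / μ * Q a := by
    intro z hz h
    have h1 : z ^ 2 ≤ (‖a‖ * S) ^ 2 := pow_le_pow_left₀ hz h 2
    have h2 := hμQ a
    rw [div_mul_eq_mul_div, le_div_iff₀ hμ]
    nlinarith [sq_nonneg ‖a‖, sq_nonneg S, mul_le_mul_of_nonneg_left h2 (sq_nonneg S), hQ0 a]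
  have hQa : (∫ y in Metric.closedBall (0 : E d) 1, polyFun p y ^ 2) = Q a := by rw [hpa]
  rw [hQa]
  constructor
  · rw [← sq_abs]
    refine key _ (abs_nonneg _) ?_
    rw [hpa]
    refine (Finset.abs_sum_le_sum_abs _ _).trans ?_
    rw [Finset.mul_sum]
    refine Finset.sum_le_sum fun j _ => ?_
    rw [abs_mul]
    exact mul_le_mul (norm_le_pi_norm a j) ((hB j x hx).1.trans (le_abs_self _)) (abs_nonneg _)
      (norm_nonneg _)
  · refine key _ (norm_nonneg _) ?_
    have hd : fderiv ℝ (polyFun p) x = ∑ j, a j • fderiv ℝ (polyFun (b j)) x := by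
      rw [hpa]
      simp only [f]
      rw [fderiv_fun_sum fun j _ => ((differentiable_polyFun (b j)).differentiableAt.const_mul _)]
      exact Finset.sum_congr rfl fun j _ =>
        fderiv_const_mul (differentiable_polyFun (b j)).differentiableAt _
    rw [hd]
    refine (norm_sum_le _ _).trans ?_
    rw [Finset.mul_sum]
    refine Finset.sum_le_sum fun j _ => ?_
    rw [norm_smul]
    exact mul_le_mul (norm_le_pi_norm a j) ((hB j x hx).2.trans (le_abs_self _)) (norm_nonneg _)
      (norm_nonneg _)

open scoped Pointwise in
lemma setIntegral_closedBall_scale {d : ℕ} (f : E d → ℝ) (x₀ : E d) {ρ : ℝ} (hρ : 0 < ρ) :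
    ∫ y in Metric.closedBall (0 : E d) 1, f (x₀ + ρ • y) =
      (ρ ^ d)⁻¹ * ∫ x in Metric.closedBall x₀ ρ, f x := by
  have h := Measure.setIntegral_comp_smul_of_pos (volume : Measure (E d))
    (fun x => f (x₀ + x)) (Metric.closedBall (0 : E d) 1) hρ
  rw [h, finrank_euclideanSpace_fin, smul_eq_mul]
  congr 1
  have h2 : (ρ • Metric.closedBall (0 : E d) 1 : Set (E d)) = Metric.closedBall (0 : E d) ρ := by
    rw [smul_closedBall' hρ.ne']; simp [abs_of_pos hρ]
  rw [h2]
  have h3 := (measurePreserving_add_left (volume : Measure (E d)) x₀).setIntegral_preimage_emb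
    (MeasurableEquiv.addLeft x₀).measurableEmbedding f (Metric.closedBall x₀ ρ)
  rw [← h3]
  congr 2
  ext y; simp

/-- Inverse estimates on a set that lies between two concentric balls of comparable radii. -/
lemma exists_inverse_estimate (d m : ℕ) (K : ℝ) :
    ∃ C : ℝ, 0 < C ∧ ∀ p : MvPolynomial (Fin d) ℝ, p.totalDegree ≤ m →
      ∀ (x₀ : E d) (ρ : ℝ), 0 < ρ → ∀ x ∈ Metric.closedBall x₀ (K * ρ),
        polyFun p x ^ 2 ≤ C * (ρ ^ d)⁻¹ * ∫ y in Metric.closedBall x₀ ρ, polyFun p y ^ 2 ∧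
        ‖gradient (polyFun p) x‖ ^ 2 ≤
          C * (ρ ^ 2)⁻¹ * (ρ ^ d)⁻¹ * ∫ y in Metric.closedBall x₀ ρ, polyFun p y ^ 2 := by
  obtain ⟨C, hC, h⟩ := exists_ball_bound d m K
  refine ⟨C, hC, fun p hp x₀ ρ hρ x hx => ?_⟩
  obtain ⟨q, hq, hqp⟩ := exists_poly_comp_homothety p x₀ ρ
  -- Rescaling to the unit ball: the integral picks up `ρ⁻ᵈ`, and each derivative a factor `ρ⁻¹`.
  set y : E d := ρ⁻¹ • (x - x₀)
  have hy : x₀ + ρ • y = x := by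
    simp [y, smul_smul, hρ.ne']
  have hy' : y ∈ Metric.closedBall (0 : E d) K := by
    rw [mem_closedBall_zero_iff, norm_smul, norm_inv, Real.norm_of_nonneg hρ.le,
      inv_mul_le_iff₀ hρ, mul_comm, ← dist_eq_norm]
    exact hx
  obtain ⟨h1, h2⟩ := h q (hq.trans hp) y hy'
  have h_int : (∫ z in Metric.closedBall (0 : E d) 1, polyFun q z ^ 2) =
      (ρ ^ d)⁻¹ * ∫ z in Metric.closedBall x₀ ρ, polyFun p z ^ 2 := by
    simp only [hqp]
    exact setIntegral_closedBall_scale (fun z => polyFun p z ^ 2) x₀ hρ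
  rw [h_int] at h1 h2
  refine ⟨by rw [hqp, hy] at h1; linarith, ?_⟩
  have hfd : fderiv ℝ (polyFun q) y = ρ • fderiv ℝ (polyFun p) x := by
    have e : polyFun q = polyFun p ∘ fun z => x₀ + ρ • z := funext hqp
    have h3 : HasFDerivAt (fun z : E d => x₀ + ρ • z) (ρ • ContinuousLinearMap.id ℝ (E d)) y :=
      ((hasFDerivAt_id y).const_smul ρ).const_add x₀
    have h4 : HasFDerivAt (polyFun p) (fderiv ℝ (polyFun p) x) (x₀ + ρ • y) := by
      rw [hy]; exact (differentiable_polyFun p).differentiableAt.hasFDerivAt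
    rw [e, (h4.comp y h3).fderiv]
    ext z; simp
  rw [hfd, norm_smul, Real.norm_of_nonneg hρ.le, mul_pow] at h2
  rw [norm_gradient]
  have hρ2 : 0 < ρ ^ 2 := by positivity
  rw [mul_comm, ← le_div_iff₀ hρ2] at h2
  refine h2.trans_eq ?_
  field_simp

/-- Polynomials on the reference element are controlled by their nodal values. -/
lemma exists_nodal_bound {d m : ℕ} {X : Finset (Fin d → ℝ)} (hX : IsReferenceNodeSet m X) :
    ∃ C : ℝ, 0 < C ∧ ∀ p : MvPolynomial (Fin d) ℝ, p.totalDegree ≤ m → ∀ A : ℝ, 0 ≤ A →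
      (∀ x ∈ X, |MvPolynomial.eval x p| ≤ A) →
      ∀ y : Fin d → ℝ, (∀ j, y j ∈ Set.Icc (0 : ℝ) 1) → |MvPolynomial.eval y p| ≤ C * A := by
  classical
  -- Unisolvence supplies the Lagrange basis polynomials `l z`. The constant is a bound for their
  -- Lebesgue constant on the unit cube, which contains the reference simplex.
  have hl := fun z : Fin d → ℝ => (hX.2 fun x => if x = z then 1 else 0).exists
  choose l hl1 hl2 using hl
  have hb : ∀ z, ∃ B : ℝ, ∀ y : Fin d → ℝ, (∀ j, y j ∈ Set.Icc (0 : ℝ) 1) →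
      |MvPolynomial.eval y (l z)| ≤ B := by
    intro z
    have hc : IsCompact (Set.univ.pi fun _ : Fin d => Set.Icc (0 : ℝ) 1) :=
      isCompact_univ_pi fun _ => isCompact_Icc
    obtain ⟨B, hB⟩ := hc.exists_bound_of_continuousOn
      (MvPolynomial.continuous_eval (l z)).continuousOn
    exact ⟨B, fun y hy => hB y fun j _ => hy j⟩
  choose B hB using hb
  refine ⟨∑ z ∈ X, |B z| + 1, by positivity, fun p hp A hA hpA y hy => ?_⟩
  have hrep : p = ∑ z ∈ X, MvPolynomial.eval z p • l z := by
    refine (hX.2 fun x => MvPolynomial.eval x p).unique ⟨hp, fun _ _ => rfl⟩ ⟨?_, fun x hx => ?_⟩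
    · exact MvPolynomial.totalDegree_finsetSum_le fun z _ =>
        (MvPolynomial.totalDegree_smul_le _ _).trans (hl1 z)
    · rw [map_sum]
      simp only [MvPolynomial.smul_eval, hl2 _ x hx]
      simp [hx]
  rw [hrep, map_sum]
  refine (Finset.abs_sum_le_sum_abs _ _).trans ?_
  calc ∑ z ∈ X, |MvPolynomial.eval y (MvPolynomial.eval z p • l z)|
      ≤ ∑ z ∈ X, |B z| * A := Finset.sum_le_sum fun z hz => by
        rw [MvPolynomial.smul_eval, abs_mul, mul_comm]
        exact mul_le_mul ((hB z y hy).trans (le_abs_self _)) (hpA z hz) (abs_nonneg _)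
          (abs_nonneg _)
    _ = (∑ z ∈ X, |B z|) * A := (Finset.sum_mul _ _ _).symm
    _ ≤ _ := mul_le_mul_of_nonneg_right (by linarith) hA

/-! ### Simplices -/

/-- Points of the convex hull of `n + 1` points in affine coordinates. -/
lemma exists_coord_of_mem_convexHull_range {d n : ℕ} (p : Fin (n + 1) → E d) {x : E d}
    (hx : x ∈ convexHull ℝ (Set.range p)) :
    ∃ y : Fin n → ℝ, (∀ j, y j ∈ Set.Icc (0 : ℝ) 1) ∧
      x = p 0 + ∑ j, y j • (p j.succ - p 0) := by
  let A : Set (E d) := {x | ∃ y : Fin n → ℝ, (∀ j, 0 ≤ y j) ∧ ∑ j, y j ≤ 1 ∧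
    x = p 0 + ∑ j, y j • (p j.succ - p 0)}
  have hA : Convex ℝ A := by
    rintro _ ⟨y, hy0, hy1, rfl⟩ _ ⟨z, hz0, hz1, rfl⟩ a b ha hb hab
    refine ⟨fun j => a * y j + b * z j, fun j => ?_, ?_, ?_⟩
    · have := hy0 j; have := hz0 j; positivity
    · rw [Finset.sum_add_distrib, ← Finset.mul_sum, ← Finset.mul_sum]
      nlinarith
    · simp only [add_smul, Finset.sum_add_distrib, mul_smul, ← Finset.smul_sum]
      have : p 0 = a • p 0 + b • p 0 := by rw [← add_smul, hab, one_smul]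
      rw [smul_add, smul_add]
      nth_rewrite 5 [this]
      abel
  have hsub : Set.range p ⊆ A := by
    rintro _ ⟨m, rfl⟩
    refine Fin.cases ?_ (fun j => ?_) m
    · exact ⟨0, by simp, by simp, by simp⟩
    · refine ⟨Pi.single j 1, fun i => ?_, by simp, ?_⟩
      · by_cases h : i = j
        · subst h; simp
        · simp [h]
      · simp [Pi.single_apply, ite_smul]
  obtain ⟨y, hy0, hy1, hy⟩ := convexHull_min hsub hA hx
  exact ⟨y, fun j => ⟨hy0 j, (Finset.single_le_sum (fun i _ => hy0 i) (Finset.mem_univ j)).trans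
    hy1⟩, hy⟩

lemma convex_cellOf {d : ℕ} (s : Affine.Simplex ℝ (E d) d) : Convex ℝ (cellOf s) :=
  convex_convexHull ℝ _

lemma isCompact_cellOf {d : ℕ} (s : Affine.Simplex ℝ (E d) d) : IsCompact (cellOf s) :=
  (Set.finite_range _).isCompact_convexHull ℝ

lemma isClosed_cellOf {d : ℕ} (s : Affine.Simplex ℝ (E d) d) : IsClosed (cellOf s) :=
  (isCompact_cellOf s).isClosed

lemma isCompact_facetOf {d : ℕ} (s : Affine.Simplex ℝ (E d) d) (m : Fin (d + 1)) :
    IsCompact (facetOf s m) :=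
  (Set.toFinite _).isCompact_convexHull ℝ

lemma point_mem_cellOf {d : ℕ} (s : Affine.Simplex ℝ (E d) d) (m : Fin (d + 1)) :
    s.points m ∈ cellOf s :=
  subset_convexHull ℝ _ ⟨m, rfl⟩

lemma affineSpan_points {d : ℕ} (s : Affine.Simplex ℝ (E d) d) :
    affineSpan ℝ (Set.range s.points) = ⊤ := by
  rw [s.independent.affineSpan_eq_top_iff_card_eq_finrank_add_one]
  simp

lemma interior_cellOf_nonempty {d : ℕ} (s : Affine.Simplex ℝ (E d) d) :
    (interior (cellOf s)).Nonempty :=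
  interior_convexHull_nonempty_iff_affineSpan_eq_top.2 (affineSpan_points s)

lemma closure_interior_cellOf {d : ℕ} (s : Affine.Simplex ℝ (E d) d) :
    closure (interior (cellOf s)) = cellOf s := by
  rw [(convex_cellOf s).closure_interior_eq_closure_of_nonempty_interior
    (interior_cellOf_nonempty s), (isClosed_cellOf s).closure_eq]

lemma refPoint_mem_cellOf {d : ℕ} (s : Affine.Simplex ℝ (E d) d) (x : Fin d → ℝ)
    (h0 : ∀ j, 0 ≤ x j) (h1 : ∑ j, x j ≤ 1) : refPoint s x ∈ cellOf s := by
  refine mem_convexHull_of_exists_fintype (Fin.cons (1 - ∑ j, x j) x) s.points ?_ ?_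
    (fun i => ⟨i, rfl⟩) ?_
  · refine fun i => Fin.cases ?_ (fun j => ?_) i
    · simpa using h1
    · simpa using h0 j
  · simp [Fin.sum_univ_succ]
  · simp only [Fin.sum_univ_succ, Fin.cons_zero, Fin.cons_succ, refPoint, smul_sub,
      Finset.sum_sub_distrib, sub_smul, one_smul, Finset.sum_smul]
    abel

lemma exists_refPoint_eq {d : ℕ} (s : Affine.Simplex ℝ (E d) d) {y : E d} (hy : y ∈ cellOf s) :
    ∃ x : Fin d → ℝ, (∀ j, x j ∈ Set.Icc (0 : ℝ) 1) ∧ y = refPoint s x :=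
  exists_coord_of_mem_convexHull_range s.points hy

/-- The boundary of a simplex consists of its facets. -/
lemma frontier_cellOf_subset {d : ℕ} (s : Affine.Simplex ℝ (E d) d) :
    frontier (cellOf s) ⊆ ⋃ m, facetOf s m := by
  let b : AffineBasis (Fin (d + 1)) ℝ (E d) := ⟨s.points, s.independent, affineSpan_points s⟩
  intro x hx
  rw [(isClosed_cellOf s).frontier_eq] at hx
  have hb : Set.range b = Set.range s.points := rfl
  have h1 : ∀ i, 0 ≤ b.coord i x := by
    have : x ∈ convexHull ℝ (Set.range b) := hx.1
    rwa [b.convexHull_eq_nonneg_coord] at this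
  have h2 : ¬ ∀ i, 0 < b.coord i x := by
    intro h
    apply hx.2
    have : x ∈ interior (convexHull ℝ (Set.range b)) := by
      rw [b.interior_convexHull]; exact h
    exact this
  -- A point of the closed simplex that is not interior has a vanishing barycentric coordinate,
  -- hence is a convex combination of the remaining vertices.
  push Not at h2
  obtain ⟨m, hm⟩ := h2
  have hm0 : b.coord m x = 0 := le_antisymm hm (h1 m)
  refine Set.mem_iUnion.2 ⟨m, ?_⟩
  have hsum := b.sum_coord_apply_eq_one x
  have hlin := b.linear_combination_coord_eq_self x
  rw [Fintype.sum_eq_add_sum_compl m, hm0, zero_add] at hsum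
  rw [Fintype.sum_eq_add_sum_compl m, hm0, zero_smul, zero_add] at hlin
  rw [← hlin]
  refine (convex_convexHull ℝ _).sum_mem (fun i _ => h1 i) hsum fun i hi => ?_
  exact subset_convexHull ℝ _ ⟨i, by simpa using hi, rfl⟩

/-- Both measures are the same multiple, depending on `n` alone, of the usual Hausdorff measure, so
the Lipschitz bound carries over without a further constant. -/
lemma euclideanHausdorffMeasure_image_le {n d : ℕ} {L : NNReal} {g : E n → E d}
    (hg : LipschitzWith L g) (s : Set (E n)) :
    (μHE[n] : Measure (E d)) (g '' s) ≤ (L : ENNReal) ^ n * volume s := by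
  have h := hg.hausdorffMeasure_image_le (d := n) (by positivity) s
  rw [← EuclideanSpace.euclideanHausdorffMeasure_eq_volume,
    Measure.euclideanHausdorffMeasure_def, Measure.euclideanHausdorffMeasure_def,
    Measure.smul_apply, Measure.smul_apply, ENNReal.smul_def, ENNReal.smul_def, smul_eq_mul,
    smul_eq_mul]
  rw [ENNReal.rpow_natCast] at h
  calc _ ≤ _ * ((L : ENNReal) ^ n * (μH[n] : Measure (E n)) s) := by gcongr
    _ = _ := by ring

/-- The convex hull of `n + 1` points has `n`-dimensional measure at most `C diam ^ n`. -/
lemma exists_hausdorff_convexHull_le (d n : ℕ) : ∃ C : ℝ, 0 < C ∧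
    ∀ (p : Fin (n + 1) → E d) (D : ℝ), 0 ≤ D → (∀ i j, dist (p i) (p j) ≤ D) →
      (μHE[n] : Measure (E d)) (convexHull ℝ (Set.range p)) ≤ ENNReal.ofReal (C * D ^ n) := by
  set B : Set (E n) := Metric.closedBall 0 (n : ℝ)
  have hB : volume B ≠ ⊤ := (isCompact_closedBall _ _).measure_lt_top.ne
  refine ⟨n ^ n * (volume B).toReal + 1, by positivity, fun p D hD hp => ?_⟩
  -- The hull is contained in the Lipschitz image of a ball: coordinate vectors with entries in `[0,
  -- 1]` have norm at most `n`, and each of the `n` edge vectors has length at most `D`, which gives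
  -- the Lipschitz constant `n D`.
  let g : E n → E d := fun y => p 0 + ∑ j, y j • (p j.succ - p 0)
  have hg : LipschitzWith (n * D).toNNReal g := by
    refine LipschitzWith.of_dist_le_mul fun y z => ?_
    rw [Real.coe_toNNReal _ (by positivity), dist_eq_norm, dist_eq_norm]
    have : g y - g z = ∑ j, (y j - z j) • (p j.succ - p 0) := by
      simp only [g, sub_smul, Finset.sum_sub_distrib]; abel
    rw [this]
    refine (norm_sum_le _ _).trans ?_
    calc ∑ j, ‖(y j - z j) • (p j.succ - p 0)‖ ≤ ∑ _j : Fin n, ‖y - z‖ * D := by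
          refine Finset.sum_le_sum fun j _ => ?_
          rw [norm_smul]
          refine mul_le_mul ?_ ?_ (norm_nonneg _) (norm_nonneg _)
          · exact PiLp.norm_apply_le (y - z) j
          · rw [← dist_eq_norm]; exact hp _ _
      _ = n * D * ‖y - z‖ := by simp; ring
  have hsub : convexHull ℝ (Set.range p) ⊆ g '' B := by
    intro x hx
    obtain ⟨y, hy, rfl⟩ := exists_coord_of_mem_convexHull_range p hx
    refine ⟨WithLp.toLp 2 y, ?_, by simp [g]⟩
    rw [mem_closedBall_zero_iff]
    have e : (WithLp.toLp 2 y : E n) = ∑ j, y j • EuclideanSpace.single j (1 : ℝ) := by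
      ext i; simp [Pi.single_apply]
    rw [e]
    refine (norm_sum_le _ _).trans ?_
    calc ∑ j, ‖y j • (EuclideanSpace.single j (1 : ℝ) : E n)‖ ≤ ∑ _j : Fin n, (1 : ℝ) := by
          refine Finset.sum_le_sum fun j _ => ?_
          simpa [norm_smul, abs_of_nonneg (hy j).1] using (hy j).2
      _ = n := by simp
  calc (μHE[n] : Measure (E d)) (convexHull ℝ (Set.range p))
      ≤ (μHE[n] : Measure (E d)) (g '' B) := measure_mono hsub
    _ ≤ ((n * D).toNNReal : ENNReal) ^ n * volume B := euclideanHausdorffMeasure_image_le hg B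
    _ = ENNReal.ofReal (n ^ n * (volume B).toReal * D ^ n) := by
        rw [← ENNReal.ofReal_toReal hB]
        change ENNReal.ofReal _ ^ n * _ = _
        rw [← ENNReal.ofReal_pow (by positivity), ← ENNReal.ofReal_mul (by positivity),
          ENNReal.toReal_ofReal ENNReal.toReal_nonneg]
        congr 1; ring
    _ ≤ _ := by
        apply ENNReal.ofReal_le_ofReal
        have : 0 ≤ D ^ n := by positivity
        nlinarith

/-- The boundary of a simplex has surface measure at most `C diam ^ (d - 1)`. -/
lemma exists_hausdorff_frontier_cellOf_le (d : ℕ) (hd : 1 ≤ d) : ∃ C : ℝ, 0 < C ∧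
    ∀ s : Affine.Simplex ℝ (E d) d, (μHE[d - 1] : Measure (E d)) (frontier (cellOf s)) ≤
      ENNReal.ofReal (C * Metric.diam (cellOf s) ^ (d - 1)) := by
  obtain ⟨C, hC, h⟩ := exists_hausdorff_convexHull_le d (d - 1)
  refine ⟨(d + 1) * C, by positivity, fun s => ?_⟩
  have hfacet : ∀ m, (μHE[d - 1] : Measure (E d)) (facetOf s m) ≤
      ENNReal.ofReal (C * Metric.diam (cellOf s) ^ (d - 1)) := by
    intro m
    -- A facet has `d` vertices; since `1 ≤ d`, they can be indexed by `Fin (d - 1 + 1)`, as the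
    -- bound for convex hulls requires.
    have e : facetOf s m = convexHull ℝ
        (Set.range fun j : Fin (d - 1 + 1) => s.points (m.succAbove (Fin.cast (by omega) j))) := by
      unfold facetOf
      congr 1
      rw [← Fin.range_succAbove, ← Set.range_comp]
      ext x
      constructor
      · rintro ⟨j, rfl⟩; exact ⟨Fin.cast (by omega) j, rfl⟩
      · rintro ⟨j, rfl⟩; exact ⟨Fin.cast (by omega) j, rfl⟩
    rw [e]
    exact h _ _ Metric.diam_nonneg fun i j =>
      Metric.dist_le_diam_of_mem (isCompact_cellOf s).isBounded (point_mem_cellOf s _)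
        (point_mem_cellOf s _)
  calc _ ≤ (μHE[d - 1] : Measure (E d)) (⋃ m, facetOf s m) :=
        measure_mono (frontier_cellOf_subset s)
    _ ≤ ∑ m, (μHE[d - 1] : Measure (E d)) (facetOf s m) := measure_iUnion_fintype_le _ _
    _ ≤ ∑ _m : Fin (d + 1), ENNReal.ofReal (C * Metric.diam (cellOf s) ^ (d - 1)) :=
        Finset.sum_le_sum fun m _ => hfacet m
    _ = _ := by
        have := Metric.diam_nonneg (s := cellOf s)
        rw [Finset.sum_const, nsmul_eq_mul, Finset.card_univ, Fintype.card_fin,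
          ← ENNReal.ofReal_natCast, ← ENNReal.ofReal_mul (by positivity)]
        push_cast
        congr 1; ring

lemma diam_cellOf_pos {d : ℕ} (hd : 1 ≤ d) (s : Affine.Simplex ℝ (E d) d) :
    0 < Metric.diam (cellOf s) := by
  have hne : s.points 0 ≠ s.points (Fin.last d) := fun h => by
    have := s.independent.injective h
    rw [Fin.ext_iff] at this
    simp at this
    omega
  exact (dist_pos.2 hne).trans_le (Metric.dist_le_diam_of_mem (isCompact_cellOf s).isBounded
    (point_mem_cellOf s _) (point_mem_cellOf s _))

/-- Distinct elements of a conforming mesh have disjoint interiors. -/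
lemma Mesh.disjoint_interior_cell {d : ℕ} (T : Mesh d) {i j : Fin T.numElem} (hij : i ≠ j) :
    Disjoint (interior (T.cell i)) (interior (T.cell j)) := by
  rw [Set.disjoint_iff_inter_eq_empty, ← interior_inter]
  change interior (cellOf (T.elem i) ∩ cellOf (T.elem j)) = ∅
  rw [T.conforming i j]
  -- If the intersection had interior points, the common vertices would span the whole space
  -- affinely. By affine independence a spanning set of vertices of a simplex consists of all of
  -- them, so both elements would have the same vertex set.
  by_contra hne
  have htop := interior_convexHull_nonempty_iff_affineSpan_eq_top.1
    (Set.nonempty_iff_ne_empty.2 hne)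
  have key : ∀ s : Affine.Simplex ℝ (E d) d, ∀ A : Set (E d), A ⊆ Set.range s.points →
      affineSpan ℝ A = ⊤ → A = Set.range s.points := by
    intro s A hA hspan
    refine hA.antisymm ?_
    rintro _ ⟨m, rfl⟩
    obtain ⟨B, rfl⟩ := Set.subset_range_iff_exists_image_eq.1 hA
    have : s.points m ∈ affineSpan ℝ (s.points '' B) := by rw [hspan]; trivial
    exact ⟨m, (s.independent.mem_affineSpan_iff m B).1 this, rfl⟩
  have h1 := key (T.elem i) _ Set.inter_subset_left htop
  have h2 := key (T.elem j) _ Set.inter_subset_right htop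
  exact hij (T.elem_injective (h1.symm.trans h2))

/-! ### The field of values of a weighted additive Schwarz operator -/

/-- Abstract lower bound for the field of values of `∑ l, T l ∘ U l`, where `T l` is close to the
multiplication by the weights `c l` on each element, and `U l` are the local solutions. -/
theorem schwarz_lower_bound {V ι J : Type*} [AddCommGroup V] [Module ℝ V] [Fintype ι] [Fintype J]
    [DecidableEq ι]
    (n : ι → Seminorm ℝ V) (ip : ι → V → V → ℂ)
    (ip_add : ∀ i v w w', ip i v (w + w') = ip i v w + ip i v w')
    (ip_smul : ∀ i v (t : ℝ) w, ip i v (t • w) = t * ip i v w)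
    (ip_le : ∀ i v w, ‖ip i v w‖ ≤ n i v * n i w)
    (ip_self : ∀ i v, ip i v v = ((n i v ^ 2 : ℝ) : ℂ))
    (T : J → V →ₗ[ℝ] V) (c : J → ι → ℝ) (sub : J → Finset ι)
    (al : J → V → V → ℂ) (al_sub : ∀ l u u' w, al l (u - u') w = al l u w - al l u' w)
    (Loc : J → Submodule ℝ V) (T_mem : ∀ l v, T l v ∈ Loc l)
    (σ γ : ℝ) (hσ : 0 < σ) (hγ : 0 < γ) (hγ1 : γ ≤ 1)
    (hT : ∀ l i v, n i (T l v - c l i • v) ≤ σ * n i v)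
    (hT0 : ∀ l i v, i ∉ sub l → n i (T l v) = 0)
    (hcomm : ∀ l v w, ‖al l (T l v) w - al l v (T l w)‖ ≤ σ * ∑ i ∈ sub l, n i v * n i w)
    (hco : ∀ l v, γ * ∑ i ∈ sub l, n i v ^ 2 ≤ ‖al l v v‖)
    (hcow : ∀ l v, γ * ∑ i ∈ sub l, c l i * n i v ^ 2 ≤
      ‖al l v (T l v)‖ + σ * ∑ i ∈ sub l, n i v ^ 2)
    (c_nonneg : ∀ l i, 0 ≤ c l i) (c_sum : ∀ i, ∑ l, c l i = 1)
    (c_zero : ∀ l i, i ∉ sub l → c l i = 0)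
    (Λ : ℕ) (hΛ : ∀ i, (Finset.univ.filter fun l => i ∈ sub l).card ≤ Λ)
    (v : V) (U : J → V) (hUmem : ∀ l, U l ∈ Loc l)
    (hU : ∀ l, ∀ w ∈ Loc l, al l (U l) w = al l v (T l w)) :
    (1 / (Λ : ℝ) - 3 * (σ / γ) - 4 * Λ * (σ / γ) ^ 2) * ∑ i, n i v ^ 2 ≤
      ‖∑ l, ∑ i, ip i v (T l (U l))‖ := by
  -- The ratio of commutator size to coercivity constant: the relative size of the errors `e l`
  -- below.
  set t : ℝ := σ / γ with ht
  have htpos : 0 < t := by positivity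
  have hσt : σ ≤ t := by
    rw [ht, le_div_iff₀ hγ]; nlinarith
  have hγt : γ * t = σ := by rw [ht]; field_simp
  set e : J → V := fun l => U l - T l v with he
  have he_mem : ∀ l, e l ∈ Loc l := fun l => (Loc l).sub_mem (hUmem l) (T_mem l v)
  have hn : ∀ i w, 0 ≤ n i w := fun i w => apply_nonneg (n i) w
  have hnT : ∀ l i w, n i (T l w) ≤ (c l i + σ) * n i w := by
    intro l i w
    have h1 : T l w = (T l w - c l i • w) + c l i • w := by abel
    rw [h1]
    refine (map_add_le_add (n i) _ _).trans ?_
    rw [map_smul_eq_mul, Real.norm_of_nonneg (c_nonneg l i)]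
    linarith [hT l i w]
  -- Tested against local functions, the error sees only the commutator, since `al l (U l) w = al l
  -- v (T l w)`.
  have hal : ∀ l, ∀ w ∈ Loc l, ‖al l (e l) w‖ ≤ σ * ∑ i ∈ sub l, n i v * n i w := by
    intro l w hw
    rw [he, al_sub, hU l w hw, norm_sub_rev]
    exact hcomm l v w
  -- The central estimate. The first-order term on the right keeps the weight `c l i`, which sums to
  -- `1` over `l`; only the term in `t ^ 2` is unweighted and will cost a factor `Λ`.
  have hloc : ∀ l, ∑ i ∈ sub l, (c l i + σ) * (n i v * n i (e l)) ≤
      t * ∑ i ∈ sub l, c l i * n i v ^ 2 + 3 * t ^ 2 * ∑ i ∈ sub l, n i v ^ 2 := by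
    intro l
    set Y := ∑ i ∈ sub l, n i v ^ 2
    set X := ∑ i ∈ sub l, n i (e l) ^ 2
    set M := ∑ i ∈ sub l, n i v * n i (e l)
    set Yc := ∑ i ∈ sub l, c l i * n i v ^ 2
    set Z := ∑ i ∈ sub l, c l i * n i (e l) ^ 2
    set Mc := ∑ i ∈ sub l, c l i * (n i v * n i (e l))
    have hM : 2 * t * M ≤ t ^ 2 * Y + X := by
      simp only [M, Y, X, Finset.mul_sum, ← Finset.sum_add_distrib]
      exact Finset.sum_le_sum fun i _ => by nlinarith [sq_nonneg (t * n i v - n i (e l))]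
    have hMc : 2 * t * Mc ≤ t ^ 2 * Yc + Z := by
      simp only [Mc, Yc, Z, Finset.mul_sum, ← Finset.sum_add_distrib]
      exact Finset.sum_le_sum fun i _ => by
        nlinarith [mul_nonneg (c_nonneg l i) (sq_nonneg (t * n i v - n i (e l)))]
    have hM0 : 0 ≤ M := Finset.sum_nonneg fun i _ => mul_nonneg (hn _ _) (hn _ _)
    -- Coercivity gives `γ X ≤ σ M`. Together with Young's inequality `hM`, half of `X` is absorbed,
    -- which yields `X ≤ t² Y` and `M ≤ t Y`.
    have hX : X ≤ t * M := by
      have h1 := (hco l (e l)).trans (hal l (e l) (he_mem l))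
      have h2 : (∑ i ∈ sub l, n i v * n i (e l)) = M := rfl
      rw [h2, ← hγt, mul_assoc] at h1
      exact le_of_mul_le_mul_left h1 hγ
    have hX2 : X ≤ t ^ 2 * Y := by linarith
    have hMY : M ≤ t * Y := by
      have : t * M ≤ t * (t * Y) := by nlinarith
      exact le_of_mul_le_mul_left this htpos
    -- The same absorption in the weighted norm. Weighted coercivity produces `al l (e l) (T l (e
    -- l))`, and `T l (e l)` is again an admissible test function.
    have hZ : Z ≤ t * Mc + t * σ * M + t * X := by
      have h1 := hcow l (e l)
      have h2 := hal l (T l (e l)) (T_mem l _)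
      have h3 : ∑ i ∈ sub l, n i v * n i (T l (e l)) ≤ Mc + σ * M := by
        simp only [Mc, M, Finset.mul_sum, ← Finset.sum_add_distrib]
        refine Finset.sum_le_sum fun i _ => ?_
        nlinarith [mul_le_mul_of_nonneg_left (hnT l i (e l)) (hn i v)]
      have h4 : γ * Z ≤ γ * (t * Mc + t * σ * M + t * X) := by
        have h5 := mul_le_mul_of_nonneg_left h3 hσ.le
        have h6 : γ * (t * Mc + t * σ * M + t * X) = γ * t * (Mc + σ * M) + γ * t * X := by ring
        rw [h6, hγt]
        linarith
      exact le_of_mul_le_mul_left h4 hγ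
    have hσM : σ * M ≤ t ^ 2 * Y := by
      have := mul_le_mul hσt hMY hM0 htpos.le
      linarith [this]
    have hMcY : Mc ≤ t * Yc + 2 * t ^ 2 * Y := by
      have h1 : t * (σ * M) ≤ t * (t ^ 2 * Y) := mul_le_mul_of_nonneg_left hσM htpos.le
      have h2 : t * X ≤ t * (t ^ 2 * Y) := mul_le_mul_of_nonneg_left hX2 htpos.le
      have : t * Mc ≤ t * (t * Yc + 2 * t ^ 2 * Y) := by nlinarith
      exact le_of_mul_le_mul_left this htpos
    have hsum : ∑ i ∈ sub l, (c l i + σ) * (n i v * n i (e l)) = Mc + σ * M := by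
      simp only [Mc, M, Finset.mul_sum, ← Finset.sum_add_distrib]
      exact Finset.sum_congr rfl fun i _ => by ring
    rw [hsum]
    linarith
  have hpt : ∀ l i, i ∈ sub l → (c l i ^ 2 - (2 * c l i * σ + σ ^ 2)) * n i v ^ 2 -
      (c l i + σ) * (n i v * n i (e l)) ≤ (ip i v (T l (U l))).re := by
    intro l i _
    -- Applying `T l` twice is multiplication by `c²` up to `(c + σ) σ + c σ = 2 c σ + σ²`.
    set r : V := T l (T l v) - (c l i) ^ 2 • v with hr
    have hr_le : n i r ≤ (2 * c l i * σ + σ ^ 2) * n i v := by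
      have h1 : r = (T l (T l v) - c l i • T l v) + c l i • (T l v - c l i • v) := by
        rw [hr, smul_sub, smul_smul, pow_two]; abel
      rw [h1]
      refine (map_add_le_add (n i) _ _).trans ?_
      rw [map_smul_eq_mul, Real.norm_of_nonneg (c_nonneg l i)]
      have h2 := hT l i (T l v)
      have h3 := mul_le_mul_of_nonneg_left (hnT l i v) hσ.le
      have h4 := mul_le_mul_of_nonneg_left (hT l i v) (c_nonneg l i)
      nlinarith
    have hdec : T l (U l) = (c l i) ^ 2 • v + (r + T l (e l)) := by
      have : U l = T l v + e l := (add_sub_cancel (T l v) (U l)).symm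
      rw [this, map_add, hr]; abel
    rw [hdec, ip_add, ip_add, ip_smul, ip_self]
    have h1 : -(n i v * n i r) ≤ (ip i v r).re :=
      (neg_le_neg (ip_le i v r)).trans (neg_le_of_abs_le (Complex.abs_re_le_norm _))
    have h2 : -(n i v * n i (T l (e l))) ≤ (ip i v (T l (e l))).re :=
      (neg_le_neg (ip_le i v _)).trans (neg_le_of_abs_le (Complex.abs_re_le_norm _))
    have h3 := mul_le_mul_of_nonneg_left hr_le (hn i v)
    have h4 := mul_le_mul_of_nonneg_left (hnT l i (e l)) (hn i v)
    have h5 : ((((c l i) ^ 2 : ℝ) : ℂ) * ((n i v ^ 2 : ℝ) : ℂ)).re = (c l i) ^ 2 * n i v ^ 2 := by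
      rw [← Complex.ofReal_mul, Complex.ofReal_re]
    rw [Complex.add_re, Complex.add_re, h5]
    nlinarith
  have hzero : ∀ l i, i ∉ sub l → ip i v (T l (U l)) = 0 := by
    intro l i hi
    have h := ip_le i v (T l (U l))
    rw [hT0 l i _ hi, mul_zero] at h
    exact norm_le_zero_iff.1 h
  have hinner : ∀ l, ∑ i, ip i v (T l (U l)) = ∑ i ∈ sub l, ip i v (T l (U l)) := fun l =>
    (Finset.sum_subset (Finset.subset_univ _) fun i _ hi => hzero l i hi).symm
  have hswap : ∀ g : J → ι → ℝ, ∑ l, ∑ i ∈ sub l, g l i =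
      ∑ i, ∑ l ∈ Finset.univ.filter (fun l => i ∈ sub l), g l i := by
    intro g
    exact Finset.sum_comm' (by simp)
  have hY : ∑ l, ∑ i ∈ sub l, n i v ^ 2 ≤ Λ * ∑ i, n i v ^ 2 := by
    rw [hswap, Finset.mul_sum]
    refine Finset.sum_le_sum fun i _ => ?_
    rw [Finset.sum_const, nsmul_eq_mul]
    exact mul_le_mul_of_nonneg_right (by exact_mod_cast hΛ i) (sq_nonneg _)
  have hcfil : ∀ i, ∑ l ∈ Finset.univ.filter (fun l => i ∈ sub l), c l i = 1 := by
    intro i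
    rw [← c_sum i]
    refine Finset.sum_subset (Finset.subset_univ _) fun l _ hl => c_zero l i ?_
    simpa using hl
  have hYc : ∑ l, ∑ i ∈ sub l, c l i * n i v ^ 2 = ∑ i, n i v ^ 2 := by
    rw [hswap]
    refine Finset.sum_congr rfl fun i _ => ?_
    rw [← Finset.sum_mul, hcfil, one_mul]
  -- Cauchy-Schwarz: at most `Λ` nonnegative weights with sum one have sum of squares at least `1 /
  -- Λ`.
  have hc2 : 1 / (Λ : ℝ) * ∑ i, n i v ^ 2 ≤ ∑ l, ∑ i ∈ sub l, c l i ^ 2 * n i v ^ 2 := by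
    rw [hswap, Finset.mul_sum]
    refine Finset.sum_le_sum fun i _ => ?_
    rw [← Finset.sum_mul]
    refine mul_le_mul_of_nonneg_right ?_ (sq_nonneg _)
    have h1 := sq_sum_le_card_mul_sum_sq (s := Finset.univ.filter (fun l => i ∈ sub l))
      (f := fun l => c l i)
    rw [hcfil, one_pow] at h1
    have h2 : 0 ≤ ∑ l ∈ Finset.univ.filter (fun l => i ∈ sub l), c l i ^ 2 :=
      Finset.sum_nonneg fun _ _ => sq_nonneg _
    have h3 : ((Finset.univ.filter (fun l => i ∈ sub l)).card : ℝ) ≤ Λ := by exact_mod_cast hΛ i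
    have h4 : 1 ≤ (Λ : ℝ) * ∑ l ∈ Finset.univ.filter (fun l => i ∈ sub l), c l i ^ 2 :=
      h1.trans (mul_le_mul_of_nonneg_right h3 h2)
    have hΛpos : 0 < (Λ : ℝ) := by
      by_contra h
      nlinarith
    rw [div_le_iff₀ hΛpos]; linarith
  refine le_trans ?_ (Complex.re_le_norm _)
  rw [Complex.re_sum]
  have hre : ∀ l, (∑ i, ip i v (T l (U l))).re = ∑ i ∈ sub l, (ip i v (T l (U l))).re := fun l => by
    rw [hinner, Complex.re_sum]
  simp only [hre]
  have hlow := Finset.sum_le_sum fun l (_ : l ∈ (Finset.univ : Finset J)) =>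
    Finset.sum_le_sum fun i (hi : i ∈ sub l) => hpt l i hi
  refine le_trans ?_ hlow
  have hsplit : ∑ l, ∑ i ∈ sub l, ((c l i ^ 2 - (2 * c l i * σ + σ ^ 2)) * n i v ^ 2 -
      (c l i + σ) * (n i v * n i (e l))) =
      ∑ l, ∑ i ∈ sub l, c l i ^ 2 * n i v ^ 2 - 2 * σ * (∑ l, ∑ i ∈ sub l, c l i * n i v ^ 2) -
      σ ^ 2 * (∑ l, ∑ i ∈ sub l, n i v ^ 2) -
      ∑ l, ∑ i ∈ sub l, (c l i + σ) * (n i v * n i (e l)) := by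
    simp only [Finset.mul_sum, ← Finset.sum_sub_distrib]
    exact Finset.sum_congr rfl fun l _ => Finset.sum_congr rfl fun i _ => by ring
  rw [hsplit, hYc]
  have herr := Finset.sum_le_sum fun l (_ : l ∈ (Finset.univ : Finset J)) => hloc l
  rw [Finset.sum_add_distrib, ← Finset.mul_sum, ← Finset.mul_sum, hYc] at herr
  -- The losses are `2σ + t ≤ 3t` at first order, and `σ² + 3t² ≤ 4t²` times `Λ` at second order.
  set N := ∑ i, n i v ^ 2
  have hN : 0 ≤ N := Finset.sum_nonneg fun _ _ => sq_nonneg _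
  have hσ2 : σ ^ 2 ≤ t ^ 2 := pow_le_pow_left₀ hσ.le hσt 2
  have hΛN : 0 ≤ (Λ : ℝ) * N := by positivity
  have e1 := mul_le_mul_of_nonneg_left hY (sq_nonneg σ)
  have e2 := mul_le_mul_of_nonneg_left hY (sq_nonneg t)
  have e3 := mul_le_mul_of_nonneg_right hσ2 hΛN
  have e4 := mul_le_mul_of_nonneg_right hσt hN
  nlinarith

/-! ### Sesquilinear forms of real matrices -/

open Matrix in
/-- The bilinear form of a real matrix. -/
def rform {n : Type*} [Fintype n] (M : Matrix n n ℝ) (x y : n → ℝ) : ℝ := y ⬝ᵥ M *ᵥ x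

open Matrix in
/-- The sesquilinear form of a real matrix. -/
def cform {n : Type*} [Fintype n] (M : Matrix n n ℝ) (V W : n → ℂ) : ℂ :=
  star W ⬝ᵥ (M.map fun t => (t : ℂ)) *ᵥ V

section Forms

variable {n : Type*} [Fintype n]

lemma cform_eq_sum (M : Matrix n n ℝ) (V W : n → ℂ) :
    cform M V W = ∑ p, ∑ q, star (W p) * ((M p q : ℂ) * V q) := by
  simp [cform, dotProduct, Matrix.mulVec, Finset.mul_sum]

lemma rform_eq_sum (M : Matrix n n ℝ) (x y : n → ℝ) :
    rform M x y = ∑ p, ∑ q, y p * (M p q * x q) := by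
  simp [rform, dotProduct, Matrix.mulVec, Finset.mul_sum]

/-- The splitting into real and imaginary parts through which finite element estimates, proved for
real coefficient vectors, are transferred to complex ones. -/
lemma cform_eq (M : Matrix n n ℝ) (V W : n → ℂ) :
    cform M V W = ((rform M (fun p => (V p).re) (fun p => (W p).re) +
      rform M (fun p => (V p).im) (fun p => (W p).im) : ℝ) : ℂ) +
      ((rform M (fun p => (V p).im) (fun p => (W p).re) -
      rform M (fun p => (V p).re) (fun p => (W p).im) : ℝ) : ℂ) * Complex.I := by
  simp only [cform_eq_sum, rform_eq_sum]
  apply Complex.ext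
  · simp only [Complex.re_sum, Complex.add_re, Complex.ofReal_re, Complex.mul_re, Complex.I_re,
      Complex.I_im, Complex.ofReal_im, ← Finset.sum_add_distrib, Complex.star_def, Complex.conj_re,
      Complex.conj_im, Complex.mul_im]
    simp only [mul_zero, zero_mul, sub_zero, add_zero]
    exact Finset.sum_congr rfl fun p _ => Finset.sum_congr rfl fun q _ => by ring
  · simp only [Complex.im_sum, Complex.add_im, Complex.ofReal_re, Complex.mul_re, Complex.I_re,
      Complex.I_im, Complex.ofReal_im, ← Finset.sum_sub_distrib, Complex.star_def, Complex.conj_re,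
      Complex.conj_im, Complex.mul_im]
    simp only [mul_zero, zero_mul, mul_one, zero_add, sub_zero, add_zero]
    exact Finset.sum_congr rfl fun p _ => Finset.sum_congr rfl fun q _ => by ring

lemma rform_symm {M : Matrix n n ℝ} (hM : M.PosSemidef) (x y : n → ℝ) :
    rform M x y = rform M y x := by
  have h : ∀ p q, M p q = M q p := fun p q => by
    simpa using (hM.isHermitian.apply q p)
  rw [rform_eq_sum, rform_eq_sum, Finset.sum_comm]
  refine Finset.sum_congr rfl fun p _ => Finset.sum_congr rfl fun q _ => ?_
  rw [h p q]; ring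

lemma rform_nonneg {M : Matrix n n ℝ} (hM : M.PosSemidef) (x : n → ℝ) : 0 ≤ rform M x x := by
  simpa [rform] using hM.dotProduct_mulVec_nonneg x

lemma cform_self {M : Matrix n n ℝ} (hM : M.PosSemidef) (V : n → ℂ) :
    cform M V V = ((rform M (fun p => (V p).re) (fun p => (V p).re) +
      rform M (fun p => (V p).im) (fun p => (V p).im) : ℝ) : ℂ) := by
  rw [cform_eq, rform_symm hM (fun p => (V p).im) (fun p => (V p).re)]
  simp

open scoped ComplexOrder

lemma posSemidef_map {M : Matrix n n ℝ} (hM : M.PosSemidef) :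
    (M.map fun t => (t : ℂ)).PosSemidef := by
  refine Matrix.PosSemidef.of_dotProduct_mulVec_nonneg ?_ fun V => ?_
  · ext p q
    have := hM.isHermitian.apply p q
    simp only [star_trivial] at this
    simp [Matrix.conjTranspose_apply, this]
  · have h := cform_self hM V
    rw [cform] at h
    rw [h]
    exact_mod_cast add_nonneg (rform_nonneg hM _) (rform_nonneg hM _)

lemma matrix_norm_sq {M : Matrix n n ℝ} (hM : M.PosSemidef) (V : n → ℂ) :
    (Matrix.toSeminormedAddCommGroup _ (posSemidef_map hM)).norm V ^ 2 =
      rform M (fun p => (V p).re) (fun p => (V p).re) +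
      rform M (fun p => (V p).im) (fun p => (V p).im) := by
  have h := @inner_self_eq_norm_sq ℂ _ _ (Matrix.toSeminormedAddCommGroup _ (posSemidef_map hM))
    (Matrix.toInnerProductSpace _ (posSemidef_map hM)) V
  refine h.symm.trans ?_
  have h2 : (Matrix.toInnerProductSpace _ (posSemidef_map hM)).inner V V = cform M V V :=
    dotProduct_comm _ _
  rw [h2, cform_self hM]
  exact Complex.ofReal_re _

/-- The seminorm of a positive semidefinite real matrix on complex vectors. -/
def formSeminorm (M : Matrix n n ℝ) (hM : M.PosSemidef) : Seminorm ℝ (n → ℂ) :=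
  Seminorm.of (Matrix.toSeminormedAddCommGroup _ (posSemidef_map hM)).norm
    (fun V W => @norm_add_le _
      (Matrix.toSeminormedAddCommGroup _ (posSemidef_map hM)).toSeminormedAddGroup V W)
    (fun a V => by
      have h0 : ∀ W, 0 ≤ (Matrix.toSeminormedAddCommGroup _ (posSemidef_map hM)).norm W := fun W =>
        @norm_nonneg _ (Matrix.toSeminormedAddCommGroup _ (posSemidef_map hM)).toSeminormedAddGroup W
      rw [← sq_eq_sq₀ (h0 _) (mul_nonneg (norm_nonneg _) (h0 _)), mul_pow, matrix_norm_sq hM,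
        matrix_norm_sq hM, Real.norm_eq_abs, sq_abs]
      simp only [rform_eq_sum, Pi.smul_apply, Complex.smul_re, Complex.smul_im, smul_eq_mul,
        ← Finset.sum_add_distrib, Finset.mul_sum]
      exact Finset.sum_congr rfl fun p _ => Finset.sum_congr rfl fun q _ => by ring)

lemma formSeminorm_sq {M : Matrix n n ℝ} (hM : M.PosSemidef) (V : n → ℂ) :
    formSeminorm M hM V ^ 2 = rform M (fun p => (V p).re) (fun p => (V p).re) +
      rform M (fun p => (V p).im) (fun p => (V p).im) :=
  matrix_norm_sq hM V

lemma norm_cform_le {M : Matrix n n ℝ} (hM : M.PosSemidef) (V W : n → ℂ) :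
    ‖cform M V W‖ ≤ formSeminorm M hM V * formSeminorm M hM W := by
  have h := @norm_inner_le_norm ℂ _ _ (Matrix.toSeminormedAddCommGroup _ (posSemidef_map hM))
    (Matrix.toInnerProductSpace _ (posSemidef_map hM)) W V
  have h2 : (Matrix.toInnerProductSpace _ (posSemidef_map hM)).inner W V = cform M V W :=
    dotProduct_comm _ _
  rw [h2] at h
  rw [mul_comm]
  exact h

lemma cform_self_eq_sq {M : Matrix n n ℝ} (hM : M.PosSemidef) (V : n → ℂ) :
    cform M V V = ((formSeminorm M hM V ^ 2 : ℝ) : ℂ) := by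
  rw [cform_self hM, formSeminorm_sq hM]

lemma cform_add_right (M : Matrix n n ℝ) (V W W' : n → ℂ) :
    cform M V (W + W') = cform M V W + cform M V W' := by
  simp [cform]

lemma cform_sub_right (M : Matrix n n ℝ) (V W W' : n → ℂ) :
    cform M V (W - W') = cform M V W - cform M V W' := by
  simp [cform]

lemma cform_sub_left (M : Matrix n n ℝ) (V V' W : n → ℂ) :
    cform M (V - V') W = cform M V W - cform M V' W := by
  simp [cform, Matrix.mulVec_sub]

lemma cform_smul_right (M : Matrix n n ℝ) (t : ℝ) (V W : n → ℂ) :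
    cform M V (t • W) = t * cform M V W := by
  simp only [cform_eq_sum, Finset.mul_sum]
  refine Finset.sum_congr rfl fun p _ => Finset.sum_congr rfl fun q _ => ?_
  simp; ring

lemma cform_smul_left (M : Matrix n n ℝ) (t : ℝ) (V W : n → ℂ) :
    cform M (t • V) W = t * cform M V W := by
  simp only [cform_eq_sum, Finset.mul_sum]
  refine Finset.sum_congr rfl fun p _ => Finset.sum_congr rfl fun q _ => ?_
  simp; ring

lemma cform_conj {M : Matrix n n ℝ} (hM : M.PosSemidef) (V W : n → ℂ) :
    star (cform M V W) = cform M W V := by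
  rw [cform_eq, cform_eq, rform_symm hM (fun p => (W p).re), rform_symm hM (fun p => (W p).im),
    rform_symm hM (fun p => (W p).im), rform_symm hM (fun p => (W p).re)]
  apply Complex.ext <;> simp

lemma rform_add_mat (A B : Matrix n n ℝ) (x y : n → ℝ) :
    rform (A + B) x y = rform A x y + rform B x y := by
  simp [rform, Matrix.add_mulVec]

lemma rform_smul_mat (t : ℝ) (A : Matrix n n ℝ) (x y : n → ℝ) :
    rform (t • A) x y = t * rform A x y := by
  simp [rform, Matrix.smul_mulVec]

/-- Multiplication of a vector by real weights. -/
def weightMap (t : n → ℝ) : (n → ℂ) →ₗ[ℝ] (n → ℂ) where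
  toFun V p := t p • V p
  map_add' V W := by ext p; simp
  map_smul' a V := by ext p; simp; ring

lemma re_weightMap {m : Type*} (t : m → ℝ) (V : m → ℂ) (p : m) :
    (weightMap t V p).re = t p * (V p).re := by simp [weightMap]

lemma im_weightMap {m : Type*} (t : m → ℝ) (V : m → ℂ) (p : m) :
    (weightMap t V p).im = t p * (V p).im := by simp [weightMap]

/-- An almost-multiplication estimate for real vectors carries over to complex ones. -/
lemma formSeminorm_weightMap_sub_le {M : Matrix n n ℝ} (hM : M.PosSemidef) (t : n → ℝ) (c σ : ℝ)
    (hσ : 0 ≤ σ)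
    (h : ∀ x : n → ℝ, rform M (fun p => (t p - c) * x p) (fun p => (t p - c) * x p) ≤
      σ ^ 2 * rform M x x) (V : n → ℂ) :
    formSeminorm M hM (weightMap t V - c • V) ≤ σ * formSeminorm M hM V := by
  refine le_of_sq_le_sq ?_ (mul_nonneg hσ (apply_nonneg _ _))
  rw [mul_pow, formSeminorm_sq, formSeminorm_sq, mul_add]
  have e1 : (fun p => ((weightMap t V - c • V) p).re) = fun p => (t p - c) * (V p).re := by
    ext p; simp [re_weightMap]; ring
  have e2 : (fun p => ((weightMap t V - c • V) p).im) = fun p => (t p - c) * (V p).im := by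
    ext p; simp [im_weightMap]; ring
  rw [e1, e2]
  exact add_le_add (h _) (h _)

lemma sqrt_rform_re_le {M : Matrix n n ℝ} (hM : M.PosSemidef) (V : n → ℂ) :
    √(rform M (fun p => (V p).re) (fun p => (V p).re)) ≤ formSeminorm M hM V := by
  rw [Real.sqrt_le_left (apply_nonneg _ _), formSeminorm_sq]
  linarith [rform_nonneg hM fun p => (V p).im]

lemma sqrt_rform_im_le {M : Matrix n n ℝ} (hM : M.PosSemidef) (V : n → ℂ) :
    √(rform M (fun p => (V p).im) (fun p => (V p).im)) ≤ formSeminorm M hM V := by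
  rw [Real.sqrt_le_left (apply_nonneg _ _), formSeminorm_sq]
  linarith [rform_nonneg hM fun p => (V p).re]

/-- A bound for the difference of two real bilinear forms carries over to complex vectors. -/
lemma norm_cform_weightMap_sub_le {ι : Type*} (s : Finset ι) {M : ι → Matrix n n ℝ}
    (hM : ∀ i, (M i).PosSemidef) (G G' : Matrix n n ℝ) (t : n → ℝ) (τ : ℝ) (hτ : 0 ≤ τ)
    (h : ∀ x y : n → ℝ, |rform G x (fun p => t p * y p) - rform G' x y| ≤
      τ * ∑ i ∈ s, √(rform (M i) x x) * √(rform (M i) y y)) (V W : n → ℂ) :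
    ‖cform G V (weightMap t W) - cform G' V W‖ ≤
      4 * τ * ∑ i ∈ s, formSeminorm (M i) (hM i) V * formSeminorm (M i) (hM i) W := by
  set S := ∑ i ∈ s, formSeminorm (M i) (hM i) V * formSeminorm (M i) (hM i) W
  have key : ∀ x y : n → ℝ, (∀ i, √(rform (M i) x x) ≤ formSeminorm (M i) (hM i) V) →
      (∀ i, √(rform (M i) y y) ≤ formSeminorm (M i) (hM i) W) →
      |rform G x (fun p => t p * y p) - rform G' x y| ≤ τ * S := fun x y hx hy =>
    (h x y).trans (mul_le_mul_of_nonneg_left (Finset.sum_le_sum fun i _ =>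
      mul_le_mul (hx i) (hy i) (Real.sqrt_nonneg _) (apply_nonneg _ _)) hτ)
  -- The complex form involves four real differences, two in the real part and two in the imaginary
  -- part, each at most `τ S`; hence the factor `4`.
  have k1 := key (fun p => (V p).re) (fun p => (W p).re) (fun i => sqrt_rform_re_le (hM i) V)
    (fun i => sqrt_rform_re_le (hM i) W)
  have k2 := key (fun p => (V p).im) (fun p => (W p).im) (fun i => sqrt_rform_im_le (hM i) V)
    (fun i => sqrt_rform_im_le (hM i) W)
  have k3 := key (fun p => (V p).im) (fun p => (W p).re) (fun i => sqrt_rform_im_le (hM i) V)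
    (fun i => sqrt_rform_re_le (hM i) W)
  have k4 := key (fun p => (V p).re) (fun p => (W p).im) (fun i => sqrt_rform_re_le (hM i) V)
    (fun i => sqrt_rform_im_le (hM i) W)
  have e1 : (fun p => (weightMap t W p).re) = fun p => t p * (W p).re :=
    funext fun p => re_weightMap t W p
  have e2 : (fun p => (weightMap t W p).im) = fun p => t p * (W p).im :=
    funext fun p => im_weightMap t W p
  refine (Complex.norm_le_abs_re_add_abs_im _).trans ?_
  rw [cform_eq, cform_eq, e1, e2]
  simp only [Complex.sub_re, Complex.add_re, Complex.ofReal_re, Complex.mul_re, Complex.I_re,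
    Complex.I_im, Complex.ofReal_im, Complex.sub_im, Complex.add_im, Complex.mul_im, mul_zero,
    mul_one, sub_zero, zero_add, add_zero]
  rw [abs_le] at k1 k2 k3 k4
  have a1 : |rform G (fun p => (V p).re) (fun p => t p * (W p).re) +
      rform G (fun p => (V p).im) (fun p => t p * (W p).im) -
      (rform G' (fun p => (V p).re) (fun p => (W p).re) +
      rform G' (fun p => (V p).im) (fun p => (W p).im))| ≤ 2 * (τ * S) := by
    rw [abs_le]; constructor <;> linarith [k1.1, k1.2, k2.1, k2.2]
  have a2 : |rform G (fun p => (V p).im) (fun p => t p * (W p).re) -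
      rform G (fun p => (V p).re) (fun p => t p * (W p).im) -
      (rform G' (fun p => (V p).im) (fun p => (W p).re) -
      rform G' (fun p => (V p).re) (fun p => (W p).im))| ≤ 2 * (τ * S) := by
    rw [abs_le]; constructor <;> linarith [k3.1, k3.2, k4.1, k4.2]
  linarith

end Forms

/-! ### Coercivity -/

lemma norm_impedance_le {k ε : ℝ} {η : ℂ} (hk : 0 < k) (hεk : |ε| ≤ k ^ 2)
    (hη : ImpedanceChoice k ε η) : ‖η‖ ≤ 2 * k := by
  rcases hη with h | ⟨h, -⟩
  · rw [h, Complex.norm_real, Real.norm_eq_abs, abs_mul, abs_of_pos hk]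
    have : |((SignType.sign ε : SignType) : ℝ)| ≤ 1 := by
      rcases lt_trichotomy ε 0 with h | h | h <;> simp [h]
    nlinarith
  · have h1 : ‖η‖ ^ 2 ≤ 2 * k ^ 2 := by
      rw [← norm_pow, h]
      refine (norm_add_le _ _).trans ?_
      simp only [norm_pow, norm_mul, Complex.norm_I, Complex.norm_real, Real.norm_eq_abs, sq_abs,
        one_mul]
      linarith
    nlinarith [norm_nonneg η]

/-- A multiplier that makes the Helmholtz form coercive. -/
lemma exists_multiplier {k ε : ℝ} {η : ℂ} (hk : 0 < k) (hε : ε ≠ 0) (hεk : |ε| ≤ k ^ 2)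
    (hη : ImpedanceChoice k ε η) :
    ∃ Θ : ℂ, ‖Θ‖ ≤ 1 ∧ |ε| / (8 * k ^ 2) ≤ Θ.re ∧
      |ε| / (8 * k ^ 2) * k ^ 2 ≤ (-(Θ * ((k : ℂ) ^ 2 + Complex.I * ε))).re ∧
      0 ≤ (-(Θ * (Complex.I * η))).re := by
  have hε0 : 0 < |ε| := abs_pos.2 hε
  have hk2 : 0 < k ^ 2 := by positivity
  have hz : ((k : ℂ) ^ 2 + Complex.I * ε) = ⟨k ^ 2, ε⟩ := by
    apply Complex.ext <;> simp [pow_two]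
  have hmul : |ε| / (8 * k ^ 2) * k ^ 2 = |ε| / 8 := by field_simp
  rw [hz, hmul]
  have hnη := norm_impedance_le hk hεk hη
  rcases hη with h | ⟨h, him⟩
  · set σ : ℝ := ((SignType.sign ε : SignType) : ℝ)
    have hσ : σ * ε = |ε| := by
      rcases lt_or_gt_of_ne hε with h | h
      · simp [σ, h, abs_of_neg h]
      · simp [σ, h, abs_of_pos h]
    have hσ2 : σ * σ = 1 := by
      rcases lt_or_gt_of_ne hε with h | h <;> simp [σ, h]
    have ht : |ε| / (4 * k ^ 2) ≤ 1 / 4 := by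
      rw [div_le_iff₀ (by positivity)]; linarith
    have ht0 : 0 < |ε| / (4 * k ^ 2) := by positivity
    -- The imaginary part `sign(ε)/2` contributes `|ε|/2` to the real part of `-Θ(k² + iε)`; the
    -- real part of `Θ` is chosen so small that it takes back only `|ε|/4`. The impedance term
    -- contributes `k/2`.
    refine ⟨⟨|ε| / (4 * k ^ 2), σ / 2⟩, ?_, ?_, ?_, ?_⟩
    · refine (Complex.norm_le_abs_re_add_abs_im _).trans ?_
      have : |σ / 2| = 1 / 2 := by
        rw [abs_div, abs_two]
        congr 1
        have : |σ| * |σ| = 1 := by rw [← abs_mul, hσ2, abs_one]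
        nlinarith [abs_nonneg σ]
      simp only [this, abs_of_pos ht0]
      linarith
    · change _ ≤ |ε| / (4 * k ^ 2)
      gcongr
      norm_num
    · have e : |ε| / (4 * k ^ 2) * k ^ 2 = |ε| / 4 := by field_simp
      simp only [Complex.neg_re, Complex.mul_re]
      rw [e]; nlinarith
    · rw [h]
      simp only [Complex.neg_re, Complex.mul_re, Complex.I_re, Complex.I_im, Complex.ofReal_re,
        Complex.ofReal_im, Complex.mul_im]
      nlinarith
  · have hre : η.re * η.re - η.im * η.im = k ^ 2 := by
      have := congrArg Complex.re h
      rwa [hz, pow_two, Complex.mul_re] at this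
    have him2 : 2 * (η.re * η.im) = ε := by
      have := congrArg Complex.im h
      rw [hz, pow_two, Complex.mul_im] at this
      linarith
    have hre2 : |η.re| ≤ 2 * k := (Complex.abs_re_le_norm η).trans hnη
    -- From `ε = 2 Re η · Im η` and `|η| ≤ 2k`: the imaginary part of `η` is bounded below by
    -- `|ε|/(4k)`, which gives the constant `|ε|/(8k²)` after division by `2k`.
    have hb : |ε| ≤ 4 * k * η.im := by
      rw [← him2, abs_mul, abs_mul, abs_of_pos him, abs_two]
      nlinarith
    -- Here `Θ = i η̄/(2k)`. Since `k² + iε = η²`, this makes `-Θ(k² + iε) = -i|η|²η/(2k)`, with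
    -- real part `|η|² Im η/(2k)`, and `-iΘη = |η|²/(2k)`.
    refine ⟨⟨η.im / (2 * k), η.re / (2 * k)⟩, ?_, ?_, ?_, ?_⟩
    · have e : (⟨η.im / (2 * k), η.re / (2 * k)⟩ : ℂ) =
          Complex.I * star η * ((1 / (2 * k) : ℝ) : ℂ) := by
        apply Complex.ext <;> simp <;> field_simp
      rw [e, norm_mul, norm_mul, Complex.norm_I, norm_star, one_mul, Complex.norm_real,
        Real.norm_of_nonneg (by positivity), mul_one_div, div_le_one (by positivity)]
      exact hnη
    · change _ ≤ η.im / (2 * k)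
      rw [div_le_div_iff₀ (by positivity) (by positivity)]
      nlinarith
    · simp only [Complex.neg_re, Complex.mul_re]
      have e : -(η.im / (2 * k) * k ^ 2 - η.re / (2 * k) * ε) =
          (η.re * ε - η.im * k ^ 2) / (2 * k) := by field_simp; ring
      rw [e, div_le_div_iff₀ (by norm_num) (by positivity), ← him2, ← hre]
      rw [him2]
      have h3 : η.re * ε = 2 * (η.re * η.re) * η.im := by rw [← him2]; ring
      have h4 : 4 * k * (k ^ 2 * η.im) ≤
          4 * k * (η.re * ε - η.im * (η.re * η.re - η.im * η.im)) := by
        refine mul_le_mul_of_nonneg_left ?_ (by positivity)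
        rw [h3, hre]
        have : k ^ 2 ≤ η.re * η.re := by nlinarith [mul_self_nonneg η.im]
        nlinarith
      nlinarith
    · simp only [Complex.neg_re, Complex.mul_re, Complex.I_re, Complex.I_im, Complex.mul_im]
      have e : -(η.im / (2 * k) * (0 * η.re - 1 * η.im) -
          η.re / (2 * k) * (0 * η.im + 1 * η.re)) =
          (η.im * η.im + η.re * η.re) / (2 * k) := by field_simp; ring
      rw [e]
      have := mul_self_nonneg η.im
      have := mul_self_nonneg η.re
      positivity

/-! ### Estimates for the local forms -/

section LocalForm

variable {n ι : Type*} [Fintype n]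

/-- The Helmholtz form assembled from elementwise stiffness and mass matrices and a boundary mass
matrix. -/
def localForm (sub : Finset ι) (S M : ι → Matrix n n ℝ) (G : Matrix n n ℝ) (z η : ℂ)
    (V W : n → ℂ) : ℂ :=
  ∑ i ∈ sub, (cform (S i) V W - z * cform (M i) V W) - Complex.I * η * cform G V W

lemma localForm_sub_left (sub : Finset ι) (S M : ι → Matrix n n ℝ) (G : Matrix n n ℝ) (z η : ℂ)
    (V V' W : n → ℂ) : localForm sub S M G z η (V - V') W =
      localForm sub S M G z η V W - localForm sub S M G z η V' W := by
  simp only [localForm, cform_sub_left]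
  have e : ∀ i, cform (S i) V W - cform (S i) V' W - z * (cform (M i) V W - cform (M i) V' W) =
      (cform (S i) V W - z * cform (M i) V W) - (cform (S i) V' W - z * cform (M i) V' W) :=
    fun i => by ring
  simp only [e, Finset.sum_sub_distrib]
  ring

variable {S M D : ι → Matrix n n ℝ} {G G' : Matrix n n ℝ} {k : ℝ} {z η : ℂ} {sub : Finset ι}
  (hS : ∀ i, (S i).PosSemidef) (hM : ∀ i, (M i).PosSemidef) (hD : ∀ i, (D i).PosSemidef)
  (hG : G.PosSemidef) (hG' : G'.PosSemidef) (hDSM : ∀ i, D i = S i + k ^ 2 • M i)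

include hS hM hDSM

lemma formSeminorm_sq_split (i : ι) (V : n → ℂ) :
    formSeminorm (D i) (hD i) V ^ 2 =
      formSeminorm (S i) (hS i) V ^ 2 + k ^ 2 * formSeminorm (M i) (hM i) V ^ 2 := by
  simp only [formSeminorm_sq, hDSM, rform_add_mat, rform_smul_mat]
  ring

lemma formSeminorm_stiffness_le (i : ι) (V : n → ℂ) :
    formSeminorm (S i) (hS i) V ≤ formSeminorm (D i) (hD i) V := by
  refine le_of_sq_le_sq ?_ (apply_nonneg _ _)
  rw [formSeminorm_sq_split hS hM hD hDSM]
  nlinarith [sq_nonneg (k * formSeminorm (M i) (hM i) V)]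

lemma formSeminorm_mass_le (i : ι) (V : n → ℂ) :
    k * formSeminorm (M i) (hM i) V ≤ formSeminorm (D i) (hD i) V := by
  refine le_of_sq_le_sq ?_ (apply_nonneg _ _)
  rw [formSeminorm_sq_split hS hM hD hDSM, mul_pow]
  nlinarith [sq_nonneg (formSeminorm (S i) (hS i) V)]

/-- Each mass norm is worth `1/k` of an energy norm. The resulting `k⁻²` pays for the factors `k²`
in the zero-order term and `k` in the impedance term. -/
lemma mass_mul_le (hk : 0 < k) (i : ι) (V W : n → ℂ) :
    formSeminorm (M i) (hM i) V * formSeminorm (M i) (hM i) W ≤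
      (k ^ 2)⁻¹ * (formSeminorm (D i) (hD i) V * formSeminorm (D i) (hD i) W) := by
  rw [← div_eq_inv_mul, le_div_iff₀ (by positivity)]
  have := mul_le_mul (formSeminorm_mass_le hS hM hD hDSM i V)
    (formSeminorm_mass_le hS hM hD hDSM i W) (mul_nonneg hk.le (apply_nonneg _ _))
    (apply_nonneg _ _)
  linarith

lemma norm_volume_form_le (hk : 0 < k) (hz : ‖z‖ ≤ 2 * k ^ 2) (i : ι) (V W : n → ℂ) :
    ‖cform (S i) V W - z * cform (M i) V W‖ ≤
      3 * (formSeminorm (D i) (hD i) V * formSeminorm (D i) (hD i) W) := by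
  refine (norm_sub_le _ _).trans ?_
  rw [norm_mul]
  have h1 : ‖cform (S i) V W‖ ≤ formSeminorm (D i) (hD i) V * formSeminorm (D i) (hD i) W :=
    (norm_cform_le (hS i) V W).trans (mul_le_mul (formSeminorm_stiffness_le hS hM hD hDSM i V)
      (formSeminorm_stiffness_le hS hM hD hDSM i W) (apply_nonneg _ _) (apply_nonneg _ _))
  have h2 : ‖z‖ * ‖cform (M i) V W‖ ≤ 2 * k ^ 2 * ((k ^ 2)⁻¹ *
      (formSeminorm (D i) (hD i) V * formSeminorm (D i) (hD i) W)) :=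
    mul_le_mul hz ((norm_cform_le (hM i) V W).trans (mass_mul_le hS hM hD hDSM hk i V W))
      (norm_nonneg _) (by positivity)
  have h3 : 2 * k ^ 2 * ((k ^ 2)⁻¹ *
      (formSeminorm (D i) (hD i) V * formSeminorm (D i) (hD i) W)) =
      2 * (formSeminorm (D i) (hD i) V * formSeminorm (D i) (hD i) W) := by
    field_simp
  linarith

variable {t : n → ℝ} {c : ι → ℝ} {σ τ : ℝ} (hk : 0 < k) (hz : ‖z‖ ≤ 2 * k ^ 2)
  (hη : ‖η‖ ≤ 2 * k) (hτ : 0 ≤ τ)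
  (hT : ∀ i V, formSeminorm (D i) (hD i) (weightMap t V - c i • V) ≤
    σ * formSeminorm (D i) (hD i) V)
  (hB : ∀ x y : n → ℝ, |rform G x (fun p => t p * y p) - rform G' x y| ≤
      τ * ∑ i ∈ sub, √(rform (M i) x x) * √(rform (M i) y y))

-- The constant collects `2k` from the impedance parameter, `4τ` from the passage to complex vectors
-- and `k⁻²` from the mass norms. With `τ ∼ 1/δ` it is of the same order `1/(kδ)` as the volume
-- terms.
include hk hη hτ hB in
lemma norm_boundary_form_le (V W : n → ℂ) :
    ‖η‖ * ‖cform G V (weightMap t W) - cform G' V W‖ ≤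
      8 * τ / k * ∑ i ∈ sub, formSeminorm (D i) (hD i) V * formSeminorm (D i) (hD i) W := by
  have h1 := norm_cform_weightMap_sub_le sub hM G G' t τ hτ hB V W
  have h2 : ∑ i ∈ sub, formSeminorm (M i) (hM i) V * formSeminorm (M i) (hM i) W ≤
      (k ^ 2)⁻¹ * ∑ i ∈ sub, formSeminorm (D i) (hD i) V * formSeminorm (D i) (hD i) W := by
    rw [Finset.mul_sum]
    exact Finset.sum_le_sum fun i _ => mass_mul_le hS hM hD hDSM hk i V W
  set A := ∑ i ∈ sub, formSeminorm (D i) (hD i) V * formSeminorm (D i) (hD i) W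
  calc ‖η‖ * ‖cform G V (weightMap t W) - cform G' V W‖
      ≤ 2 * k * (4 * τ * ((k ^ 2)⁻¹ * A)) :=
        mul_le_mul hη (h1.trans (mul_le_mul_of_nonneg_left h2 (by positivity))) (norm_nonneg _)
          (by positivity)
    _ = 8 * τ / k * A := by field_simp; ring

include hG hG' hk hz hη hτ hT hB in
/-- The commutator of a local form with a partition of unity function. -/
lemma norm_localForm_comm_le (V W : n → ℂ) :
    ‖localForm sub S M G z η (weightMap t V) W - localForm sub S M G z η V (weightMap t W)‖ ≤
      (6 * σ + 16 * τ / k) *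
        ∑ i ∈ sub, formSeminorm (D i) (hD i) V * formSeminorm (D i) (hD i) W := by
  have hvol : ∀ i, ‖(cform (S i) (weightMap t V) W - z * cform (M i) (weightMap t V) W) -
      (cform (S i) V (weightMap t W) - z * cform (M i) V (weightMap t W))‖ ≤
      6 * σ * (formSeminorm (D i) (hD i) V * formSeminorm (D i) (hD i) W) := by
    intro i
    -- On one element the real number `c i` may be subtracted from the weight on both sides, since
    -- multiplication by a real constant commutes with the form. Two terms with continuity constant
    -- `3` remain.
    have e : (cform (S i) (weightMap t V) W - z * cform (M i) (weightMap t V) W) -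
        (cform (S i) V (weightMap t W) - z * cform (M i) V (weightMap t W)) =
        (cform (S i) (weightMap t V - c i • V) W - z * cform (M i) (weightMap t V - c i • V) W) -
        (cform (S i) V (weightMap t W - c i • W) -
          z * cform (M i) V (weightMap t W - c i • W)) := by
      simp only [cform_sub_left, cform_sub_right, cform_smul_left, cform_smul_right]
      ring
    rw [e]
    refine (norm_sub_le _ _).trans ?_
    have h1 := norm_volume_form_le hS hM hD hDSM hk hz i (weightMap t V - c i • V) W
    have h2 := norm_volume_form_le hS hM hD hDSM hk hz i V (weightMap t W - c i • W)
    have h3 := mul_le_mul_of_nonneg_right (hT i V) (apply_nonneg (formSeminorm (D i) (hD i)) W)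
    have h4 := mul_le_mul_of_nonneg_left (hT i W) (apply_nonneg (formSeminorm (D i) (hD i)) V)
    linarith
  have hbdr : ‖η‖ * ‖cform G (weightMap t V) W - cform G V (weightMap t W)‖ ≤
      16 * τ / k * ∑ i ∈ sub, formSeminorm (D i) (hD i) V * formSeminorm (D i) (hD i) W := by
    -- The form `G'`, with the weight inside the boundary integral, is an intermediary for both
    -- terms. Hermitian symmetry of `G` and `G'` turns the first difference into the second with the
    -- arguments exchanged.
    have e : cform G (weightMap t V) W - cform G V (weightMap t W) =
        star (cform G W (weightMap t V) - cform G' W V) -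
          (cform G V (weightMap t W) - cform G' V W) := by
      rw [star_sub, cform_conj hG, cform_conj hG']; ring
    have h1 := norm_boundary_form_le hS hM hD hDSM hk hη hτ hB V W
    have h2 := norm_boundary_form_le hS hM hD hDSM hk hη hτ hB W V
    simp only [mul_comm (formSeminorm (D _) (hD _) W)] at h2
    rw [e]
    have h3 : ‖star (cform G W (weightMap t V) - cform G' W V) -
          (cform G V (weightMap t W) - cform G' V W)‖ ≤
          ‖cform G W (weightMap t V) - cform G' W V‖ +
          ‖cform G V (weightMap t W) - cform G' V W‖ := by
      refine (norm_sub_le _ _).trans ?_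
      rw [norm_star]
    have h4 := mul_le_mul_of_nonneg_left h3 (norm_nonneg η)
    have h5 : 16 * τ / k = 8 * τ / k + 8 * τ / k := by ring
    rw [h5, add_mul]
    linarith
  have e : localForm sub S M G z η (weightMap t V) W - localForm sub S M G z η V (weightMap t W) =
      ∑ i ∈ sub, ((cform (S i) (weightMap t V) W - z * cform (M i) (weightMap t V) W) -
      (cform (S i) V (weightMap t W) - z * cform (M i) V (weightMap t W))) -
      Complex.I * (η * (cform G (weightMap t V) W - cform G V (weightMap t W))) := by
    simp only [localForm, Finset.sum_sub_distrib]
    ring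
  rw [e]
  refine (norm_sub_le _ _).trans ?_
  rw [norm_mul, Complex.norm_I, one_mul, norm_mul, add_mul]
  refine add_le_add ?_ hbdr
  rw [Finset.mul_sum]
  exact (norm_sum_le _ _).trans (Finset.sum_le_sum fun i _ => hvol i)

variable {Θ : ℂ} {γ : ℝ} (hΘ : ‖Θ‖ ≤ 1) (hΘ1 : γ ≤ Θ.re) (hΘz : γ * k ^ 2 ≤ (-(Θ * z)).re)
  (hΘη : 0 ≤ (-(Θ * (Complex.I * η))).re)

include hΘ1 hΘz in
lemma volume_form_coercive (i : ι) (V : n → ℂ) :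
    γ * formSeminorm (D i) (hD i) V ^ 2 ≤
      (Θ * (cform (S i) V V - z * cform (M i) V V)).re := by
  rw [cform_self_eq_sq (hS i), cform_self_eq_sq (hM i), formSeminorm_sq_split hS hM hD hDSM]
  set a := formSeminorm (S i) (hS i) V ^ 2 with ha
  set b := formSeminorm (M i) (hM i) V ^ 2 with hb
  have ha0 : 0 ≤ a := sq_nonneg _
  have hb0 : 0 ≤ b := sq_nonneg _
  have e : Θ * ((a : ℂ) - z * (b : ℂ)) = Θ * (a : ℂ) + -(Θ * z) * (b : ℂ) := by ring
  rw [e, Complex.add_re, Complex.re_mul_ofReal, Complex.re_mul_ofReal]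
  nlinarith [mul_le_mul_of_nonneg_right hΘ1 ha0, mul_le_mul_of_nonneg_right hΘz hb0]

-- Multiplication by `Θ` does not increase the modulus, gives every volume term a real part of at
-- least `γ` times the energy, and leaves a boundary term of nonnegative real part, which is
-- dropped.
include hG hΘ hΘ1 hΘz hΘη in
lemma localForm_coercive (V : n → ℂ) :
    γ * ∑ i ∈ sub, formSeminorm (D i) (hD i) V ^ 2 ≤ ‖localForm sub S M G z η V V‖ := by
  have h1 : ‖Θ * localForm sub S M G z η V V‖ ≤ ‖localForm sub S M G z η V V‖ := by
    rw [norm_mul]; exact mul_le_of_le_one_left (norm_nonneg _) hΘ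
  refine le_trans ?_ ((Complex.re_le_norm _).trans h1)
  have e : Θ * localForm sub S M G z η V V =
      ∑ i ∈ sub, Θ * (cform (S i) V V - z * cform (M i) V V) +
        -(Θ * (Complex.I * η)) * ((formSeminorm G hG V ^ 2 : ℝ) : ℂ) := by
    rw [← cform_self_eq_sq hG, localForm, ← Finset.mul_sum]; ring
  rw [e, Complex.add_re, Complex.re_mul_ofReal, Complex.re_sum, Finset.mul_sum]
  have h2 := Finset.sum_le_sum fun i (_ : i ∈ sub) =>
    volume_form_coercive hS hM hD hDSM hΘ1 hΘz i V
  have h3 := mul_nonneg hΘη (sq_nonneg (formSeminorm G hG V))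
  linarith

include hG' hk hz hη hτ hT hB hΘ hΘ1 hΘz hΘη in
/-- Coercivity in the norm weighted by a partition of unity function. -/
lemma localForm_weighted_coercive (hc : ∀ i, 0 ≤ c i) (V : n → ℂ) :
    γ * ∑ i ∈ sub, c i * formSeminorm (D i) (hD i) V ^ 2 ≤
      ‖localForm sub S M G z η V (weightMap t V)‖ +
        (3 * σ + 8 * τ / k) * ∑ i ∈ sub, formSeminorm (D i) (hD i) V ^ 2 := by
  have h1 : ‖Θ * localForm sub S M G z η V (weightMap t V)‖ ≤
      ‖localForm sub S M G z η V (weightMap t V)‖ := by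
    rw [norm_mul]; exact mul_le_of_le_one_left (norm_nonneg _) hΘ
  have hre : (Θ * localForm sub S M G z η V (weightMap t V)).re ≤
      ‖localForm sub S M G z η V (weightMap t V)‖ := (Complex.re_le_norm _).trans h1
  have hvol : ∀ i, γ * (c i * formSeminorm (D i) (hD i) V ^ 2) -
      3 * σ * formSeminorm (D i) (hD i) V ^ 2 ≤
      (Θ * (cform (S i) V (weightMap t V) - z * cform (M i) V (weightMap t V))).re := by
    intro i
    -- Elementwise coercivity is applied with the frozen nonnegative weight `c i`; the deviation
    -- from the frozen weight goes into the error.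
    have e : Θ * (cform (S i) V (weightMap t V) - z * cform (M i) V (weightMap t V)) =
        Θ * (cform (S i) V V - z * cform (M i) V V) * (c i : ℂ) +
        Θ * (cform (S i) V (weightMap t V - c i • V) -
          z * cform (M i) V (weightMap t V - c i • V)) := by
      simp only [cform_sub_right, cform_smul_right]; ring
    rw [e, Complex.add_re, Complex.re_mul_ofReal]
    have h2 := mul_le_mul_of_nonneg_right
      (volume_form_coercive hS hM hD hDSM hΘ1 hΘz i V) (hc i)
    have h3 : ‖Θ * (cform (S i) V (weightMap t V - c i • V) -
          z * cform (M i) V (weightMap t V - c i • V))‖ ≤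
          3 * σ * formSeminorm (D i) (hD i) V ^ 2 := by
      rw [norm_mul]
      refine (mul_le_of_le_one_left (norm_nonneg _) hΘ).trans ?_
      refine (norm_volume_form_le hS hM hD hDSM hk hz i V _).trans ?_
      have := mul_le_mul_of_nonneg_left (hT i V) (apply_nonneg (formSeminorm (D i) (hD i)) V)
      nlinarith
    have h4 := neg_le_of_abs_le ((Complex.abs_re_le_norm _).trans h3)
    linarith
  have hbdr : -(8 * τ / k * ∑ i ∈ sub, formSeminorm (D i) (hD i) V ^ 2) ≤
      (-(Θ * (Complex.I * η)) * cform G V (weightMap t V)).re := by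
    -- The weighted boundary form `G'` is positive semidefinite, so its contribution has the good
    -- sign; only its difference to `G` enters as an error.
    have e : -(Θ * (Complex.I * η)) * cform G V (weightMap t V) =
        -(Θ * (Complex.I * η)) * ((formSeminorm G' hG' V ^ 2 : ℝ) : ℂ) +
        -(Θ * (Complex.I * (η * (cform G V (weightMap t V) - cform G' V V)))) := by
      rw [← cform_self_eq_sq hG']; ring
    rw [e, Complex.add_re, Complex.re_mul_ofReal]
    have h2 := mul_nonneg hΘη (sq_nonneg (formSeminorm G' hG' V))
    have h3 : ‖-(Θ * (Complex.I * (η * (cform G V (weightMap t V) - cform G' V V))))‖ ≤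
        8 * τ / k * ∑ i ∈ sub, formSeminorm (D i) (hD i) V ^ 2 := by
      rw [norm_neg, norm_mul, norm_mul, Complex.norm_I, one_mul, norm_mul]
      refine (mul_le_of_le_one_left (by positivity) hΘ).trans ?_
      simpa only [← pow_two] using norm_boundary_form_le hS hM hD hDSM hk hη hτ hB V V
    have h4 := neg_le_of_abs_le ((Complex.abs_re_le_norm _).trans h3)
    linarith
  have e : Θ * localForm sub S M G z η V (weightMap t V) =
      ∑ i ∈ sub, Θ * (cform (S i) V (weightMap t V) - z * cform (M i) V (weightMap t V)) +
        -(Θ * (Complex.I * η)) * cform G V (weightMap t V) := by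
    rw [localForm, ← Finset.mul_sum]; ring
  rw [e, Complex.add_re, Complex.re_sum] at hre
  have h5 := Finset.sum_le_sum fun i (_ : i ∈ sub) => hvol i
  rw [Finset.sum_sub_distrib, ← Finset.mul_sum, ← Finset.mul_sum] at h5
  linarith

end LocalForm

/-! ### Polynomials on one element -/

lemma lagrange_bound_of_cell {d m : ℕ} {X : Finset (Fin d → ℝ)} {C : ℝ}
    (hC : ∀ p : MvPolynomial (Fin d) ℝ, p.totalDegree ≤ m → ∀ A : ℝ, 0 ≤ A →
      (∀ x ∈ X, |MvPolynomial.eval x p| ≤ A) →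
      ∀ y : Fin d → ℝ, (∀ j, y j ∈ Set.Icc (0 : ℝ) 1) → |MvPolynomial.eval y p| ≤ C * A)
    (s : Affine.Simplex ℝ (E d) d) {f : MvPolynomial (Fin d) ℝ} (hf : f.totalDegree ≤ m) {A : ℝ}
    (hA : 0 ≤ A) (h : ∀ ξ ∈ X, |polyFun f (refPoint s ξ)| ≤ A) {y : E d} (hy : y ∈ cellOf s) :
    |polyFun f y| ≤ C * A := by
  obtain ⟨q, hq, hqf⟩ := exists_poly_comp_affine f (s.points 0) fun j =>
    s.points (Fin.succ j) - s.points 0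
  obtain ⟨ξ, hξ, rfl⟩ := exists_refPoint_eq s hy
  have := hC q (hq.trans hf) A hA (fun x hx => by rw [hqf]; exact h x hx) ξ hξ
  rwa [hqf] at this

lemma integrableOn_polyFun_mul {d : ℕ} (f g : MvPolynomial (Fin d) ℝ) {s : Set (E d)}
    (hs : IsCompact s) : IntegrableOn (fun y => polyFun f y * polyFun g y) s :=
  ((continuous_polyFun f).mul (continuous_polyFun g)).continuousOn.integrableOn_compact hs

lemma integrableOn_gradient_inner {d : ℕ} (f g : MvPolynomial (Fin d) ℝ) {s : Set (E d)}
    (hs : IsCompact s) :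
    IntegrableOn (fun y => inner ℝ (gradient (polyFun f) y) (gradient (polyFun g) y)) s :=
  ((continuous_gradient_polyFun f).inner
    (continuous_gradient_polyFun g)).continuousOn.integrableOn_compact hs

/-- If the nodal values of `f` are bounded by `θ` times those of `g`, then `f` is bounded by `θ`
times `g` on the element, in all norms, with the natural scaling. -/
lemma exists_element_estimate {d m : ℕ} {X : Finset (Fin d → ℝ)}
    (hX : IsReferenceNodeSet m X) (K : ℝ) (hK : 1 ≤ K) :
    ∃ C : ℝ, 0 < C ∧ ∀ (s : Affine.Simplex ℝ (E d) d) (x₀ : E d) (ρ : ℝ), 0 < ρ →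
      Metric.closedBall x₀ ρ ⊆ cellOf s → Metric.diam (cellOf s) ≤ K * ρ →
      ∀ (f g : MvPolynomial (Fin d) ℝ), f.totalDegree ≤ m → g.totalDegree ≤ m →
      ∀ θ : ℝ, 0 ≤ θ →
      (∀ ξ ∈ X, |polyFun f (refPoint s ξ)| ≤ θ * |polyFun g (refPoint s ξ)|) →
      (∀ y ∈ cellOf s, polyFun f y ^ 2 ≤
        C * θ ^ 2 * (ρ ^ d)⁻¹ * ∫ y in cellOf s, polyFun g y * polyFun g y) ∧
      (∫ y in cellOf s, polyFun f y * polyFun f y) ≤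
        C * θ ^ 2 * ∫ y in cellOf s, polyFun g y * polyFun g y ∧
      (∫ y in cellOf s, inner ℝ (gradient (polyFun f) y) (gradient (polyFun f) y)) ≤
        C * θ ^ 2 * (ρ ^ 2)⁻¹ * ∫ y in cellOf s, polyFun g y * polyFun g y := by
  obtain ⟨C₁, hC₁, h₁⟩ := exists_inverse_estimate d m K
  obtain ⟨C₂, hC₂, h₂⟩ := exists_nodal_bound hX
  set ω : ℝ := (volume : Measure (E d)).real (Metric.ball (0 : E d) 1) with hω
  have hω0 : 0 ≤ ω := measureReal_nonneg
  -- `A` is the constant of the pointwise bound for `f`: the inverse estimate bounds `g` at the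
  -- nodes, and the nodal bound passes to `f` on the whole element. `B` bounds the volume of the
  -- element relative to `ρ ^ d`.
  set A : ℝ := C₂ ^ 2 * C₁ with hA
  have hA0 : 0 < A := by positivity
  set B : ℝ := K ^ d * ω with hB
  have hB0 : 0 ≤ B := by positivity
  refine ⟨A + B * A + B * (C₁ * (ω * A)), by positivity, ?_⟩
  intro s x₀ ρ hρ hball hdiam f g hf hg θ hθ hfg
  set I : ℝ := ∫ y in cellOf s, polyFun g y * polyFun g y with hI
  have hI0 : 0 ≤ I := integral_nonneg fun y => mul_self_nonneg _
  have hcell : cellOf s ⊆ Metric.closedBall x₀ (K * ρ) := fun y hy =>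
    (Metric.dist_le_diam_of_mem (isCompact_cellOf s).isBounded hy
      (hball (Metric.mem_closedBall_self hρ.le))).trans hdiam
  have hρd : 0 < ρ ^ d := by positivity
  have hgy : ∀ y ∈ cellOf s, polyFun g y ^ 2 ≤ C₁ * (ρ ^ d)⁻¹ * I := by
    intro y hy
    refine ((h₁ g hg x₀ ρ hρ y (hcell hy)).1).trans ?_
    refine mul_le_mul_of_nonneg_left ?_ (by positivity)
    rw [hI]
    simp only [pow_two]
    exact setIntegral_mono_set (integrableOn_polyFun_mul g g (isCompact_cellOf s))
      (Filter.Eventually.of_forall fun y => mul_self_nonneg _) hball.eventuallyLE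
  have hfy : ∀ y ∈ cellOf s, polyFun f y ^ 2 ≤ A * θ ^ 2 * (ρ ^ d)⁻¹ * I := by
    intro y hy
    have h3 : |polyFun f y| ≤ C₂ * (θ * √(C₁ * (ρ ^ d)⁻¹ * I)) := by
      refine lagrange_bound_of_cell h₂ s hf (by positivity) (fun ξ hξ => ?_) hy
      refine (hfg ξ hξ).trans (mul_le_mul_of_nonneg_left ?_ hθ)
      refine Real.le_sqrt_of_sq_le ?_
      rw [sq_abs]
      exact hgy _ (refPoint_mem_cellOf s ξ (hX.1 ξ hξ).1 (hX.1 ξ hξ).2)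
    have h4 := pow_le_pow_left₀ (abs_nonneg _) h3 2
    rw [sq_abs, mul_pow, mul_pow, Real.sq_sqrt (by positivity)] at h4
    refine h4.trans_eq ?_
    rw [hA]; ring
  have hvolB : ∀ R : ℝ, 0 ≤ R →
      (volume : Measure (E d)).real (Metric.closedBall x₀ R) = R ^ d * ω := by
    intro R hR
    rw [measureReal_def, Measure.addHaar_closedBall _ _ hR, finrank_euclideanSpace_fin,
      ENNReal.toReal_mul, ENNReal.toReal_ofReal (by positivity)]
    rfl
  have hvol : (volume : Measure (E d)).real (cellOf s) ≤ B * ρ ^ d := by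
    refine (measureReal_mono hcell (isCompact_closedBall _ _).measure_lt_top.ne).trans_eq ?_
    rw [hvolB _ (by positivity), mul_pow, hB]; ring
  have h_int : ∀ (u : E d → ℝ) (b : ℝ), 0 ≤ b → (∀ y ∈ cellOf s, |u y| ≤ b) →
      ∫ y in cellOf s, u y ≤ b * (B * ρ ^ d) := by
    intro u b hb hu
    have := norm_setIntegral_le_of_norm_le_const (μ := volume)
      (isCompact_cellOf s).measure_lt_top (f := u) hu
    exact (le_abs_self _).trans (this.trans (mul_le_mul_of_nonneg_left hvol hb))
  -- The inverse estimate for `f` on the inscribed ball, where the pointwise bound already controls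
  -- its `L²` norm; the volume of the ball cancels one factor `ρ⁻ᵈ`.
  have hgrad : ∀ y ∈ cellOf s, ‖gradient (polyFun f) y‖ ^ 2 ≤
      C₁ * (ω * A) * θ ^ 2 * (ρ ^ 2)⁻¹ * (ρ ^ d)⁻¹ * I := by
    intro y hy
    refine ((h₁ f hf x₀ ρ hρ y (hcell hy)).2).trans ?_
    have h5 : ∫ y in Metric.closedBall x₀ ρ, polyFun f y ^ 2 ≤
        A * θ ^ 2 * (ρ ^ d)⁻¹ * I * (ρ ^ d * ω) := by
      have := norm_setIntegral_le_of_norm_le_const (μ := volume)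
        (isCompact_closedBall x₀ ρ).measure_lt_top (f := fun y => polyFun f y ^ 2)
        (C := A * θ ^ 2 * (ρ ^ d)⁻¹ * I) (fun y hy => by
          rw [Real.norm_of_nonneg (sq_nonneg _)]; exact hfy y (hball hy))
      rw [hvolB ρ hρ.le] at this
      exact (le_abs_self _).trans this
    calc C₁ * (ρ ^ 2)⁻¹ * (ρ ^ d)⁻¹ * ∫ y in Metric.closedBall x₀ ρ, polyFun f y ^ 2
        ≤ C₁ * (ρ ^ 2)⁻¹ * (ρ ^ d)⁻¹ * (A * θ ^ 2 * (ρ ^ d)⁻¹ * I * (ρ ^ d * ω)) :=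
          mul_le_mul_of_nonneg_left h5 (by positivity)
      _ = _ := by field_simp
  have hrest : 0 ≤ B * A := by positivity
  have hrest2 : 0 ≤ B * (C₁ * (ω * A)) := by positivity
  refine ⟨fun y hy => ?_, ?_, ?_⟩
  · refine (hfy y hy).trans ?_
    gcongr
    linarith
  · refine (h_int _ (A * θ ^ 2 * (ρ ^ d)⁻¹ * I) (by positivity) fun y hy => ?_).trans ?_
    · rw [abs_of_nonneg (mul_self_nonneg _), ← pow_two]; exact hfy y hy
    · have e : A * θ ^ 2 * (ρ ^ d)⁻¹ * I * (B * ρ ^ d) = B * A * θ ^ 2 * I := by field_simp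
      rw [e]
      gcongr
      linarith
  · refine (h_int _ (C₁ * (ω * A) * θ ^ 2 * (ρ ^ 2)⁻¹ * (ρ ^ d)⁻¹ * I) (by positivity)
      fun y hy => ?_).trans ?_
    · rw [real_inner_self_eq_norm_sq, abs_of_nonneg (sq_nonneg _)]; exact hgrad y hy
    · have e : C₁ * (ω * A) * θ ^ 2 * (ρ ^ 2)⁻¹ * (ρ ^ d)⁻¹ * I * (B * ρ ^ d) =
          B * (C₁ * (ω * A)) * θ ^ 2 * (ρ ^ 2)⁻¹ * I := by field_simp
      rw [e]
      gcongr
      linarith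

/-- A polynomial that vanishes on an element has vanishing gradient there. -/
lemma gradient_eq_zero_of_vanish {d : ℕ} (s : Affine.Simplex ℝ (E d) d)
    (f : MvPolynomial (Fin d) ℝ) (h : ∀ y ∈ cellOf s, polyFun f y = 0) :
    ∀ y ∈ cellOf s, gradient (polyFun f) y = 0 := by
  have h1 : Set.EqOn (gradient (polyFun f)) (fun _ => 0) (interior (cellOf s)) := by
    intro y hy
    have : polyFun f =ᶠ[nhds y] fun _ => (0 : ℝ) := by
      filter_upwards [isOpen_interior.mem_nhds hy] with x hx
      exact h x (interior_subset hx)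
    change (InnerProductSpace.toDual ℝ (E d)).symm (fderiv ℝ (polyFun f) y) = 0
    rw [this.fderiv_eq]
    simp
  have h2 := h1.closure (continuous_gradient_polyFun f) continuous_const
  rw [closure_interior_cellOf] at h2
  exact fun y hy => h2 hy

/-- A polynomial with bounded gradient in the interior of an element is Lipschitz there. -/
lemma polyFun_sub_le_of_gradient {d : ℕ} (s : Affine.Simplex ℝ (E d) d)
    (f : MvPolynomial (Fin d) ℝ) {B : ℝ}
    (h : ∀ y ∈ interior (cellOf s), ‖gradient (polyFun f) y‖ ≤ B) {x y : E d}
    (hx : x ∈ cellOf s) (hy : y ∈ cellOf s) :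
    |polyFun f x - polyFun f y| ≤ B * Metric.diam (cellOf s) := by
  have hcl : ∀ y ∈ cellOf s, ‖fderiv ℝ (polyFun f) y‖ ≤ B := by
    have hc : IsClosed {y | ‖fderiv ℝ (polyFun f) y‖ ≤ B} :=
      isClosed_le (continuous_fderiv_polyFun f).norm continuous_const
    have hsub : interior (cellOf s) ⊆ {y | ‖fderiv ℝ (polyFun f) y‖ ≤ B} := fun y hy => by
      rw [Set.mem_ofPred_eq, ← norm_gradient]; exact h y hy
    have := hc.closure_subset_iff.2 hsub
    rw [closure_interior_cellOf] at this
    exact this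
  have h1 := (convex_cellOf s).norm_image_sub_le_of_norm_fderiv_le (𝕜 := ℝ)
    (fun y _ => (differentiable_polyFun f).differentiableAt) hcl hy hx
  have hB : 0 ≤ B := (norm_nonneg _).trans (hcl x hx)
  refine h1.trans (mul_le_mul_of_nonneg_left ?_ hB)
  rw [← dist_eq_norm]
  exact Metric.dist_le_diam_of_mem (isCompact_cellOf s).isBounded hx hy

/-- Bound for an integral over a set covered by finitely many pieces. -/
lemma norm_setIntegral_le_sum {α ι : Type*} [MeasurableSpace α] {μ : Measure α} (F : Finset ι)
    {s : Set α} {t : ι → Set α} (hs : s ⊆ ⋃ i ∈ F, t i) {f : α → ℝ} {b m : ι → ℝ}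
    (hb : ∀ i ∈ F, 0 ≤ b i) (hm : ∀ i ∈ F, 0 ≤ m i) (hsm : MeasurableSet s)
    (htm : ∀ i ∈ F, MeasurableSet (t i))
    (hf : ∀ i ∈ F, ∀ x ∈ s ∩ t i, |f x| ≤ b i) (hμ : ∀ i ∈ F, μ (t i) ≤ ENNReal.ofReal (m i)) :
    |∫ x in s, f x ∂μ| ≤ ∑ i ∈ F, b i * m i := by
  -- The lower Lebesgue integral is subadditive over pieces that may overlap and asks for no
  -- integrability of `f`.
  have h1 : ‖∫ x in s, f x ∂μ‖ₑ ≤ ∫⁻ x in s, ‖f x‖ₑ ∂μ := enorm_integral_le_lintegral_enorm _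
  have h2 : ∫⁻ x in s, ‖f x‖ₑ ∂μ ≤ ∑ i ∈ F, ∫⁻ x in s ∩ t i, ‖f x‖ₑ ∂μ := by
    have hs' : s = ⋃ i ∈ F, s ∩ t i := by
      rw [← Set.inter_iUnion₂, Set.inter_eq_left.2 hs]
    calc ∫⁻ x in s, ‖f x‖ₑ ∂μ = ∫⁻ x in ⋃ i ∈ F, s ∩ t i, ‖f x‖ₑ ∂μ := by rw [← hs']
      _ = ∫⁻ x in ⋃ i : F, s ∩ t i, ‖f x‖ₑ ∂μ := by rw [Set.iUnion_subtype]
      _ ≤ ∑' i : F, ∫⁻ x in s ∩ t i, ‖f x‖ₑ ∂μ := lintegral_iUnion_le _ _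
      _ = ∑ i ∈ F, ∫⁻ x in s ∩ t i, ‖f x‖ₑ ∂μ := by
        rw [tsum_fintype]
        exact Finset.sum_coe_sort F fun i => ∫⁻ x in s ∩ t i, ‖f x‖ₑ ∂μ
  have h3 : ∀ i ∈ F, ∫⁻ x in s ∩ t i, ‖f x‖ₑ ∂μ ≤ ENNReal.ofReal (b i * m i) := by
    intro i hi
    calc ∫⁻ x in s ∩ t i, ‖f x‖ₑ ∂μ ≤ ENNReal.ofReal (b i) * μ (s ∩ t i) := by
          rw [← setLIntegral_const]
          refine lintegral_mono_ae ?_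
          filter_upwards [ae_restrict_mem (hsm.inter (htm i hi))] with x hx
          rw [← ofReal_norm]
          exact ENNReal.ofReal_le_ofReal (hf i hi x hx)
      _ ≤ ENNReal.ofReal (b i) * ENNReal.ofReal (m i) :=
          mul_le_mul_right ((measure_mono Set.inter_subset_right).trans (hμ i hi)) _
      _ = _ := (ENNReal.ofReal_mul (hb i hi)).symm
  have h4 : ‖∫ x in s, f x ∂μ‖ₑ ≤ ENNReal.ofReal (∑ i ∈ F, b i * m i) := by
    rw [ENNReal.ofReal_sum_of_nonneg fun i hi => mul_nonneg (hb i hi) (hm i hi)]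
    exact h1.trans (h2.trans (Finset.sum_le_sum h3))
  rw [← ofReal_norm] at h4
  exact (ENNReal.ofReal_le_ofReal_iff (Finset.sum_nonneg fun i hi =>
    mul_nonneg (hb i hi) (hm i hi))).1 h4

/-! ### Elements and subdomains -/

namespace Mesh

variable {d : ℕ} (T : Mesh d)

lemma isClosed_biUnion_cell (F : Finset (Fin T.numElem)) : IsClosed (⋃ i ∈ F, T.cell i) :=
  F.finite_toSet.isClosed_biUnion fun i _ => isClosed_cellOf (T.elem i)

lemma interior_cell_subset {F : Finset (Fin T.numElem)} {i : Fin T.numElem} (hi : i ∈ F) :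
    interior (T.cell i) ⊆ interior (⋃ i ∈ F, T.cell i) :=
  interior_mono (Set.subset_biUnion_of_mem (u := fun i => T.cell i) hi)

lemma cell_subset_closure {F : Finset (Fin T.numElem)} {i : Fin T.numElem} (hi : i ∈ F) :
    T.cell i ⊆ closure (interior (⋃ i ∈ F, T.cell i)) := by
  have h := closure_mono (T.interior_cell_subset hi)
  rwa [cell, closure_interior_cellOf] at h

lemma closure_subset_biUnion_cell (F : Finset (Fin T.numElem)) :
    closure (interior (⋃ i ∈ F, T.cell i)) ⊆ ⋃ i ∈ F, T.cell i :=
  (T.isClosed_biUnion_cell F).closure_subset_iff.2 interior_subset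

lemma Ω_eq : T.Ω = interior (⋃ i ∈ (Finset.univ : Finset (Fin T.numElem)), T.cell i) := by
  simp [Ω]

lemma cell_subset_closure_Ω (i : Fin T.numElem) : T.cell i ⊆ closure T.Ω := by
  rw [Ω_eq]; exact T.cell_subset_closure (Finset.mem_univ i)

lemma closure_Ω_subset : closure T.Ω ⊆ ⋃ i, T.cell i := by
  rw [Ω_eq]
  exact (T.closure_subset_biUnion_cell _).trans (by simp)

/-- A point in the interior of an element lies in no other element. -/
lemma eq_of_mem_interior_of_mem {i j : Fin T.numElem} {y : E d} (hi : y ∈ interior (T.cell i))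
    (hj : y ∈ T.cell j) : i = j := by
  by_contra hij
  have hj' : y ∈ closure (interior (T.cell j)) := by
    rw [cell, closure_interior_cellOf]; exact hj
  obtain ⟨z, hz1, hz2⟩ := mem_closure_iff.1 hj' _ isOpen_interior hi
  exact Set.disjoint_left.1 (T.disjoint_interior_cell hij) hz1 hz2

/-- Integrals over a union of elements are sums of integrals over the elements. -/
lemma setIntegral_interior_biUnion (F : Finset (Fin T.numElem)) {f : E d → ℝ}
    {g : Fin T.numElem → E d → ℝ} (hfg : ∀ i, ∀ y ∈ interior (T.cell i), f y = g i y)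
    (hg : ∀ i, IntegrableOn (g i) (T.cell i)) :
    ∫ y in interior (⋃ i ∈ F, T.cell i), f y = ∑ i ∈ F, ∫ y in T.cell i, g i y := by
  have hnull : ∀ i, (volume : Measure (E d)) (frontier (T.cell i)) = 0 := fun i =>
    (convex_cellOf (T.elem i)).addHaar_frontier _
  -- The interior of the union exceeds the disjoint union of the element interiors only by element
  -- boundaries, which are null sets because elements are convex.
  have h1 : (interior (⋃ i ∈ F, T.cell i) : Set (E d)) =ᵐ[volume]
      (⋃ i ∈ F, interior (T.cell i) : Set (E d)) := by
    refine (Filter.EventuallyLE.antisymm ?_ ?_)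
    · rw [ae_le_set]
      have hsub : interior (⋃ i ∈ F, T.cell i) \ (⋃ i ∈ F, interior (T.cell i)) ⊆
          ⋃ i, frontier (T.cell i) := by
        rintro y ⟨hy1, hy2⟩
        obtain ⟨i, hi, hyi⟩ := Set.mem_iUnion₂.1 (interior_subset hy1)
        refine Set.mem_iUnion.2 ⟨i, ?_⟩
        have hcl : IsClosed (T.cell i) := isClosed_cellOf _
        rw [hcl.frontier_eq]
        exact ⟨hyi, fun h => hy2 (Set.mem_iUnion₂.2 ⟨i, hi, h⟩)⟩
      exact measure_mono_null hsub (measure_iUnion_null hnull)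
    · have hsub : (⋃ i ∈ F, interior (T.cell i)) ⊆ interior (⋃ i ∈ F, T.cell i) :=
        Set.iUnion₂_subset fun i hi => T.interior_cell_subset hi
      exact hsub.eventuallyLE
  rw [setIntegral_congr_set h1, integral_biUnion_finset F
    (fun i _ => isOpen_interior.measurableSet)
    (fun i _ j _ hij => T.disjoint_interior_cell hij)
    (fun i _ => ((hg i).mono_set interior_subset).congr_fun
      (fun y hy => (hfg i y hy).symm) isOpen_interior.measurableSet)]
  refine Finset.sum_congr rfl fun i _ => ?_
  rw [setIntegral_congr_fun isOpen_interior.measurableSet fun y hy => hfg i y hy]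
  exact setIntegral_congr_set (interior_ae_eq_of_null_frontier (hnull i))

lemma isClosed_ΓD : IsClosed T.ΓD :=
  T.dirichletFacets.finite_toSet.isClosed_biUnion fun _ _ => (isCompact_facetOf _ _).isClosed

end Mesh

namespace Setup

variable {d r : ℕ} {X : Finset (Fin d → ℝ)} (P : Setup d r X)

lemma cell_subset_closure_Ωl {l : Fin P.N} {i : Fin P.mesh.numElem} (hi : i ∈ P.sub l) :
    P.mesh.cell i ⊆ closure (P.Ωl l) :=
  P.mesh.cell_subset_closure hi

lemma closure_Ωl_subset (l : Fin P.N) : closure (P.Ωl l) ⊆ ⋃ i ∈ P.sub l, P.mesh.cell i :=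
  P.mesh.closure_subset_biUnion_cell _

lemma Ωl_subset (l : Fin P.N) : P.Ωl l ⊆ P.mesh.Ω :=
  interior_mono (Set.iUnion₂_subset fun i _ => Set.subset_iUnion (fun i => P.mesh.cell i) i)

/-- The polynomial that agrees with `χ l` on an element. -/
def χPoly (l : Fin P.N) (i : Fin P.mesh.numElem) : MvPolynomial (Fin d) ℝ :=
  ((P.χ_poly l).2 i).choose

lemma χ_eq (l : Fin P.N) (i : Fin P.mesh.numElem) {y : E d} (hy : y ∈ P.mesh.cell i) :
    P.χ l y = polyFun (P.χPoly l i) y :=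
  ((P.χ_poly l).2 i).choose_spec.2 y hy

/-- A partition of unity function vanishes on the elements outside of its subdomain. -/
lemma χ_eq_zero {l : Fin P.N} {i : Fin P.mesh.numElem} (hi : i ∉ P.sub l) {y : E d}
    (hy : y ∈ P.mesh.cell i) : P.χ l y = 0 := by
  -- An interior point of the element lies in no other element, so not in the closure of `Ω_l`; the
  -- boundary of the element is then reached by continuity.
  have h1 : Set.EqOn (polyFun (P.χPoly l i)) (fun _ => 0) (interior (P.mesh.cell i)) := by
    intro x hx
    have hx' := interior_subset hx
    rw [← P.χ_eq l i hx']
    by_contra hne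
    have := P.closure_Ωl_subset l (P.χ_support l x (P.mesh.cell_subset_closure_Ω i hx') hne)
    obtain ⟨j, hj, hxj⟩ := Set.mem_iUnion₂.1 this
    exact hi (P.mesh.eq_of_mem_interior_of_mem hx hxj ▸ hj)
  have h2 := h1.closure (continuous_polyFun _) continuous_const
  rw [Mesh.cell, closure_interior_cellOf] at h2
  rw [P.χ_eq l i hy]
  exact h2 hy

lemma χ_sub_le {l : Fin P.N} {i : Fin P.mesh.numElem} {B : ℝ}
    (h : ∀ x ∈ interior (P.mesh.cell i), ‖gradient (P.χ l) x‖ ≤ B) {x y : E d}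
    (hx : x ∈ P.mesh.cell i) (hy : y ∈ P.mesh.cell i) :
    |P.χ l x - P.χ l y| ≤ B * Metric.diam (P.mesh.cell i) := by
  rw [P.χ_eq l i hx, P.χ_eq l i hy]
  refine polyFun_sub_le_of_gradient (P.mesh.elem i) _ (fun z hz => ?_) hx hy
  have e : P.χ l =ᶠ[nhds z] polyFun (P.χPoly l i) := by
    filter_upwards [isOpen_interior.mem_nhds hz] with w hw
    exact P.χ_eq l i (interior_subset hw)
  have := h z hz
  rwa [norm_gradient, e.fderiv_eq, ← norm_gradient] at this

/-! ### The finite element functions -/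

/-- The finite element function with given real coefficients. -/
def feFun (x : P.Idx → ℝ) (y : E d) : ℝ := ∑ p, x p * P.φ p y

/-- The polynomial that agrees with a basis function on an element. -/
def φPoly (i : Fin P.mesh.numElem) (p : P.Idx) : MvPolynomial (Fin d) ℝ :=
  ((P.φ_poly p).2 i).choose

lemma totalDegree_φPoly (i : Fin P.mesh.numElem) (p : P.Idx) :
    (P.φPoly i p).totalDegree ≤ r - 1 :=
  ((P.φ_poly p).2 i).choose_spec.1

lemma φ_eq (i : Fin P.mesh.numElem) (p : P.Idx) {y : E d} (hy : y ∈ P.mesh.cell i) :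
    P.φ p y = polyFun (P.φPoly i p) y :=
  ((P.φ_poly p).2 i).choose_spec.2 y hy

/-- The polynomial that agrees with a finite element function on an element. -/
def fePoly (i : Fin P.mesh.numElem) (x : P.Idx → ℝ) : MvPolynomial (Fin d) ℝ :=
  ∑ p, x p • P.φPoly i p

lemma totalDegree_fePoly (i : Fin P.mesh.numElem) (x : P.Idx → ℝ) :
    (P.fePoly i x).totalDegree ≤ r - 1 :=
  MvPolynomial.totalDegree_finsetSum_le fun p _ =>
    (MvPolynomial.totalDegree_smul_le _ _).trans (P.totalDegree_φPoly i p)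

lemma polyFun_fePoly (i : Fin P.mesh.numElem) (x : P.Idx → ℝ) (y : E d) :
    polyFun (P.fePoly i x) y = ∑ p, x p * polyFun (P.φPoly i p) y := by
  simp [fePoly, polyFun_sum, polyFun_smul]

lemma feFun_eq (i : Fin P.mesh.numElem) (x : P.Idx → ℝ) {y : E d} (hy : y ∈ P.mesh.cell i) :
    P.feFun x y = polyFun (P.fePoly i x) y := by
  rw [polyFun_fePoly, feFun]
  exact Finset.sum_congr rfl fun p _ => by rw [P.φ_eq i p hy]

lemma gradient_fePoly (i : Fin P.mesh.numElem) (x : P.Idx → ℝ) (y : E d) :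
    gradient (polyFun (P.fePoly i x)) y = ∑ p, x p • gradient (polyFun (P.φPoly i p)) y := by
  have e : polyFun (P.fePoly i x) = fun y => ∑ p, x p * polyFun (P.φPoly i p) y :=
    funext (P.polyFun_fePoly i x)
  have hd : fderiv ℝ (polyFun (P.fePoly i x)) y =
      ∑ p, x p • fderiv ℝ (polyFun (P.φPoly i p)) y := by
    rw [e, fderiv_fun_sum fun p _ => ((differentiable_polyFun _).differentiableAt.const_mul _)]
    exact Finset.sum_congr rfl fun p _ =>
      fderiv_const_mul (differentiable_polyFun _).differentiableAt _
  simp only [gradient, hd, map_sum, map_smul]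

lemma feFun_node (x : P.Idx → ℝ) (p : P.Idx) : P.feFun x p = x p := by
  simp only [feFun, P.φ_nodal]
  simp

lemma feFun_dirichlet (x : P.Idx → ℝ) {y : E d} (hy : y ∈ P.mesh.ΓD) : P.feFun x y = 0 := by
  simp [feFun, P.φ_dirichlet _ y hy]

lemma refPoint_mem_nodes (i : Fin P.mesh.numElem) {ξ : Fin d → ℝ} (hξ : ξ ∈ X)
    (h : refPoint (P.mesh.elem i) ξ ∉ P.mesh.ΓD) :
    refPoint (P.mesh.elem i) ξ ∈ P.mesh.nodes X := by
  classical
  simp only [Mesh.nodes, Finset.mem_filter, Finset.mem_image, Finset.mem_product]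
  exact ⟨⟨(i, ξ), ⟨Finset.mem_univ _, hξ⟩, rfl⟩, h⟩

/-- At the nodes of an element, weighting of the coefficients is multiplication. -/
lemma feFun_weight_refPoint (i : Fin P.mesh.numElem) {ξ : Fin d → ℝ} (hξ : ξ ∈ X) (w : E d → ℝ)
    (x : P.Idx → ℝ) :
    P.feFun (fun p => w p * x p) (refPoint (P.mesh.elem i) ξ) =
      w (refPoint (P.mesh.elem i) ξ) * P.feFun x (refPoint (P.mesh.elem i) ξ) := by
  -- A reference node on the Dirichlet boundary carries no index, but all finite element functions
  -- vanish there.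
  by_cases h : refPoint (P.mesh.elem i) ξ ∈ P.mesh.ΓD
  · rw [P.feFun_dirichlet _ h, P.feFun_dirichlet _ h, mul_zero]
  · have h1 := P.feFun_node (fun p => w p * x p) ⟨_, P.refPoint_mem_nodes i hξ h⟩
    have h2 := P.feFun_node x ⟨_, P.refPoint_mem_nodes i hξ h⟩
    dsimp only at h1 h2
    rw [h1, h2]

lemma exists_cell_of_node (hX : IsReferenceNodeSet (r - 1) X) (p : P.Idx) :
    ∃ i, (p : E d) ∈ P.mesh.cell i := by
  classical
  have hp := p.2
  simp only [Mesh.nodes, Finset.mem_filter, Finset.mem_image, Finset.mem_product] at hp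
  obtain ⟨⟨⟨i, ξ⟩, ⟨-, hξ⟩, h⟩, -⟩ := hp
  refine ⟨i, ?_⟩
  rw [← h]
  exact refPoint_mem_cellOf _ ξ (hX.1 ξ hξ).1 (hX.1 ξ hξ).2

/-! ### Element matrices -/

/-- The stiffness matrix of an element. -/
def elemStiffness (i : Fin P.mesh.numElem) : Matrix P.Idx P.Idx ℝ := fun p q =>
  ∫ y in P.mesh.cell i,
    inner ℝ (gradient (polyFun (P.φPoly i p)) y) (gradient (polyFun (P.φPoly i q)) y)

/-- The mass matrix of an element. -/
def elemMass (i : Fin P.mesh.numElem) : Matrix P.Idx P.Idx ℝ := fun p q =>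
  ∫ y in P.mesh.cell i, polyFun (P.φPoly i p) y * polyFun (P.φPoly i q) y

/-- The surface on which the impedance condition of a local problem is posed. -/
def locBdry (l : Fin P.N) : Set (E d) := frontier (P.Ωl l) \ P.mesh.ΓD

/-- The boundary mass matrix of a local problem, with a weight. -/
def bdryMass (l : Fin P.N) (w : E d → ℝ) : Matrix P.Idx P.Idx ℝ := fun p q =>
  ∫ y in P.locBdry l, w y * (P.φ p y * P.φ q y) ∂(μHE[d - 1])

lemma isCompact_cell (i : Fin P.mesh.numElem) : IsCompact (P.mesh.cell i) := isCompact_cellOf _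

/-- The common passage from a Gram matrix to the integral of the functions themselves, for the
stiffness, mass and weighted boundary matrices alike. -/
lemma rform_integral {n α : Type*} [Fintype n] [MeasurableSpace α] {μ : Measure α}
    {M : Matrix n n ℝ} {b : n → n → α → ℝ} (hM : ∀ p q, M p q = ∫ y, b p q y ∂μ)
    (hb : ∀ p q, Integrable (b p q) μ) (x x' : n → ℝ) {F : α → ℝ}
    (hF : ∀ y, F y = ∑ p, ∑ q, x' p * x q * b p q y) :
    rform M x x' = ∫ y, F y ∂μ := by
  rw [funext hF, rform_eq_sum, integral_finsetSum]
  · refine Finset.sum_congr rfl fun p _ => ?_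
    rw [integral_finsetSum _ fun q _ => (hb p q).const_mul _]
    refine Finset.sum_congr rfl fun q _ => ?_
    rw [integral_const_mul, hM]
    ring
  · exact fun p _ => integrable_finsetSum _ fun q _ => (hb p q).const_mul _

lemma rform_elemStiffness (i : Fin P.mesh.numElem) (x x' : P.Idx → ℝ) :
    rform (P.elemStiffness i) x x' = ∫ y in P.mesh.cell i,
      inner ℝ (gradient (polyFun (P.fePoly i x')) y) (gradient (polyFun (P.fePoly i x)) y) := by
  refine rform_integral (fun _ _ => rfl) (fun p q => integrableOn_gradient_inner _ _ (P.isCompact_cell i)) x x'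
    fun y => ?_
  rw [gradient_fePoly, gradient_fePoly, sum_inner]
  refine Finset.sum_congr rfl fun p _ => ?_
  rw [inner_sum]
  refine Finset.sum_congr rfl fun q _ => ?_
  rw [real_inner_smul_left, real_inner_smul_right]
  ring

lemma rform_elemMass (i : Fin P.mesh.numElem) (x x' : P.Idx → ℝ) :
    rform (P.elemMass i) x x' = ∫ y in P.mesh.cell i,
      polyFun (P.fePoly i x') y * polyFun (P.fePoly i x) y := by
  refine rform_integral (fun _ _ => rfl) (fun p q => integrableOn_polyFun_mul _ _ (P.isCompact_cell i)) x x'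
    fun y => ?_
  rw [polyFun_fePoly, polyFun_fePoly, Finset.sum_mul_sum]
  exact Finset.sum_congr rfl fun p _ => Finset.sum_congr rfl fun q _ => by ring

lemma posSemidef_of_symm {n : Type*} [Fintype n] {M : Matrix n n ℝ} (h : ∀ p q, M p q = M q p)
    (h0 : ∀ x, 0 ≤ rform M x x) : M.PosSemidef := by
  refine Matrix.PosSemidef.of_dotProduct_mulVec_nonneg ?_ fun x => by simpa [rform] using h0 x
  ext p q
  simp [Matrix.conjTranspose_apply, h p q]

lemma posSemidef_elemStiffness (i : Fin P.mesh.numElem) : (P.elemStiffness i).PosSemidef := by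
  refine posSemidef_of_symm (fun p q => ?_) fun x => ?_
  · simp only [elemStiffness, real_inner_comm]
  · rw [rform_elemStiffness]
    exact integral_nonneg fun y => real_inner_self_nonneg

lemma posSemidef_elemMass (i : Fin P.mesh.numElem) : (P.elemMass i).PosSemidef := by
  refine posSemidef_of_symm (fun p q => ?_) fun x => ?_
  · simp only [elemMass, mul_comm]
  · rw [rform_elemMass]
    exact integral_nonneg fun y => mul_self_nonneg _

lemma gradient_φ_eq (i : Fin P.mesh.numElem) (p : P.Idx) {y : E d}
    (hy : y ∈ interior (P.mesh.cell i)) :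
    gradient (P.φ p) y = gradient (polyFun (P.φPoly i p)) y := by
  have e : P.φ p =ᶠ[nhds y] polyFun (P.φPoly i p) := by
    filter_upwards [isOpen_interior.mem_nhds hy] with w hw
    exact P.φ_eq i p (interior_subset hw)
  simp only [gradient, e.fderiv_eq]

lemma integral_gradient_eq_sum (F : Finset (Fin P.mesh.numElem)) (p q : P.Idx) :
    ∫ y in interior (⋃ i ∈ F, P.mesh.cell i), inner ℝ (gradient (P.φ p) y) (gradient (P.φ q) y) =
      ∑ i ∈ F, P.elemStiffness i p q :=
  P.mesh.setIntegral_interior_biUnion F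
    (fun i y hy => by rw [P.gradient_φ_eq i p hy, P.gradient_φ_eq i q hy])
    fun i => integrableOn_gradient_inner _ _ (P.isCompact_cell i)

lemma integral_mul_eq_sum (F : Finset (Fin P.mesh.numElem)) (p q : P.Idx) :
    ∫ y in interior (⋃ i ∈ F, P.mesh.cell i), P.φ p y * P.φ q y =
      ∑ i ∈ F, P.elemMass i p q :=
  P.mesh.setIntegral_interior_biUnion F
    (fun i y hy => by rw [P.φ_eq i p (interior_subset hy), P.φ_eq i q (interior_subset hy)])
    fun i => integrableOn_polyFun_mul _ _ (P.isCompact_cell i)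

lemma Dk_eq (k : ℝ) :
    P.Dk k = (∑ i, (P.elemStiffness i + k ^ 2 • P.elemMass i)).map fun t => (t : ℂ) := by
  unfold Dk
  congr 1
  ext p q
  have h1 := P.integral_gradient_eq_sum Finset.univ p q
  have h2 := P.integral_mul_eq_sum Finset.univ p q
  rw [← Mesh.Ω_eq] at h1 h2
  simp only [Matrix.add_apply, Matrix.smul_apply, stiffness, mass, h1, h2, Matrix.sum_apply,
    Finset.sum_add_distrib, Finset.smul_sum]

/-! ### Boundary matrices -/

lemma measurableSet_locBdry (l : Fin P.N) : MeasurableSet (P.locBdry l) :=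
  isClosed_frontier.measurableSet.diff P.mesh.isClosed_ΓD.measurableSet

/-- The boundary of a subdomain is covered by the boundaries of its elements. -/
lemma frontier_Ωl_subset (l : Fin P.N) :
    frontier (P.Ωl l) ⊆ ⋃ i ∈ P.sub l, frontier (P.mesh.cell i) := by
  intro y hy
  obtain ⟨i, hi, hyi⟩ := Set.mem_iUnion₂.1 (P.closure_Ωl_subset l hy.1)
  refine Set.mem_iUnion₂.2 ⟨i, hi, ?_⟩
  rw [(P.isCompact_cell i).isClosed.frontier_eq]
  refine ⟨hyi, fun h => hy.2 ?_⟩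
  have ho : IsOpen (P.Ωl l) := isOpen_interior
  rw [ho.interior_eq]
  exact P.mesh.interior_cell_subset hi h

lemma locBdry_subset (l : Fin P.N) :
    P.locBdry l ⊆ ⋃ i ∈ P.sub l, frontier (P.mesh.cell i) :=
  Set.sdiff_subset.trans (P.frontier_Ωl_subset l)

lemma hausdorff_frontier_cell_lt_top (hd : 1 ≤ d) (i : Fin P.mesh.numElem) :
    (μHE[d - 1] : Measure (E d)) (frontier (P.mesh.cell i)) < ⊤ := by
  obtain ⟨C, -, h⟩ := exists_hausdorff_frontier_cellOf_le d hd
  exact (h (P.mesh.elem i)).trans_lt ENNReal.ofReal_lt_top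

/-- Functions that are polynomial on each element are integrable on the boundary of a subdomain. -/
lemma integrableOn_locBdry (hd : 1 ≤ d) (l : Fin P.N) {f : E d → ℝ}
    {g : Fin P.mesh.numElem → E d → ℝ} (hg : ∀ i, Continuous (g i))
    (hfg : ∀ i, ∀ y ∈ P.mesh.cell i, f y = g i y) :
    IntegrableOn f (P.locBdry l) (μHE[d - 1]) := by
  refine IntegrableOn.mono_set ?_ (P.locBdry_subset l)
  rw [integrableOn_finset_iUnion]
  intro i _
  have hcl : frontier (P.mesh.cell i) ⊆ P.mesh.cell i := by
    rw [(P.isCompact_cell i).isClosed.frontier_eq]; exact Set.sdiff_subset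
  have hcomp : IsCompact (frontier (P.mesh.cell i)) :=
    (P.isCompact_cell i).of_isClosed_subset isClosed_frontier hcl
  obtain ⟨B, hB⟩ := hcomp.exists_bound_of_continuousOn (hg i).continuousOn
  refine IntegrableOn.congr_fun ?_ (fun y hy => (hfg i y (hcl hy)).symm)
    isClosed_frontier.measurableSet
  exact Measure.integrableOn_of_bounded (P.hausdorff_frontier_cell_lt_top hd i).ne
    (hg i).aestronglyMeasurable
    ((ae_restrict_iff' isClosed_frontier.measurableSet).2 (Filter.Eventually.of_forall hB))

lemma integrableOn_one_mul_φ (hd : 1 ≤ d) (l : Fin P.N) (p q : P.Idx) :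
    IntegrableOn (fun y => (1 : ℝ) * (P.φ p y * P.φ q y)) (P.locBdry l) (μHE[d - 1]) :=
  P.integrableOn_locBdry hd l
    (g := fun i y => 1 * (polyFun (P.φPoly i p) y * polyFun (P.φPoly i q) y))
    (fun i => continuous_const.mul ((continuous_polyFun _).mul (continuous_polyFun _)))
    fun i y hy => by rw [P.φ_eq i p hy, P.φ_eq i q hy]

lemma integrableOn_χ_mul_φ (hd : 1 ≤ d) (l : Fin P.N) (p q : P.Idx) :
    IntegrableOn (fun y => P.χ l y * (P.φ p y * P.φ q y)) (P.locBdry l) (μHE[d - 1]) :=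
  P.integrableOn_locBdry hd l
    (g := fun i y => polyFun (P.χPoly l i) y *
      (polyFun (P.φPoly i p) y * polyFun (P.φPoly i q) y))
    (fun i => (continuous_polyFun _).mul ((continuous_polyFun _).mul (continuous_polyFun _)))
    fun i y hy => by rw [P.φ_eq i p hy, P.φ_eq i q hy, P.χ_eq l i hy]

lemma mul_feFun_mul_feFun (w : E d → ℝ) (x x' : P.Idx → ℝ) (y : E d) :
    w y * (P.feFun x' y * P.feFun x y) =
      ∑ p, ∑ q, x' p * x q * (w y * (P.φ p y * P.φ q y)) := by
  rw [feFun, feFun, Finset.sum_mul_sum, Finset.mul_sum]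
  refine Finset.sum_congr rfl fun p _ => ?_
  rw [Finset.mul_sum]
  exact Finset.sum_congr rfl fun q _ => by ring

lemma integrableOn_feFun (l : Fin P.N) (w : E d → ℝ)
    (hw : ∀ p q, IntegrableOn (fun y => w y * (P.φ p y * P.φ q y)) (P.locBdry l) (μHE[d - 1]))
    (x x' : P.Idx → ℝ) :
    IntegrableOn (fun y => w y * (P.feFun x' y * P.feFun x y)) (P.locBdry l) (μHE[d - 1]) := by
  rw [funext (P.mul_feFun_mul_feFun w x x')]
  exact integrable_finsetSum _ fun p _ => integrable_finsetSum _ fun q _ => (hw p q).const_mul _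

lemma rform_bdryMass (l : Fin P.N) (w : E d → ℝ)
    (hw : ∀ p q, IntegrableOn (fun y => w y * (P.φ p y * P.φ q y)) (P.locBdry l) (μHE[d - 1]))
    (x x' : P.Idx → ℝ) :
    rform (P.bdryMass l w) x x' =
      ∫ y in P.locBdry l, w y * (P.feFun x' y * P.feFun x y) ∂(μHE[d - 1]) :=
  rform_integral (fun _ _ => rfl) hw x x' (P.mul_feFun_mul_feFun w x x')

lemma posSemidef_bdryMass (l : Fin P.N) (w : E d → ℝ)
    (hw : ∀ p q, IntegrableOn (fun y => w y * (P.φ p y * P.φ q y)) (P.locBdry l) (μHE[d - 1]))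
    (hw0 : ∀ y ∈ P.locBdry l, 0 ≤ w y) : (P.bdryMass l w).PosSemidef := by
  refine posSemidef_of_symm (fun p q => ?_) fun x => ?_
  · simp only [bdryMass, mul_comm (P.φ p _)]
  · rw [P.rform_bdryMass l w hw]
    exact setIntegral_nonneg (P.measurableSet_locBdry l) fun y hy =>
      mul_nonneg (hw0 y hy) (mul_self_nonneg _)

lemma locBdry_subset_closure (l : Fin P.N) : P.locBdry l ⊆ closure P.mesh.Ω := fun _ hy =>
  closure_mono (P.Ωl_subset l) hy.1.1

/-! ### Localisation of the system matrix -/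

/-- A basis function whose node sees `χ l` vanishes on the elements outside of the subdomain. -/
lemma φ_vanish (hX : IsReferenceNodeSet (r - 1) X) {l : Fin P.N} {p : P.Idx}
    (hp : P.χ l (p : E d) ≠ 0) {i : Fin P.mesh.numElem} (hi : i ∉ P.sub l) {y : E d}
    (hy : y ∈ P.mesh.cell i) : polyFun (P.φPoly i p) y = 0 := by
  -- All nodal values on the element vanish: `φ p` is zero at every other node and at Dirichlet
  -- nodes, and `p` itself is not in the element because `χ l` vanishes there. Unisolvence, in the
  -- form of the nodal bound with `A = 0`, does the rest.
  obtain ⟨C, -, hC⟩ := exists_nodal_bound hX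
  have h := lagrange_bound_of_cell hC (P.mesh.elem i) (P.totalDegree_φPoly i p) le_rfl
    (fun ξ hξ => ?_) hy
  · simpa using h
  · have hmem : refPoint (P.mesh.elem i) ξ ∈ P.mesh.cell i :=
      refPoint_mem_cellOf _ ξ (hX.1 ξ hξ).1 (hX.1 ξ hξ).2
    rw [← P.φ_eq i p hmem]
    by_cases hD : refPoint (P.mesh.elem i) ξ ∈ P.mesh.ΓD
    · simp [P.φ_dirichlet p _ hD]
    · have h1 := P.φ_nodal p ⟨_, P.refPoint_mem_nodes i hξ hD⟩
      dsimp only at h1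
      rw [h1, if_neg]
      · simp
      · rintro rfl
        exact hp (P.χ_eq_zero hi hmem)

lemma elemStiffness_vanish (hX : IsReferenceNodeSet (r - 1) X) {l : Fin P.N} {p : P.Idx}
    (hp : P.χ l (p : E d) ≠ 0) {i : Fin P.mesh.numElem} (hi : i ∉ P.sub l) (q : P.Idx) :
    P.elemStiffness i q p = 0 := by
  refine setIntegral_eq_zero_of_forall_eq_zero fun y hy => ?_
  rw [gradient_eq_zero_of_vanish (P.mesh.elem i) _ (fun y hy => P.φ_vanish hX hp hi hy) y hy,
    inner_zero_right]

lemma elemMass_vanish (hX : IsReferenceNodeSet (r - 1) X) {l : Fin P.N} {p : P.Idx}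
    (hp : P.χ l (p : E d) ≠ 0) {i : Fin P.mesh.numElem} (hi : i ∉ P.sub l) (q : P.Idx) :
    P.elemMass i q p = 0 := by
  refine setIntegral_eq_zero_of_forall_eq_zero fun y hy => ?_
  rw [P.φ_vanish hX hp hi hy, mul_zero]

/-- A point of `Ω` outside of a subdomain lies in an element outside of the subdomain. -/
lemma exists_cell_of_not_mem_Ωl {l : Fin P.N} {y : E d} (hy : y ∈ P.mesh.Ω) (hyl : y ∉ P.Ωl l) :
    ∃ i, i ∉ P.sub l ∧ y ∈ P.mesh.cell i := by
  by_contra! hne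
  apply hyl
  have hcl : IsClosed (⋃ i ∈ (P.sub l)ᶜ, P.mesh.cell i) := P.mesh.isClosed_biUnion_cell _
  -- Removing from `Ω` the closed union of the elements outside the subdomain leaves an open set
  -- covered by the elements of the subdomain.
  refine mem_interior.2 ⟨P.mesh.Ω ∩ (⋃ i ∈ (P.sub l)ᶜ, P.mesh.cell i)ᶜ, ?_,
    isOpen_interior.inter hcl.isOpen_compl, hy, ?_⟩
  · rintro z ⟨hz, hz'⟩
    obtain ⟨i, hi⟩ := Set.mem_iUnion.1 (interior_subset hz)
    by_cases his : i ∈ P.sub l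
    · exact Set.mem_iUnion₂.2 ⟨i, his, hi⟩
    · exact absurd (Set.mem_iUnion₂.2 ⟨i, Finset.mem_compl.2 his, hi⟩) hz'
  · intro h
    obtain ⟨i, hi, hyi⟩ := Set.mem_iUnion₂.1 h
    exact hne i (Finset.mem_compl.1 hi) hyi

/-- Both integrals reduce to the common part of the two surfaces. A point of either surface that is
not on the other lies in an element outside the subdomain, where `φ p` vanishes: on `ΓI` because it
is off the boundary of `Ω_l` and not in `Ω`, on the boundary of `Ω_l` because it is then in `Ω` but
not in `Ω_l`. -/
lemma setIntegral_ΓI_eq (hX : IsReferenceNodeSet (r - 1) X) {l : Fin P.N} {p : P.Idx}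
    (hp : P.χ l (p : E d) ≠ 0) (q : P.Idx) :
    ∫ y in P.mesh.ΓI, P.φ q y * P.φ p y ∂(μHE[d - 1]) =
      ∫ y in P.locBdry l, P.φ q y * P.φ p y ∂(μHE[d - 1]) := by
  have hvan : ∀ i, i ∉ P.sub l → ∀ y ∈ P.mesh.cell i, P.φ q y * P.φ p y = 0 := fun i hi y hy => by
    rw [P.φ_eq i p hy, P.φ_vanish hX hp hi hy, mul_zero]
  have hΓm : MeasurableSet P.mesh.ΓI :=
    isClosed_frontier.measurableSet.diff P.mesh.isClosed_ΓD.measurableSet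
  have hΩo : IsOpen P.mesh.Ω := isOpen_interior
  have hlo : IsOpen (P.Ωl l) := isOpen_interior
  have h1 : ∫ y in P.mesh.ΓI ∩ P.locBdry l, P.φ q y * P.φ p y ∂(μHE[d - 1]) =
      ∫ y in P.mesh.ΓI, P.φ q y * P.φ p y ∂(μHE[d - 1]) := by
    refine (setIntegral_eq_of_subset_of_forall_sdiff_eq_zero hΓm Set.inter_subset_left ?_).symm
    rintro y ⟨hy1, hy2⟩
    have hyf : y ∉ frontier (P.Ωl l) := fun h => hy2 ⟨hy1, h, hy1.2⟩
    obtain ⟨i, hi⟩ := Set.mem_iUnion.1 (P.mesh.closure_Ω_subset hy1.1.1)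
    refine hvan i (fun his => ?_) y hi
    have hcl := P.cell_subset_closure_Ωl his hi
    have hyl : y ∈ P.Ωl l := by
      by_contra h
      exact hyf ⟨hcl, by rwa [hlo.interior_eq]⟩
    exact hy1.1.2 (by rw [hΩo.interior_eq]; exact P.Ωl_subset l hyl)
  have h2 : ∫ y in P.mesh.ΓI ∩ P.locBdry l, P.φ q y * P.φ p y ∂(μHE[d - 1]) =
      ∫ y in P.locBdry l, P.φ q y * P.φ p y ∂(μHE[d - 1]) := by
    refine (setIntegral_eq_of_subset_of_forall_sdiff_eq_zero (P.measurableSet_locBdry l)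
      Set.inter_subset_right ?_).symm
    rintro y ⟨hy1, hy2⟩
    have hyΩ : y ∈ P.mesh.Ω := by
      by_contra h
      exact hy2 ⟨⟨⟨P.locBdry_subset_closure l hy1, by rwa [hΩo.interior_eq]⟩, hy1.2⟩, hy1⟩
    have hyl : y ∉ P.Ωl l := by
      have := hy1.1.2
      rwa [hlo.interior_eq] at this
    obtain ⟨i, hi, hyi⟩ := P.exists_cell_of_not_mem_Ωl hyΩ hyl
    exact hvan i hi y hyi
  rw [← h1, h2]

/-- The matrix of a local problem, on all indices. -/
def locMatrix (k ε : ℝ) (η : ℂ) (l : Fin P.N) : Matrix P.Idx P.Idx ℂ := fun p q =>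
  helmholtzForm (P.Ωl l) (P.locBdry l) k ε η (P.φ q) (P.φ p)

lemma locMatrix_eq (k ε : ℝ) (η : ℂ) (l : Fin P.N) (p q : P.Idx) :
    P.locMatrix k ε η l p q =
      ∑ i ∈ P.sub l, ((P.elemStiffness i p q : ℂ) -
        ((k : ℂ) ^ 2 + Complex.I * ε) * (P.elemMass i p q : ℂ)) -
      Complex.I * η * (P.bdryMass l (fun _ => 1) p q : ℂ) := by
  have h1 : ∫ x in P.Ωl l, inner ℝ (gradient (P.φ q) x) (gradient (P.φ p) x) =
      ∑ i ∈ P.sub l, P.elemStiffness i p q := by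
    simp only [real_inner_comm (gradient (P.φ p) _)]
    exact P.integral_gradient_eq_sum (P.sub l) p q
  have h2 : ∫ x in P.Ωl l, P.φ q x * P.φ p x = ∑ i ∈ P.sub l, P.elemMass i p q := by
    simp only [mul_comm (P.φ q _)]
    exact P.integral_mul_eq_sum (P.sub l) p q
  have h3 : ∫ x in P.locBdry l, P.φ q x * P.φ p x ∂(μHE[d - 1]) =
      P.bdryMass l (fun _ => 1) p q := by
    simp only [bdryMass, one_mul, mul_comm (P.φ q _)]
  rw [locMatrix, helmholtzForm, h1, h2, h3, Finset.sum_sub_distrib, ← Finset.mul_sum]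
  push_cast
  rfl

/-- Weighted by `χ l`, the rows of the system matrix are those of the local matrix. -/
lemma χ_mul_A (hX : IsReferenceNodeSet (r - 1) X) (k ε : ℝ) (η : ℂ) (l : Fin P.N) (p q : P.Idx) :
    (P.χ l (p : E d) : ℂ) * P.A k ε η p q = (P.χ l (p : E d) : ℂ) * P.locMatrix k ε η l p q := by
  by_cases hp : P.χ l (p : E d) = 0
  · simp [hp]
  congr 1
  have h1 : ∫ x in P.mesh.Ω, inner ℝ (gradient (P.φ q) x) (gradient (P.φ p) x) =
      ∫ x in P.Ωl l, inner ℝ (gradient (P.φ q) x) (gradient (P.φ p) x) := by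
    rw [Mesh.Ω_eq, P.integral_gradient_eq_sum]
    refine Eq.trans ?_ (P.integral_gradient_eq_sum (P.sub l) q p).symm
    exact (Finset.sum_subset (Finset.subset_univ _) fun i _ hi =>
      P.elemStiffness_vanish hX hp hi q).symm
  have h2 : ∫ x in P.mesh.Ω, P.φ q x * P.φ p x = ∫ x in P.Ωl l, P.φ q x * P.φ p x := by
    rw [Mesh.Ω_eq, P.integral_mul_eq_sum]
    refine Eq.trans ?_ (P.integral_mul_eq_sum (P.sub l) q p).symm
    exact (Finset.sum_subset (Finset.subset_univ _) fun i _ hi =>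
      P.elemMass_vanish hX hp hi q).symm
  rw [A, locMatrix, helmholtzForm, helmholtzForm, h1, h2, P.setIntegral_ΓI_eq hX hp q]

end Setup

namespace Setup

variable {d r : ℕ} {X : Finset (Fin d → ℝ)} (P : Setup d r X)

/-! ### Estimates for the partition of unity -/

lemma exists_ball (hd : 1 ≤ d) {K : ℝ} (hK : 1 ≤ K) (hP : P.Regular K)
    (i : Fin P.mesh.numElem) :
    ∃ (x₀ : E d) (ρ : ℝ), 0 < ρ ∧ Metric.closedBall x₀ ρ ⊆ cellOf (P.mesh.elem i) ∧
      Metric.diam (cellOf (P.mesh.elem i)) ≤ K * ρ := by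
  obtain ⟨x₀, ρ, h1, h2⟩ := hP.1 i
  refine ⟨x₀, ρ, ?_, h1, h2⟩
  -- Shape regularity does not itself demand a positive radius; this follows from the positive
  -- diameter.
  have := diam_cellOf_pos hd (P.mesh.elem i)
  by_contra h
  have h3 : Metric.diam (cellOf (P.mesh.elem i)) ≤ K * ρ := h2
  nlinarith

lemma diam_cell_le_h (i : Fin P.mesh.numElem) : Metric.diam (P.mesh.cell i) ≤ P.mesh.h :=
  le_ciSup (f := fun i => Metric.diam (P.mesh.cell i)) (Set.finite_range _).bddAbove i

lemma χ_variation {K : ℝ} (hK : 1 ≤ K) (hP : P.Regular K) (hδ : 0 < P.δ) (l : Fin P.N)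
    (i : Fin P.mesh.numElem) {x y : E d} (hx : x ∈ P.mesh.cell i) (hy : y ∈ P.mesh.cell i) :
    |P.χ l x - P.χ l y| ≤ K / P.δ * Metric.diam (P.mesh.cell i) := by
  refine P.χ_sub_le (fun z hz => (hP.2.2.2.2 l i z hz).trans ?_) hx hy
  have : P.δ ≤ P.δl l := ciInf_le (Set.finite_range _).bddBelow l
  gcongr

lemma polyFun_fePoly_weight (i : Fin P.mesh.numElem) {ξ : Fin d → ℝ} (hξ : ξ ∈ X)
    (hX : IsReferenceNodeSet (r - 1) X) (w : E d → ℝ) (x : P.Idx → ℝ) :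
    polyFun (P.fePoly i fun p => w p * x p) (refPoint (P.mesh.elem i) ξ) =
      w (refPoint (P.mesh.elem i) ξ) * polyFun (P.fePoly i x) (refPoint (P.mesh.elem i) ξ) := by
  have hmem : refPoint (P.mesh.elem i) ξ ∈ P.mesh.cell i :=
    refPoint_mem_cellOf _ ξ (hX.1 ξ hξ).1 (hX.1 ξ hξ).2
  rw [← P.feFun_eq i _ hmem, ← P.feFun_eq i _ hmem, P.feFun_weight_refPoint i hξ]

/-- The nodal values of `(χ - χ(z)) u` are small multiples of those of `u`. -/
lemma nodal_weight_le {K : ℝ} (hK : 1 ≤ K) (hP : P.Regular K) (hδ : 0 < P.δ)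
    (hX : IsReferenceNodeSet (r - 1) X) (l : Fin P.N) (i : Fin P.mesh.numElem) {z : E d}
    (hz : z ∈ P.mesh.cell i) (x : P.Idx → ℝ) :
    ∀ ξ ∈ X, |polyFun (P.fePoly i fun p => (P.χ l p - P.χ l z) * x p)
        (refPoint (P.mesh.elem i) ξ)| ≤
      K / P.δ * Metric.diam (P.mesh.cell i) *
        |polyFun (P.fePoly i x) (refPoint (P.mesh.elem i) ξ)| := by
  intro ξ hξ
  rw [P.polyFun_fePoly_weight i hξ hX (fun y => P.χ l y - P.χ l z), abs_mul]
  exact mul_le_mul_of_nonneg_right (P.χ_variation hK hP hδ l i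
    (refPoint_mem_cellOf _ ξ (hX.1 ξ hξ).1 (hX.1 ξ hξ).2) hz) (abs_nonneg _)

/-- The energy matrix of an element. -/
def elemEnergy (k : ℝ) (i : Fin P.mesh.numElem) : Matrix P.Idx P.Idx ℝ :=
  P.elemStiffness i + k ^ 2 • P.elemMass i

lemma posSemidef_elemEnergy (k : ℝ) (i : Fin P.mesh.numElem) : (P.elemEnergy k i).PosSemidef :=
  (P.posSemidef_elemStiffness i).add ((P.posSemidef_elemMass i).smul (sq_nonneg k))

lemma rform_elemEnergy (k : ℝ) (i : Fin P.mesh.numElem) (x y : P.Idx → ℝ) :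
    rform (P.elemEnergy k i) x y =
      rform (P.elemStiffness i) x y + k ^ 2 * rform (P.elemMass i) x y := by
  rw [elemEnergy, rform_add_mat, rform_smul_mat]

/-- On an element of diameter `D` the nodal values are multiplied by at most `KD/δ`. The inverse
estimate loses `1/D` in the gradient, and `kD ≤ K` handles the mass term, so both parts of the
energy are `O(δ⁻²)` times the squared `L²` norm, which is at most `k⁻²` times the energy. -/
lemma exists_weight_estimate (d : ℕ) (hd : 1 ≤ d) {r : ℕ} {X : Finset (Fin d → ℝ)}
    (hX : IsReferenceNodeSet (r - 1) X) (K : ℝ) (hK : 1 ≤ K) :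
    ∃ C : ℝ, 0 < C ∧ ∀ (P : Setup d r X) (k : ℝ), 0 < k → P.Regular K → 0 < P.δ →
      k * P.mesh.h ≤ K → ∀ l i z, z ∈ P.mesh.cell i → ∀ x : P.Idx → ℝ,
      rform (P.elemEnergy k i) (fun p => (P.χ l p - P.χ l z) * x p)
        (fun p => (P.χ l p - P.χ l z) * x p) ≤
        (C / (k * P.δ)) ^ 2 * rform (P.elemEnergy k i) x x := by
  obtain ⟨C, hC, hE⟩ := exists_element_estimate hX K hK
  refine ⟨2 * C * K ^ 4 + 1, by positivity, fun P k hk hP hδ hkh l i z hz x => ?_⟩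
  obtain ⟨x₀, ρ, hρ, hball, hdiam⟩ := P.exists_ball hd hK hP i
  have hdiam0 : 0 ≤ Metric.diam (P.mesh.cell i) := Metric.diam_nonneg
  obtain ⟨-, hM, hS⟩ := hE (P.mesh.elem i) x₀ ρ hρ hball hdiam _ _
    (P.totalDegree_fePoly i fun p => (P.χ l p - P.χ l z) * x p) (P.totalDegree_fePoly i x)
    (K / P.δ * Metric.diam (P.mesh.cell i)) (by positivity) (P.nodal_weight_le hK hP hδ hX l i hz x)
  rw [P.rform_elemEnergy, P.rform_elemEnergy, P.rform_elemStiffness, P.rform_elemMass,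
    P.rform_elemMass i x x]
  change _ ≤ _ * ∫ y in P.mesh.cell i, _ at hM
  change _ ≤ _ * ∫ y in P.mesh.cell i, _ at hS
  set I := ∫ y in P.mesh.cell i, polyFun (P.fePoly i x) y * polyFun (P.fePoly i x) y
  have hI : 0 ≤ I := integral_nonneg fun y => mul_self_nonneg _
  have hSx : 0 ≤ rform (P.elemStiffness i) x x := rform_nonneg (P.posSemidef_elemStiffness i) x
  set D := Metric.diam (P.mesh.cell i) with hD
  have hDρ : D ≤ K * ρ := hdiam
  have hkD : k * D ≤ K := (mul_le_mul_of_nonneg_left (P.diam_cell_le_h i) hk.le).trans hkh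
  have h1 : (K / P.δ * D) ^ 2 * (ρ ^ 2)⁻¹ ≤ K ^ 4 / P.δ ^ 2 := by
    rw [← div_eq_mul_inv, div_le_div_iff₀ (by positivity) (by positivity)]
    have h2 : D ^ 2 ≤ (K * ρ) ^ 2 := pow_le_pow_left₀ hdiam0 hDρ 2
    calc (K / P.δ * D) ^ 2 * P.δ ^ 2 = K ^ 2 * D ^ 2 := by field_simp
      _ ≤ K ^ 2 * (K * ρ) ^ 2 := by gcongr
      _ = K ^ 4 * ρ ^ 2 := by ring
  have h2 : k ^ 2 * (K / P.δ * D) ^ 2 ≤ K ^ 4 / P.δ ^ 2 := by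
    have h3 : (k * D) ^ 2 ≤ K ^ 2 := pow_le_pow_left₀ (by positivity) hkD 2
    calc k ^ 2 * (K / P.δ * D) ^ 2 = K ^ 2 / P.δ ^ 2 * (k * D) ^ 2 := by field_simp
      _ ≤ K ^ 2 / P.δ ^ 2 * K ^ 2 := by gcongr
      _ = _ := by ring
  have h3 : C * (K / P.δ * D) ^ 2 * (ρ ^ 2)⁻¹ * I ≤ C * (K ^ 4 / P.δ ^ 2) * I := by
    rw [mul_assoc C]; gcongr
  have h4 : k ^ 2 * (C * (K / P.δ * D) ^ 2 * I) ≤ C * (K ^ 4 / P.δ ^ 2) * I := by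
    calc k ^ 2 * (C * (K / P.δ * D) ^ 2 * I) = C * (k ^ 2 * (K / P.δ * D) ^ 2) * I := by ring
      _ ≤ _ := by gcongr
  -- The gradient and mass parts each contribute `C K⁴/δ²`; the summand `1` lets the total be
  -- bounded by a perfect square.
  have h5 : 2 * C * K ^ 4 ≤ (2 * C * K ^ 4 + 1) ^ 2 := by
    have : 0 ≤ 2 * C * K ^ 4 := by positivity
    nlinarith
  have h6 : 2 * (C * (K ^ 4 / P.δ ^ 2) * I) ≤
      ((2 * C * K ^ 4 + 1) / (k * P.δ)) ^ 2 * (k ^ 2 * I) := by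
    have e : ((2 * C * K ^ 4 + 1) / (k * P.δ)) ^ 2 * (k ^ 2 * I) =
        (2 * C * K ^ 4 + 1) ^ 2 * (I / P.δ ^ 2) := by field_simp
    have e' : 2 * (C * (K ^ 4 / P.δ ^ 2) * I) = 2 * C * K ^ 4 * (I / P.δ ^ 2) := by ring
    rw [e, e']
    gcongr
  have h7 := mul_nonneg (sq_nonneg ((2 * C * K ^ 4 + 1) / (k * P.δ))) hSx
  have h8 := mul_le_mul_of_nonneg_left hM (sq_nonneg k)
  change _ + k ^ 2 * ∫ y in P.mesh.cell i, _ ≤ _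
  change (∫ y in P.mesh.cell i, _) ≤ _ at hS
  change k ^ 2 * (∫ y in P.mesh.cell i, _) ≤ _ at h8
  rw [mul_add]
  linarith

/-- Supremum bounds for polynomials replace a trace inequality. With `D` the element diameter, the
integrand is at most `(D/δ) D⁻ᵈ` times the two `L²` norms and the surface measure is `O(D^(d-1))`,
so the powers of `D` cancel and `1/δ` remains. -/
lemma exists_boundary_estimate (d : ℕ) (hd : 1 ≤ d) {r : ℕ} {X : Finset (Fin d → ℝ)}
    (hX : IsReferenceNodeSet (r - 1) X) (K : ℝ) (hK : 1 ≤ K) :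
    ∃ C : ℝ, 0 < C ∧ ∀ P : Setup d r X, P.Regular K → 0 < P.δ → ∀ l, ∀ x y : P.Idx → ℝ,
      |rform (P.bdryMass l fun _ => 1) x (fun p => P.χ l p * y p) -
        rform (P.bdryMass l (P.χ l)) x y| ≤
        C / P.δ * ∑ i ∈ P.sub l,
          √(rform (P.elemMass i) x x) * √(rform (P.elemMass i) y y) := by
  obtain ⟨C, hC, hE⟩ := exists_element_estimate hX K hK
  obtain ⟨C', hC', hF⟩ := exists_hausdorff_frontier_cellOf_le d hd
  refine ⟨C * C' * K ^ (d + 1), by positivity, fun P hP hδ l x y => ?_⟩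
  choose x₀ ρ hρ hball hdiam using fun i => P.exists_ball hd hK hP i
  have hw1 := P.integrableOn_one_mul_φ hd l
  have hw2 := P.integrableOn_χ_mul_φ hd l
  rw [P.rform_bdryMass l _ hw1, P.rform_bdryMass l _ hw2,
    ← integral_sub (P.integrableOn_feFun l _ hw1 _ _) (P.integrableOn_feFun l _ hw2 _ _)]
  have hD0 : ∀ i, 0 ≤ Metric.diam (P.mesh.cell i) := fun i => Metric.diam_nonneg
  refine (norm_setIntegral_le_sum (P.sub l) (P.locBdry_subset l)
    (b := fun i => √(C * 1 ^ 2 * (ρ i ^ d)⁻¹ * rform (P.elemMass i) x x) *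
      √(C * (K / P.δ * Metric.diam (P.mesh.cell i)) ^ 2 * (ρ i ^ d)⁻¹ *
        rform (P.elemMass i) y y))
    (m := fun i => C' * Metric.diam (P.mesh.cell i) ^ (d - 1))
    (fun i _ => by positivity) (fun i _ => by have := hD0 i; positivity)
    (P.measurableSet_locBdry l) (fun i _ => isClosed_frontier.measurableSet) ?_
    (fun i _ => hF (P.mesh.elem i))).trans ?_
  · rintro i - z ⟨-, hz⟩
    have hzc : z ∈ P.mesh.cell i := by
      rw [(P.isCompact_cell i).isClosed.frontier_eq] at hz; exact hz.1
    -- The weight is frozen at the evaluation point `z` itself, so the integrand is a product of the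
    -- function of `x` and the function with coefficients `(χ(x_p) - χ(z)) y_p`. The bounds are
    -- uniform in `z`.
    have e : (1 : ℝ) * (P.feFun (fun p => P.χ l p * y p) z * P.feFun x z) -
        P.χ l z * (P.feFun y z * P.feFun x z) =
        polyFun (P.fePoly i x) z *
          polyFun (P.fePoly i fun p => (P.χ l p - P.χ l z) * y p) z := by
      rw [← P.feFun_eq i _ hzc, ← P.feFun_eq i _ hzc]
      have : P.feFun (fun p => (P.χ l p - P.χ l z) * y p) z =
          P.feFun (fun p => P.χ l p * y p) z - P.χ l z * P.feFun y z := by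
        simp only [feFun, Finset.mul_sum, ← Finset.sum_sub_distrib]
        exact Finset.sum_congr rfl fun p _ => by ring
      rw [this]; ring
    rw [e, abs_mul]
    have h1 := (hE (P.mesh.elem i) (x₀ i) (ρ i) (hρ i) (hball i) (hdiam i) _ _
      (P.totalDegree_fePoly i x) (P.totalDegree_fePoly i x) 1 zero_le_one
      (fun ξ _ => by rw [one_mul])).1 z hzc
    have h2 := (hE (P.mesh.elem i) (x₀ i) (ρ i) (hρ i) (hball i) (hdiam i) _ _
      (P.totalDegree_fePoly i fun p => (P.χ l p - P.χ l z) * y p) (P.totalDegree_fePoly i y)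
      (K / P.δ * Metric.diam (P.mesh.cell i)) (by have := hD0 i; positivity)
      (P.nodal_weight_le hK hP hδ hX l i hzc y)).1 z hzc
    refine mul_le_mul ?_ ?_ (abs_nonneg _) (Real.sqrt_nonneg _)
    · refine Real.le_sqrt_of_sq_le ?_
      rw [sq_abs, P.rform_elemMass]; exact h1
    · refine Real.le_sqrt_of_sq_le ?_
      rw [sq_abs, P.rform_elemMass]; exact h2
  · rw [Finset.mul_sum]
    refine Finset.sum_le_sum fun i _ => ?_
    have hρd : 0 < ρ i ^ d := pow_pos (hρ i) d
    have hmx : 0 ≤ rform (P.elemMass i) x x := rform_nonneg (P.posSemidef_elemMass i) x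
    have hmy : 0 ≤ rform (P.elemMass i) y y := rform_nonneg (P.posSemidef_elemMass i) y
    set D := Metric.diam (P.mesh.cell i) with hD
    have hDi : 0 ≤ D := hD0 i
    have e1 : √(C * 1 ^ 2 * (ρ i ^ d)⁻¹ * rform (P.elemMass i) x x) *
        √(C * (K / P.δ * D) ^ 2 * (ρ i ^ d)⁻¹ * rform (P.elemMass i) y y) =
        C * (K / P.δ * D) * (ρ i ^ d)⁻¹ *
          (√(rform (P.elemMass i) x x) * √(rform (P.elemMass i) y y)) := by
      have s1 : √(C * 1 ^ 2 * (ρ i ^ d)⁻¹ * rform (P.elemMass i) x x) =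
          √(C * (ρ i ^ d)⁻¹) * √(rform (P.elemMass i) x x) := by
        rw [one_pow, mul_one, Real.sqrt_mul (by positivity)]
      have s2 : √(C * (K / P.δ * D) ^ 2 * (ρ i ^ d)⁻¹ * rform (P.elemMass i) y y) =
          K / P.δ * D * √(C * (ρ i ^ d)⁻¹) * √(rform (P.elemMass i) y y) := by
        rw [Real.sqrt_mul (by positivity)]
        congr 1
        have : C * (K / P.δ * D) ^ 2 * (ρ i ^ d)⁻¹ = (K / P.δ * D) ^ 2 * (C * (ρ i ^ d)⁻¹) := by
          ring
        rw [this, Real.sqrt_mul (sq_nonneg _), Real.sqrt_sq (by positivity)]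
      rw [s1, s2]
      have s3 : √(C * (ρ i ^ d)⁻¹) * √(C * (ρ i ^ d)⁻¹) = C * (ρ i ^ d)⁻¹ :=
        Real.mul_self_sqrt (by positivity)
      calc _ = √(C * (ρ i ^ d)⁻¹) * √(C * (ρ i ^ d)⁻¹) * (K / P.δ * D) *
            (√(rform (P.elemMass i) x x) * √(rform (P.elemMass i) y y)) := by ring
        _ = _ := by rw [s3]; ring
    rw [e1]
    set Q := √(rform (P.elemMass i) x x) * √(rform (P.elemMass i) y y)
    have hQ : 0 ≤ Q := by positivity
    have hDd : D * D ^ (d - 1) ≤ K ^ d * ρ i ^ d := by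
      rw [← pow_succ', Nat.sub_add_cancel hd, ← mul_pow]
      exact pow_le_pow_left₀ hDi (hdiam i) d
    calc C * (K / P.δ * D) * (ρ i ^ d)⁻¹ * Q * (C' * D ^ (d - 1))
        = C * C' * K / P.δ * (ρ i ^ d)⁻¹ * (D * D ^ (d - 1)) * Q := by ring
      _ ≤ C * C' * K / P.δ * (ρ i ^ d)⁻¹ * (K ^ d * ρ i ^ d) * Q := by gcongr
      _ = _ := by
        have : ρ i ≠ 0 := (hρ i).ne'
        field_simp
        ring

/-- A finite element function with vanishing mass on an element has vanishing coefficients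
there. -/
lemma eq_zero_of_rform_elemMass (hd : 1 ≤ d) (hX : IsReferenceNodeSet (r - 1) X) {K : ℝ}
    (hK : 1 ≤ K) (hP : P.Regular K) {i : Fin P.mesh.numElem} {x : P.Idx → ℝ}
    (h : rform (P.elemMass i) x x ≤ 0) {p : P.Idx} (hp : (p : E d) ∈ P.mesh.cell i) : x p = 0 := by
  obtain ⟨C, hC, hE⟩ := exists_element_estimate hX K hK
  obtain ⟨x₀, ρ, hρ, hball, hdiam⟩ := P.exists_ball hd hK hP i
  have h1 := (hE (P.mesh.elem i) x₀ ρ hρ hball hdiam _ _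
      (P.totalDegree_fePoly i x) (P.totalDegree_fePoly i x) 1 zero_le_one
      (fun ξ _ => by rw [one_mul])).1 p hp
  rw [P.rform_elemMass] at h
  have h2 : polyFun (P.fePoly i x) p ^ 2 ≤ 0 :=
    h1.trans (mul_nonpos_of_nonneg_of_nonpos (by positivity) h)
  have h3 : polyFun (P.fePoly i x) p = 0 := by
    have := le_antisymm h2 (sq_nonneg _)
    exact pow_eq_zero_iff two_ne_zero |>.1 this
  rw [← P.feFun_eq i x hp, P.feFun_node] at h3
  exact h3

lemma eq_zero_of_formSeminorm_eq_zero (hd : 1 ≤ d) (hX : IsReferenceNodeSet (r - 1) X) {K k : ℝ}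
    (hK : 1 ≤ K) (hk : 0 < k) (hP : P.Regular K) {i : Fin P.mesh.numElem} {V : P.Idx → ℂ}
    (h : formSeminorm (P.elemEnergy k i) (P.posSemidef_elemEnergy k i) V = 0) {p : P.Idx}
    (hp : (p : E d) ∈ P.mesh.cell i) : V p = 0 := by
  have h1 := formSeminorm_sq (P.posSemidef_elemEnergy k i) V
  rw [h, P.rform_elemEnergy, P.rform_elemEnergy] at h1
  have a1 := rform_nonneg (P.posSemidef_elemStiffness i) fun p => (V p).re
  have a2 := rform_nonneg (P.posSemidef_elemStiffness i) fun p => (V p).im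
  have a3 := rform_nonneg (P.posSemidef_elemMass i) fun p => (V p).re
  have a4 := rform_nonneg (P.posSemidef_elemMass i) fun p => (V p).im
  have hk2 : 0 < k ^ 2 := by positivity
  apply Complex.ext
  · exact P.eq_zero_of_rform_elemMass hd hX hK hP (x := fun p => (V p).re) (by nlinarith) hp
  · exact P.eq_zero_of_rform_elemMass hd hX hK hP (x := fun p => (V p).im) (by nlinarith) hp

end Setup

namespace Setup

variable {d r : ℕ} {X : Finset (Fin d → ℝ)} (P : Setup d r X)

/-! ### Matrix form of the local problems -/

lemma dotProduct_locMatrix (k ε : ℝ) (η : ℂ) (l : Fin P.N) (V W : P.Idx → ℂ) :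
    star W ⬝ᵥ (P.locMatrix k ε η l).mulVec V =
      localForm (P.sub l) P.elemStiffness P.elemMass (P.bdryMass l fun _ => 1)
        ((k : ℂ) ^ 2 + Complex.I * ε) η V W := by
  have e : ∀ p q, star (W p) * (P.locMatrix k ε η l p q * V q) =
      ∑ i ∈ P.sub l, (star (W p) * ((P.elemStiffness i p q : ℂ) * V q) -
        ((k : ℂ) ^ 2 + Complex.I * ε) * (star (W p) * ((P.elemMass i p q : ℂ) * V q))) -
      Complex.I * η * (star (W p) * ((P.bdryMass l (fun _ => 1) p q : ℂ) * V q)) := by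
    intro p q
    rw [P.locMatrix_eq, sub_mul, mul_sub, Finset.sum_mul, Finset.mul_sum]
    congr 1
    · exact Finset.sum_congr rfl fun i _ => by ring
    · ring
  have h1 : star W ⬝ᵥ (P.locMatrix k ε η l).mulVec V =
      ∑ p, ∑ q, star (W p) * (P.locMatrix k ε η l p q * V q) := by
    simp [dotProduct, Matrix.mulVec, Finset.mul_sum]
  rw [h1]
  simp only [e, localForm, cform_eq_sum, Finset.sum_sub_distrib, Finset.mul_sum]
  congr 1
  congr 1
  · rw [Finset.sum_comm]
    refine (Finset.sum_congr rfl fun p _ => Finset.sum_comm).trans ?_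
    rw [Finset.sum_comm]
    exact Finset.sum_congr rfl fun _ _ => Finset.sum_comm
  · rw [Finset.sum_comm]
    refine (Finset.sum_congr rfl fun p _ => Finset.sum_comm).trans ?_
    rw [Finset.sum_comm]
    exact Finset.sum_congr rfl fun _ _ => Finset.sum_comm

open Classical in
/-- Extension of a local vector by zero. -/
def extend (l : Fin P.N) (w : P.LocIdx l → ℂ) : P.Idx → ℂ := fun p =>
  if h : (p : E d) ∈ closure (P.Ωl l) then w ⟨p, h⟩ else 0

/-- The vectors supported on the nodes of a subdomain. -/
def locSpace (l : Fin P.N) : Submodule ℝ (P.Idx → ℂ) where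
  carrier := {V | ∀ p : P.Idx, (p : E d) ∉ closure (P.Ωl l) → V p = 0}
  add_mem' := fun hV hW p hp => by simp [hV p hp, hW p hp]
  zero_mem' := fun _ _ => rfl
  smul_mem' := fun a V hV p hp => by simp [hV p hp]

lemma extend_mem (l : Fin P.N) (w : P.LocIdx l → ℂ) : P.extend l w ∈ P.locSpace l :=
  fun p hp => by simp [extend, hp]

lemma extend_coe (l : Fin P.N) (w : P.LocIdx l → ℂ) (p : P.LocIdx l) :
    P.extend l w (p : P.Idx) = w p := by
  simp [extend, p.2]

lemma weightMap_mem (hX : IsReferenceNodeSet (r - 1) X) (l : Fin P.N) (V : P.Idx → ℂ) :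
    weightMap (fun p : P.Idx => P.χ l p) V ∈ P.locSpace l := by
  intro p hp
  have hpΩ : P.χ l p = 0 := by
    by_contra h
    obtain ⟨i, hi⟩ := P.exists_cell_of_node hX p
    exact hp (P.χ_support l p (P.mesh.cell_subset_closure_Ω i hi) h)
  simp [weightMap, hpΩ]

lemma sum_locIdx (l : Fin P.N) (f : P.Idx → ℂ)
    (hf : ∀ p : P.Idx, (p : E d) ∉ closure (P.Ωl l) → f p = 0) :
    ∑ p : P.LocIdx l, f p = ∑ p, f p := by
  classical
  have h : ∑ p ∈ Finset.univ.filter (fun p : P.Idx => (p : E d) ∈ closure (P.Ωl l)), f p =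
      ∑ p : P.LocIdx l, f p := Finset.sum_subtype _ (by simp) f
  have h2 : ∑ p ∈ Finset.univ.filter (fun p : P.Idx => (p : E d) ∈ closure (P.Ωl l)), f p =
      ∑ p, f p :=
    Finset.sum_subset (Finset.subset_univ _) fun p _ hp => hf p (by simpa using hp)
  rw [← h2, h]

/-- Local unknowns are treated as global vectors supported on the nodes of the subdomain, so that
all subdomains share one vector space. -/
lemma dotProduct_Aloc (k ε : ℝ) (η : ℂ) (l : Fin P.N) (u : P.LocIdx l → ℂ) {W : P.Idx → ℂ}
    (hW : W ∈ P.locSpace l) :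
    ∑ p : P.LocIdx l, star (W p) * (P.Aloc k ε η l).mulVec u p =
      star W ⬝ᵥ (P.locMatrix k ε η l).mulVec (P.extend l u) := by
  have h1 : ∀ p : P.LocIdx l, (P.Aloc k ε η l).mulVec u p =
      (P.locMatrix k ε η l).mulVec (P.extend l u) p := by
    intro p
    simp only [Matrix.mulVec, dotProduct]
    rw [← P.sum_locIdx l (fun q => P.locMatrix k ε η l p q * P.extend l u q)
      fun q hq => by rw [P.extend_mem l u q hq, mul_zero]]
    exact Finset.sum_congr rfl fun q _ => by rw [P.extend_coe]; rfl
  simp only [h1]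
  rw [P.sum_locIdx l (fun p => star (W p) * (P.locMatrix k ε η l).mulVec (P.extend l u) p)
    fun q hq => by rw [hW q hq, star_zero, zero_mul]]
  rfl

lemma R_mulVec (l : Fin P.N) (V : P.Idx → ℂ) (p : P.LocIdx l) :
    (P.R l).mulVec V p = P.χ l ((p : P.Idx) : E d) * V p := by
  simp [Matrix.mulVec, dotProduct, R]

lemma R_transpose_mulVec (l : Fin P.N) (u : P.LocIdx l → ℂ) :
    (P.R l).transpose.mulVec u = weightMap (fun p : P.Idx => P.χ l p) (P.extend l u) := by
  classical
  ext q
  simp only [Matrix.mulVec, dotProduct, Matrix.transpose_apply, R]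
  have h : ∀ p : P.LocIdx l, (if (p : P.Idx) = q then ((P.χ l ((p : P.Idx) : E d) : ℝ) : ℂ) else 0) *
      u p = (if (p : P.Idx) = q then ((P.χ l ((p : P.Idx) : E d) : ℝ) : ℂ) else 0) *
        P.extend l u p := fun p => by rw [P.extend_coe]
  rw [Finset.sum_congr rfl fun p _ => h p]
  rw [P.sum_locIdx l (fun p => (if p = q then ((P.χ l (p : E d) : ℝ) : ℂ) else 0) *
    P.extend l u p) fun p hp => by rw [P.extend_mem l u p hp, mul_zero]]
  simp [weightMap]

end Setup

namespace Setup

variable {d r : ℕ} {X : Finset (Fin d → ℝ)} (P : Setup d r X)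

/-! ### The bound for the field of values -/

lemma innerDk_eq_sum (k : ℝ) (V W : P.Idx → ℂ) :
    P.innerDk k V W = ∑ i, cform (P.elemEnergy k i) V W := by
  have e : ∀ p q, P.Dk k p q = ∑ i, (P.elemEnergy k i p q : ℂ) := by
    intro p q
    rw [P.Dk_eq, Matrix.map_apply, Matrix.sum_apply]
    push_cast
    rfl
  simp only [innerDk, dotProduct, Matrix.mulVec, Pi.star_apply, e, cform_eq_sum, Finset.mul_sum,
    Finset.sum_mul]
  refine (Finset.sum_congr rfl fun p _ => Finset.sum_comm).trans ?_
  rw [Finset.sum_comm]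

lemma normDk_sq (k : ℝ) (V : P.Idx → ℂ) :
    P.normDk k V ^ 2 =
      ∑ i, formSeminorm (P.elemEnergy k i) (P.posSemidef_elemEnergy k i) V ^ 2 := by
  have h : (P.innerDk k V V).re =
      ∑ i, formSeminorm (P.elemEnergy k i) (P.posSemidef_elemEnergy k i) V ^ 2 := by
    rw [P.innerDk_eq_sum, Complex.re_sum]
    exact Finset.sum_congr rfl fun i _ => by
      rw [cform_self_eq_sq (P.posSemidef_elemEnergy k i), Complex.ofReal_re]
  rw [normDk, h, Real.sq_sqrt (Finset.sum_nonneg fun _ _ => sq_nonneg _)]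

lemma normDk_sq_pos (hd : 1 ≤ d) (hX : IsReferenceNodeSet (r - 1) X) {K k : ℝ} (hK : 1 ≤ K)
    (hk : 0 < k) (hP : P.Regular K) {V : P.Idx → ℂ} (hV : V ≠ 0) : 0 < P.normDk k V ^ 2 := by
  rw [P.normDk_sq]
  by_contra h
  apply hV
  have h0 := (Finset.sum_eq_zero_iff_of_nonneg fun i (_ : i ∈ Finset.univ) =>
    sq_nonneg (formSeminorm (P.elemEnergy k i) (P.posSemidef_elemEnergy k i) V)).1
    (le_antisymm (not_lt.1 h) (Finset.sum_nonneg fun _ _ => sq_nonneg _))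
  ext p
  obtain ⟨i, hi⟩ := P.exists_cell_of_node hX p
  exact P.eq_zero_of_formSeminorm_eq_zero hd hX hK hk hP
    (pow_eq_zero_iff two_ne_zero |>.1 (h0 i (Finset.mem_univ i))) hi

/-- Weighted by `χ l`, finite element functions vanish outside of the subdomain. -/
lemma formSeminorm_weightMap_eq_zero (hX : IsReferenceNodeSet (r - 1) X) (k : ℝ) (l : Fin P.N)
    (i : Fin P.mesh.numElem) (hi : i ∉ P.sub l) (V : P.Idx → ℂ) :
    formSeminorm (P.elemEnergy k i) (P.posSemidef_elemEnergy k i)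
      (weightMap (fun p : P.Idx => P.χ l p) V) = 0 := by
  have h : cform (P.elemEnergy k i) (weightMap (fun p : P.Idx => P.χ l p) V)
      (weightMap (fun p : P.Idx => P.χ l p) V) = 0 := by
    rw [cform_eq_sum]
    refine Finset.sum_eq_zero fun p _ => Finset.sum_eq_zero fun q _ => ?_
    by_cases hq : P.χ l (q : E d) = 0
    · simp [weightMap, hq]
    · have : P.elemEnergy k i p q = 0 := by
        simp [elemEnergy, P.elemStiffness_vanish hX hq hi, P.elemMass_vanish hX hq hi]
      simp [this]
  rw [cform_self_eq_sq (P.posSemidef_elemEnergy k i)] at h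
  exact pow_eq_zero_iff two_ne_zero |>.1 (Complex.ofReal_eq_zero.1 h)

/-- An element belongs to at most `Λ` subdomains. -/
lemma card_sub_le_Λ (i : Fin P.mesh.numElem) :
    (Finset.univ.filter fun l => i ∈ P.sub l).card ≤ P.Λ := by
  classical
  rcases (Finset.univ.filter fun l => i ∈ P.sub l).eq_empty_or_nonempty with h | ⟨l, hl⟩
  · simp [h]
  -- All subdomains that contain the element meet the closure of any one of them, at a vertex of the
  -- element.
  · have hl' : i ∈ P.sub l := by simpa using hl
    refine le_trans (Finset.card_le_card ?_) (Finset.le_sup (f := fun l : Fin P.N =>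
      (Finset.univ.filter fun l' : Fin P.N =>
        (closure (P.Ωl l) ∩ closure (P.Ωl l')).Nonempty).card) (Finset.mem_univ l))
    intro l' hl''
    have h2 : i ∈ P.sub l' := by simpa using hl''
    have hv : (P.mesh.elem i).points 0 ∈ P.mesh.cell i :=
      subset_convexHull ℝ _ (Set.mem_range_self 0)
    simp only [Finset.mem_filter, Finset.mem_univ, true_and]
    exact ⟨_, P.cell_subset_closure_Ωl hl' hv, P.cell_subset_closure_Ωl h2 hv⟩

lemma Binv_mul_A_mulVec (k ε : ℝ) (η : ℂ) (V : P.Idx → ℂ) :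
    (P.Binv k ε η * P.A k ε η).mulVec V =
      ∑ l, weightMap (fun p : P.Idx => P.χ l p) (P.extend l
        ((P.Aloc k ε η l)⁻¹.mulVec ((P.R l).mulVec ((P.A k ε η).mulVec V)))) := by
  classical
  rw [← Matrix.mulVec_mulVec, Binv, Matrix.sum_mulVec]
  refine Finset.sum_congr rfl fun l _ => ?_
  rw [← P.R_transpose_mulVec, ← Matrix.mulVec_mulVec, ← Matrix.mulVec_mulVec]

/-- The local solutions satisfy the local variational problems. -/
lemma localForm_local_solution (hX : IsReferenceNodeSet (r - 1) X) (k ε : ℝ) (η : ℂ)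
    (l : Fin P.N) (hA : IsUnit (P.Aloc k ε η l)) (V : P.Idx → ℂ) {W : P.Idx → ℂ}
    (hW : W ∈ P.locSpace l) :
    localForm (P.sub l) P.elemStiffness P.elemMass (P.bdryMass l fun _ => 1)
        ((k : ℂ) ^ 2 + Complex.I * ε) η (P.extend l
        ((P.Aloc k ε η l)⁻¹.mulVec ((P.R l).mulVec ((P.A k ε η).mulVec V)))) W =
      localForm (P.sub l) P.elemStiffness P.elemMass (P.bdryMass l fun _ => 1)
        ((k : ℂ) ^ 2 + Complex.I * ε) η V (weightMap (fun p : P.Idx => P.χ l p) W) := by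
  classical
  rw [← P.dotProduct_locMatrix, ← P.dotProduct_locMatrix, ← P.dotProduct_Aloc k ε η l _ hW,
    Matrix.mulVec_mulVec, Matrix.mul_nonsing_inv _ ((Matrix.isUnit_iff_isUnit_det _).1 hA),
    Matrix.one_mulVec]
  simp only [P.R_mulVec]
  rw [P.sum_locIdx l (fun p => star (W p) * (P.χ l p * (P.A k ε η).mulVec V p))
    fun q hq => by rw [hW q hq, star_zero, zero_mul]]
  refine Finset.sum_congr rfl fun p _ => ?_
  -- The factor `χ l` from the restriction first replaces global rows by local ones; being real, it
  -- then passes through the conjugation onto the test vector.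
  have h : (P.χ l p : ℂ) * (P.A k ε η).mulVec V p =
      (P.χ l p : ℂ) * (P.locMatrix k ε η l).mulVec V p := by
    simp only [Matrix.mulVec, dotProduct, Finset.mul_sum, ← mul_assoc, P.χ_mul_A hX]
  rw [h]
  simp only [weightMap, Pi.star_apply, LinearMap.coe_mk, AddHom.coe_mk, Complex.real_smul,
    star_mul', Complex.star_def, Complex.conj_ofReal]
  ring

/-- A kernel vector, extended by zero and tested with itself, has zero energy on every element of
the subdomain by coercivity, hence vanishes at every node of its closure. -/
lemma isUnit_Aloc (hd : 1 ≤ d) (hX : IsReferenceNodeSet (r - 1) X) {K k ε : ℝ} {η : ℂ}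
    (hK : 1 ≤ K) (hk : 0 < k) (hε : ε ≠ 0) (hP : P.Regular K) (hεk : |ε| ≤ k ^ 2)
    (hη : ImpedanceChoice k ε η) (l : Fin P.N) : IsUnit (P.Aloc k ε η l) := by
  classical
  obtain ⟨Θ, hΘ, hΘ1, hΘz, hΘη⟩ := exists_multiplier hk hε hεk hη
  have hγ : 0 < |ε| / (8 * k ^ 2) := div_pos (abs_pos.2 hε) (by positivity)
  rw [← Matrix.mulVec_injective_iff_isUnit]
  rw [← Matrix.coe_mulVecLin, injective_iff_map_eq_zero]
  intro u hu
  rw [Matrix.mulVecLin_apply] at hu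
  have h1 := P.dotProduct_Aloc k ε η l u (P.extend_mem l u)
  rw [hu, P.dotProduct_locMatrix] at h1
  simp only [Pi.zero_apply, mul_zero, Finset.sum_const_zero] at h1
  have h2 := localForm_coercive (sub := P.sub l) P.posSemidef_elemStiffness
    P.posSemidef_elemMass (P.posSemidef_elemEnergy k)
    (P.posSemidef_bdryMass l _ (P.integrableOn_one_mul_φ hd l) fun _ _ => zero_le_one)
    (fun _ => rfl) hΘ hΘ1 hΘz hΘη (P.extend l u)
  rw [← h1, norm_zero] at h2
  have h3 : ∑ i ∈ P.sub l, formSeminorm (P.elemEnergy k i) (P.posSemidef_elemEnergy k i)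
      (P.extend l u) ^ 2 = 0 :=
    le_antisymm (nonpos_of_mul_nonpos_right h2 hγ) (Finset.sum_nonneg fun _ _ => sq_nonneg _)
  have h4 := (Finset.sum_eq_zero_iff_of_nonneg fun i _ => sq_nonneg _).1 h3
  ext p
  obtain ⟨i, hi, hpi⟩ := Set.mem_iUnion₂.1 (P.closure_Ωl_subset l p.2)
  rw [← P.extend_coe l u p]
  exact P.eq_zero_of_formSeminorm_eq_zero hd hX hK hk hP
    (pow_eq_zero_iff two_ne_zero |>.1 (h4 i hi)) hpi

/-- The lower bound for the field of values in terms of `k / (|ε| δ)`. -/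
theorem exists_fieldOfValuesBound (d : ℕ) (hd : 1 ≤ d) {r : ℕ} {X : Finset (Fin d → ℝ)}
    (hX : IsReferenceNodeSet (r - 1) X) (K : ℝ) (hK : 1 ≤ K) :
    ∃ C : ℝ, 0 < C ∧ ∀ (P : Setup d r X) (k ε : ℝ) (η : ℂ), 0 < k → ε ≠ 0 → 0 < P.δ →
      Admissible P K k ε η → P.FieldOfValuesBound k ε η
        (1 / (P.Λ : ℝ) - C * (k / (|ε| * P.δ)) - C * P.Λ * (k / (|ε| * P.δ)) ^ 2) := by
  classical
  obtain ⟨C₁, hC₁, hW⟩ := exists_weight_estimate d hd hX K hK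
  obtain ⟨C₂, hC₂, hB⟩ := exists_boundary_estimate d hd hX K hK
  -- With `σ = (6 C₁ + 16 C₂)/(kδ)` and `γ = |ε|/(8k²)` the ratio `σ/γ` equals `a k/(|ε|δ)`. The
  -- constant `3a + 4a²` then covers both the linear and the quadratic loss.
  set a := 8 * (6 * C₁ + 16 * C₂) with ha
  have ha0 : 0 < a := by positivity
  refine ⟨3 * a + 4 * a ^ 2, by positivity, ?_⟩
  rintro P k ε η hk hε hδ ⟨hP, hkh, hεk, hη⟩
  have hunit := P.isUnit_Aloc hd hX hK hk hε hP hεk hη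
  refine ⟨fun l => by convert hunit l, fun V hV => ?_⟩
  rw [le_div_iff₀ (P.normDk_sq_pos hd hX hK hk hP hV), P.innerDk_eq_sum]
  obtain ⟨Θ, hΘ, hΘ1, hΘz, hΘη⟩ := exists_multiplier hk hε hεk hη
  have hε0 : 0 < |ε| := abs_pos.2 hε
  set γ := |ε| / (8 * k ^ 2) with hγdef
  have hγ : 0 < γ := div_pos hε0 (by positivity)
  have hγ1 : γ ≤ 1 := by
    rw [hγdef, div_le_one (by positivity)]
    nlinarith [sq_nonneg k]
  have hz : ‖(k : ℂ) ^ 2 + Complex.I * ε‖ ≤ 2 * k ^ 2 := by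
    refine (norm_add_le _ _).trans ?_
    simp only [norm_pow, norm_mul, Complex.norm_I, Complex.norm_real, Real.norm_eq_abs, sq_abs,
      one_mul]
    linarith
  have hηk := norm_impedance_le hk hεk hη
  set s := C₁ / (k * P.δ) with hs
  have hs0 : 0 < s := by positivity
  set τ := C₂ / P.δ with hτdef
  have hτ0 : 0 < τ := by positivity
  set σ := 6 * s + 16 * τ / k with hσ
  have hτk : 0 < τ / k := by positivity
  have hσ0 : 0 < σ := by positivity
  have hvert : ∀ i, (P.mesh.elem i).points 0 ∈ P.mesh.cell i := fun i =>
    subset_convexHull ℝ _ (Set.mem_range_self 0)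
  -- The elementwise weight is the value of `χ l` at a vertex. One and the same point of the element
  -- serves all `l`, so that the weights inherit the partition of unity property.
  set c : Fin P.N → Fin P.mesh.numElem → ℝ := fun l i => P.χ l ((P.mesh.elem i).points 0)
  have hcl : ∀ i, (P.mesh.elem i).points 0 ∈ closure P.mesh.Ω := fun i =>
    P.mesh.cell_subset_closure_Ω i (hvert i)
  have hc0 : ∀ l i, 0 ≤ c l i := fun l i => (P.χ_mem l _ (hcl i)).1
  have hTs : ∀ l i V, formSeminorm (P.elemEnergy k i) (P.posSemidef_elemEnergy k i)
      (weightMap (fun p : P.Idx => P.χ l p) V - c l i • V) ≤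
      s * formSeminorm (P.elemEnergy k i) (P.posSemidef_elemEnergy k i) V := fun l i V =>
    formSeminorm_weightMap_sub_le (P.posSemidef_elemEnergy k i) _ _ _ hs0.le
      (hW P k hk hP hδ hkh l i _ (hvert i)) V
  have hG : ∀ l, (P.bdryMass l fun _ => 1).PosSemidef := fun l =>
    P.posSemidef_bdryMass l _ (P.integrableOn_one_mul_φ hd l) fun _ _ => zero_le_one
  have hG' : ∀ l, (P.bdryMass l (P.χ l)).PosSemidef := fun l =>
    P.posSemidef_bdryMass l _ (P.integrableOn_χ_mul_φ hd l) fun y hy =>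
      (P.χ_mem l y (P.locBdry_subset_closure l hy)).1
  have key := schwarz_lower_bound
    (fun i => formSeminorm (P.elemEnergy k i) (P.posSemidef_elemEnergy k i))
    (fun i => cform (P.elemEnergy k i)) (fun i => cform_add_right _)
    (fun i V t W => cform_smul_right _ t V W)
    (fun i => norm_cform_le (P.posSemidef_elemEnergy k i))
    (fun i => cform_self_eq_sq (P.posSemidef_elemEnergy k i))
    (fun l => weightMap fun p : P.Idx => P.χ l p) c P.sub
    (fun l => localForm (P.sub l) P.elemStiffness P.elemMass (P.bdryMass l fun _ => 1)
        ((k : ℂ) ^ 2 + Complex.I * ε) η)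
    (fun l => localForm_sub_left _ _ _ _ _ _) P.locSpace (P.weightMap_mem hX) σ γ hσ0 hγ hγ1
    (fun l i V => (hTs l i V).trans (mul_le_mul_of_nonneg_right (by
      rw [hσ, mul_div_assoc]; linarith) (apply_nonneg _ _)))
    (fun l i V hi => P.formSeminorm_weightMap_eq_zero hX k l i hi V)
    (fun l => norm_localForm_comm_le P.posSemidef_elemStiffness P.posSemidef_elemMass
      (P.posSemidef_elemEnergy k) (hG l) (hG' l) (fun _ => rfl) hk hz hηk hτ0.le (hTs l)
      (hB P hP hδ l))
    (fun l => localForm_coercive P.posSemidef_elemStiffness P.posSemidef_elemMass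
      (P.posSemidef_elemEnergy k) (hG l) (fun _ => rfl) hΘ hΘ1 hΘz hΘη)
    (fun l V => (localForm_weighted_coercive P.posSemidef_elemStiffness P.posSemidef_elemMass
      (P.posSemidef_elemEnergy k) (hG' l) (fun _ => rfl) hk hz hηk hτ0.le (hTs l)
      (hB P hP hδ l) hΘ hΘ1 hΘz hΘη (hc0 l) V).trans (add_le_add_right
        (mul_le_mul_of_nonneg_right (by rw [hσ, mul_div_assoc, mul_div_assoc]; linarith)
          (Finset.sum_nonneg fun _ _ => sq_nonneg _)) _))
    hc0 (fun i => P.χ_sum _ (hcl i)) (fun l i hi => P.χ_eq_zero hi (hvert i)) P.Λ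
    P.card_sub_le_Λ V
    (fun l => P.extend l
        ((P.Aloc k ε η l)⁻¹.mulVec ((P.R l).mulVec ((P.A k ε η).mulVec V))))
    (fun l => P.extend_mem l _)
    (fun l W hWl => P.localForm_local_solution hX k ε η l (hunit l) V hWl)
  have hsum : ∀ i, cform (P.elemEnergy k i) V ((P.Binv k ε η * P.A k ε η).mulVec V) =
      ∑ l, cform (P.elemEnergy k i) V (weightMap (fun p : P.Idx => P.χ l p) (P.extend l
        ((P.Aloc k ε η l)⁻¹.mulVec ((P.R l).mulVec ((P.A k ε η).mulVec V))))) := by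
    intro i
    rw [P.Binv_mul_A_mulVec]
    simp only [cform, star_sum, sum_dotProduct]
  rw [← P.normDk_sq, Finset.sum_comm] at key
  simp only [hsum]
  refine le_trans (mul_le_mul_of_nonneg_right ?_ (sq_nonneg _)) key
  have hθ : σ / γ = a * (k / (|ε| * P.δ)) := by
    rw [hσ, hs, hτdef, hγdef, ha]
    field_simp
  rw [hθ]
  have hθ0 : 0 < k / (|ε| * P.δ) := by positivity
  set θ := k / (|ε| * P.δ)
  have h1 : 0 ≤ a ^ 2 * θ := by positivity
  have h2 : 0 ≤ a * (P.Λ * θ ^ 2) := by positivity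
  nlinarith

end Setup

/-! ### From the bound in `k/(|ε|δ)` to the two parameter regimes -/

/-- The quotient in the bound is nonnegative, so every nonpositive lower bound comes for free. The
maximum with `0` makes the degenerate cases below trivial. -/
lemma Setup.FieldOfValuesBound.mono {d r : ℕ} {X : Finset (Fin d → ℝ)} {P : Setup d r X}
    {k ε : ℝ} {η : ℂ} {c c' : ℝ} (h : P.FieldOfValuesBound k ε η c) (hc : c' ≤ max c 0) :
    P.FieldOfValuesBound k ε η c' :=
  ⟨h.1, fun V hV => hc.trans (max_le (h.2 V hV) (div_nonneg (norm_nonneg _) (sq_nonneg _)))⟩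

/-- Counting powers: `k · k^(-1-β) · k^α = k^(α-β)`, with one factor `K` for each of the three
comparisons. -/
lemma fieldOfValues_parameter_le {K k ε δ H α β : ℝ} (hK : 1 ≤ K) (hk : 0 < k)
    (hε : k ^ (1 + β) ≤ K * |ε|) (hδ : H ≤ K * δ) (hH : k ^ (-α) ≤ K * H) :
    ε ≠ 0 ∧ 0 < δ ∧ k / (|ε| * δ) ≤ K ^ 3 * k ^ (α - β) := by
  have hK0 : 0 < K := by linarith
  have h1 : 0 < k ^ (1 + β) := Real.rpow_pos_of_pos hk _
  have h2 : 0 < k ^ (-α) := Real.rpow_pos_of_pos hk _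
  have hε0 : 0 < |ε| := pos_of_mul_pos_right (h1.trans_le hε) hK0.le
  have hδ' : k ^ (-α) ≤ K ^ 2 * δ := by nlinarith
  have hδ0 : 0 < δ := pos_of_mul_pos_right (h2.trans_le hδ') (by positivity)
  refine ⟨abs_pos.1 hε0, hδ0, ?_⟩
  rw [div_le_iff₀ (by positivity)]
  have e : k = k ^ (α - β) * (k ^ (1 + β) * k ^ (-α)) := by
    rw [← Real.rpow_add hk, ← Real.rpow_add hk]
    ring_nf
    exact (Real.rpow_one k).symm
  calc k = k ^ (α - β) * (k ^ (1 + β) * k ^ (-α)) := e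
    _ ≤ k ^ (α - β) * ((K * |ε|) * (K ^ 2 * δ)) := by gcongr
    _ = K ^ 3 * k ^ (α - β) * (|ε| * δ) := by ring

end Helmholtz

end

theorem corollary3p13 (d : ℕ) (hd : d = 2 ∨ d = 3) (r : ℕ) (hr : 2 ≤ r)
    (X : Finset (Fin d → ℝ)) (hX : Helmholtz.IsReferenceNodeSet (r - 1) X)
    (K : ℝ) (hK : 1 ≤ K) :
    (∀ α β : ℝ, 0 < α → α < 1 → 0 < β → β < 1 →
      ∃ C : ℝ, 0 < C ∧ ∀ L : ℕ, ∃ k₀ : ℝ, 0 < k₀ ∧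
        ∀ (P : Helmholtz.Setup d r X) (k ε : ℝ) (η : ℂ),
          Helmholtz.Admissible P K k ε η → P.Λ = L → k₀ ≤ k →
          Helmholtz.Comparable K |ε| (k ^ (1 + β)) →
          Helmholtz.Comparable K P.δ P.H →
          Helmholtz.Comparable K P.H (k ^ (-α)) →
          P.FieldOfValuesBound k ε η (1 / (L : ℝ) - C * k ^ (α - β))) ∧
    (∀ δ : ℝ, 0 < δ → ∀ L : ℕ,
      ∃ C k₀ : ℝ, 0 < C ∧ 0 < k₀ ∧
        ∀ (P : Helmholtz.Setup d r X) (k ε : ℝ) (η : ℂ),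
          Helmholtz.Admissible P K k ε η → P.Λ = L → P.δ = δ →
          |ε| = C * k → k₀ ≤ k →
          P.FieldOfValuesBound k ε η (1 / (2 * (L : ℝ)))) := by
  have hd1 : 1 ≤ d := by omega
  obtain ⟨C, hC, hF⟩ := Helmholtz.Setup.exists_fieldOfValuesBound d hd1 hX K hK
  have hK0 : 0 < K := by linarith
  constructor
  · intro α β _ _ _ _
    -- The linear and the quadratic loss each cost `C K³ k^(α-β)`; the summand `1` makes the claimed
    -- bound nonpositive when `α ≥ β`.
    refine ⟨1 + 2 * C * K ^ 3, by positivity, fun L => ?_⟩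
    -- This is where the threshold depends on `Λ`: for large `k` one factor of the small parameter
    -- absorbs `Λ` in the quadratic term.
    obtain ⟨k₁, hk₁⟩ : ∃ k₁ : ℝ, ∀ k, k₁ ≤ k → α < β → L * (K ^ 3 * k ^ (α - β)) ≤ 1 := by
      by_cases hαβ : α < β
      · have h := ((tendsto_rpow_neg_atTop (sub_pos.2 hαβ)).const_mul (K ^ 3)).const_mul (L : ℝ)
        rw [mul_zero, mul_zero] at h
        obtain ⟨k₁, h1⟩ := Filter.eventually_atTop.1 (h.eventually_le_const zero_lt_one)
        refine ⟨k₁, fun k hk _ => ?_⟩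
        have := h1 k hk
        rwa [neg_sub] at this
      · exact ⟨0, fun _ _ h => absurd h hαβ⟩
    refine ⟨max 1 k₁, by positivity, fun P k ε η hadm hΛ hk hε hδH hH => ?_⟩
    have hk1 : 1 ≤ k := (le_max_left _ _).trans hk
    have hk0 : 0 < k := by linarith
    obtain ⟨hε0, hδ0, hθ⟩ := Helmholtz.fieldOfValues_parameter_le hK hk0 hε.2 hδH.2 hH.2
    refine (hF P k ε η hk0 hε0 hδ0 hadm).mono ?_
    rw [hΛ]
    have hθ0 : 0 ≤ k / (|ε| * P.δ) := by positivity
    set θ := k / (|ε| * P.δ)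
    have hs0 : 0 < k ^ (α - β) := Real.rpow_pos_of_pos hk0 _
    rcases lt_or_ge α β with hαβ | hαβ
    · refine le_max_of_le_left ?_
      have h1 := hk₁ k ((le_max_right _ _).trans hk) hαβ
      set t := K ^ 3 * k ^ (α - β)
      have h2 : (L : ℝ) * θ ^ 2 ≤ t := by
        calc (L : ℝ) * θ ^ 2 ≤ L * t ^ 2 := by gcongr
          _ = L * t * t := by ring
          _ ≤ 1 * t := by gcongr
          _ = t := one_mul t
      have h3 := mul_le_mul_of_nonneg_left h2 hC.le
      have h4 := mul_le_mul_of_nonneg_left hθ hC.le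
      have e : (1 + 2 * C * K ^ 3) * k ^ (α - β) = k ^ (α - β) + 2 * (C * t) := by
        simp only [t]; ring
      rw [e, mul_assoc C]
      linarith
    -- Here `k^(α-β) ≥ 1 ≥ 1/Λ`, so there is nothing to prove.
    · refine le_max_of_le_right ?_
      have h1 : 1 ≤ k ^ (α - β) := Real.one_le_rpow hk1 (by linarith)
      have h2 : 1 / (L : ℝ) ≤ 1 := by
        rw [one_div]; exact Nat.cast_inv_le_one L
      have h3 : 0 ≤ 2 * C * K ^ 3 * k ^ (α - β) := by positivity
      linarith
  · intro δ hδ L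
    -- Chosen so that `k/(|ε|δ) = 1/(4(L+1)(C+1))`; the linear and the quadratic loss are then at
    -- most `1/(4L)` each.
    refine ⟨4 * (L + 1) * (C + 1) / δ, 1, by positivity, one_pos,
      fun P k ε η hadm hΛ hPδ hε hk => ?_⟩
    have hk0 : 0 < k := by linarith
    have hε0 : 0 < |ε| := by rw [hε]; positivity
    refine (hF P k ε η hk0 (abs_pos.1 hε0) (hPδ ▸ hδ) hadm).mono ?_
    -- For `L = 0` the quotient `1/(2L)` is `0` by convention and the bound is trivial.
    rcases Nat.eq_zero_or_pos L with hL | hL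
    · exact le_max_of_le_right (by simp [hL])
    refine le_max_of_le_left ?_
    have hL1 : (1 : ℝ) ≤ L := by exact_mod_cast hL
    have hθ : k / (|ε| * P.δ) = 1 / (4 * (L + 1) * (C + 1)) := by
      rw [hε, hPδ]; field_simp
    rw [hΛ, hθ]
    set θ := 1 / (4 * ((L : ℝ) + 1) * (C + 1))
    have hθ0 : 0 < θ := by positivity
    have h1 : C * θ ≤ 1 / (4 * L) := by
      rw [mul_one_div, div_le_div_iff₀ (by positivity) (by positivity)]
      nlinarith
    have h2 : L * θ ≤ 1 := by
      rw [mul_one_div, div_le_one (by positivity)]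
      nlinarith
    have h3 : C * L * θ ^ 2 ≤ 1 / (4 * L) := by
      calc C * L * θ ^ 2 = C * θ * (L * θ) := by ring
        _ ≤ 1 / (4 * L) * 1 := by gcongr
        _ = _ := mul_one _
    have e : 1 / (L : ℝ) = 1 / (2 * L) + 2 * (1 / (4 * L)) := by field_simp; norm_num
    linarith
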